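/- **Conventions.** Let $\mathbf\Sigma=(N,\Sigma,\rho)$ be a stacky fan: $N$ is a finitely generated abelian group, $\Sigma$ a rational simplicial fan in $N\otimes\mathbb R$, and $\rho:\mathbb Z^n\to N$ a homomorphism with finite cokernel such that the images $\bar\rho_i$ of $\rho_i=\rho(e_i)$ in $N\otimes\mathbb R$ span the distinct rays of $\Sigma$. A cone $\sigma$ is identified with $\{i:\bar\rho_i\in\sigma\}$. Let $\mathcal X(\mathbf\Sigma)=[\mathcal U/G]$ be the associated toric Deligne–Mumford stack over $\mathbb C$, where $\mathcal U\subset\mathbb C^n$ is the set of points $z$ such that $\{i:z_i=0\}$ is a cone of $\Sigma$, $G=\operatorname{Hom}(\mathbb L^\vee,\mathbb C^\times)$ and $\mathbb L^\vee=H^1(\operatorname{Cone}(\rho)^*)$ is the Gale dual. Let $\mathcal X(\mathbf\Sigma)_\sigma=\{z_i=0,\ i\in\sigma\}/G$, and let $D_i$ be the line bundle (or divisor) of the coordinate $z_i$. For $\sigma\in\Sigma$ let $\operatorname{Box}(\sigma)$ be the set of $b\in N$ with $\bar b=\sum_{i\in\sigma}b_i\bar\rho_i$, $0\le b_i<1$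 (and put $b_i=0$ for $i\notin\sigma$); $b$ corresponds to the element of $G$ that acts on $z_i$ by $e^{2\pi\sqrt{-1}\,b_i}$ and takes the class of $(u,\chi)$ in $\mathbb L^\vee$ to $e^{2\pi\sqrt{-1}(\sum u_ib_i-\chi(b))}$, where $\mathbb L^\vee$ is described as the group of pairs $(u,\chi)\in\mathbb Q^n\times\operatorname{Hom}(N,\mathbb Q/\mathbb Z)$ with $u_i\equiv\chi(\rho_i)$ modulo $\operatorname{Hom}(N,\mathbb Q)$. The involution of $\operatorname{Box}(\sigma)$ induced by inversion on the inertia stack is $\hat b=\sum_{b_i\ne0}\rho_i-b$. Let $\langle c\rangle$ denote the fractional part of $c$. Let $\mathbb P_{r_1,r_2}$ be the orbifold $\mathbb P^1$ with isotropy groups $\mu_{r_1}$ at $0$, $\mu_{r_2}$ at $\infty$ and no others, i.e. the toric stack of the complete fan in $\mathbb R$ with $N=\mathbb Z$, $\rho=(-r_1,r_2)$. By a toric morphism $f:\mathbb P_{r_1,r_2}\to\mathcal X(\mathbf\Sigma)$ we mean here one that maps the open torus $\mathbb C^\times$ of $\mathbb P_{r_1,r_2}$ to a one-dimensional torus orbit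 $O_\tau$ of $\mathcal X(\mathbf\Sigma)$ by a homomorphism of groups; here $O_\tau=\{z: z_i=0\Leftrightarrow i\in\tau\}/G$, with $\tau$ a cone of codimension one, is a group under coordinatewise multiplication. Representable morphisms are those that are injective on isotropy groups. Morphisms are considered up to 2-isomorphism. We say that $f|_0$ (resp. $f|_\infty$) gives the box element $b$ if the generator $e^{2\pi\sqrt{-1}/r_1}$ of $\mu_{r_1}$ (resp. $e^{2\pi\sqrt{-1}/r_2}$ of $\mu_{r_2}$) is mapped to the element of $G$ that corresponds to $b$. **(A) One-dimensional targets.** Suppose that $\Sigma$ is complete and of dimension $1$, with cones $\sigma_1=\langle\bar\rho_1\rangle$, $\sigma_2=\langle\bar\rho_2\rangle$, and let $w_2\rho_1+w_1\rho_2=0$, $w_1,w_2\in\mathbb Z_{>0}$, be the minimal integral relation between $\rho_1$ and $\rho_2$ in $N$ (the generator of the relations). Then the following three kinds of data correspond bijectively: (a) (isomorphism classes of) representable toric morphisms $f:\mathbb P_{r_1,r_2}\to\mathcal X(\mathbf\Sigma)$, for some $r_1,r_2\geq 1$, with $f(0)=\mathcal X(\mathbf\Sigma)_{\sigma_1}$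 and $f(\infty)=\mathcal X(\mathbf\Sigma)_{\sigma_2}$; (b) box elements $b_1\in\operatorname{Box}(\sigma_1)$, $b_2\in\operatorname{Box}(\sigma_2)$ and non-negative integers $q_1,q_2$ with $q_1\rho_1+q_2\rho_2+b_1+b_2=0$ in $N$, where $q_1,q_2,\bar b_1,\bar b_2$ are not all zero; (c) a box element $b_1\in\operatorname{Box}(\sigma_1)$ and a rational number $l>0$ such that $w_2l-f_1$ is a non-negative integer, where $\bar b_1=f_1\bar\rho_1$. The bijections can be chosen so that corresponding data are related as follows, with $\bar b_i=f_i\bar\rho_i$: $f|_0$ gives $b_1$ and $f|_\infty$ gives $b_2$; $b_1$ is the same in (b) and (c); $r_i$ is the order of $b_i$ in $N/\mathbb Z\rho_i$; $\deg f^*D_1=w_2l$ and $\deg f^*D_2=w_1l$; $l=(q_2+f_2)/w_1=(q_1+f_1)/w_2$; $q_1=\lfloor lw_2\rfloor$, $q_2=\lfloor lw_1\rfloor$, $f_1=\langle lw_2\rangle$, $f_2=\langle lw_1\rangle$. **(B) General targets.** Let $\mathbf\Sigma$ be any stacky fan, let $\sigma,\sigma'\in\Sigma$ be top-dimensional cones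 that meet along a face of codimension one, let $j$ be the unique index with $\bar\rho_j\in\sigma$, $\bar\rho_j\notin\sigma'$, and let $b\in\operatorname{Box}(\sigma)$. Then $f\mapsto c=\deg f^*D_j$ is a bijection from the set of (isomorphism classes of) representable toric morphisms $f:\mathbb P_{r_1,r_2}\to\mathcal X(\mathbf\Sigma)$, for some $r_1,r_2\ge1$, such that $f(0)=\mathcal X(\mathbf\Sigma)_\sigma$, $f(\infty)=\mathcal X(\mathbf\Sigma)_{\sigma'}$ and $f|_0$ gives the box element $\hat b$, to the set of positive rational numbers $c$ with $\langle c\rangle=\hat b_j$. -/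

import Mathlib

open scoped TensorProduct

noncomputable section

/-- The real vector space `N ⊗ ℝ` of a finitely generated abelian group `N`. -/
abbrev RealSpan (N : Type*) [AddCommGroup N] : Type _ := ℝ ⊗[ℤ] N

/-- The image `c̄` of `c : N` in `N ⊗ ℝ`. -/
def toReal {N : Type*} [AddCommGroup N] (c : N) : RealSpan N := (1 : ℝ) ⊗ₜ[ℤ] c

/-- The cone `∑_{i ∈ σ} ℝ_{≥ 0} ρ̄ᵢ`. -/
def coneHull {N : Type*} [AddCommGroup N] {n : ℕ} (ρ : Fin n → N) (σ : Finset (Fin n)) :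
    Set (RealSpan N) :=
  {v | ∃ a : Fin n → ℝ, (∀ i, 0 ≤ a i) ∧ (∀ i ∉ σ, a i = 0) ∧ v = ∑ i, a i • toReal (ρ i)}

/-- A stacky fan `(N, Σ, ρ)`. The homomorphism `ρ : ℤⁿ → N` is given by the images `ρᵢ` of the
standard basis vectors. The rays of the simplicial fan `Σ` are the rays spanned by the `ρ̄ᵢ`, and a
cone of `Σ` is recorded by the set `σ` of the indices of its rays, so that the cone itself
is `coneHull ρ σ`; its faces are the cones of the subsets of `σ`. -/
structure StackyFan (N : Type*) [AddCommGroup N] (n : ℕ) where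
  ρ : Fin n → N
  finite_coker : Finite (N ⧸ AddSubgroup.closure (Set.range ρ))
  cones : Set (Finset (Fin n))
  empty_mem : ∅ ∈ cones
  ray_mem : ∀ i, {i} ∈ cones
  face_mem : ∀ σ ∈ cones, ∀ τ ⊆ σ, τ ∈ cones
  simplicial : ∀ σ ∈ cones, LinearIndependent ℝ (fun i : σ => toReal (ρ i))
  inter_face : ∀ σ ∈ cones, ∀ σ' ∈ cones,
    coneHull ρ σ ∩ coneHull ρ σ' = coneHull ρ (σ ∩ σ')

namespace StackyFan

variable {N : Type*} [AddCommGroup N] {n : ℕ} (X : StackyFan N n)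

/-- The rank of `N`, i.e. the dimension of the toric stack. -/
def dim (_X : StackyFan N n) : ℕ := Module.finrank ℝ (RealSpan N)

/-- `σ | σ'`: top-dimensional cones that meet along a face of codimension one. -/
def Adjacent (σ σ' : Finset (Fin n)) : Prop :=
  σ ∈ X.cones ∧ σ' ∈ X.cones ∧ σ.card = X.dim ∧ σ'.card = X.dim ∧ (σ ∩ σ').card + 1 = X.dim

/-- The fan is complete: its support is all of `N ⊗ ℝ`. -/
def Complete : Prop := ∀ v : RealSpan N, ∃ σ ∈ X.cones, v ∈ coneHull X.ρ σ

/-! ### The group `G` -/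

/-- The 1-cocycles of `RHom(Cone(ρ), ℤ)`, computed with the injective resolution `ℚ → ℚ/ℤ` of `ℤ`:
pairs `(u, χ) ∈ Hom(ℤⁿ, ℚ) × Hom(N, ℚ/ℤ)` such that `χ ∘ ρ` is the reduction of `u`. -/
def cocycles : AddSubgroup ((Fin n → ℚ) × (N →+ AddCircle (1 : ℚ))) where
  carrier := {p | ∀ i, ((p.1 i : ℚ) : AddCircle (1 : ℚ)) = p.2 (X.ρ i)}
  zero_mem' := by intro i; simp
  add_mem' := by
    intro p q hp hq i
    simp only [Set.mem_ofPred_eq] at hp hq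
    simp [← hp i, ← hq i]
  neg_mem' := by
    intro p hp i
    simp only [Set.mem_ofPred_eq] at hp
    simp [← hp i]

/-- The coboundary map `Hom(N, ℚ) → Hom(ℤⁿ, ℚ) × Hom(N, ℚ/ℤ)`, `v ↦ (v ∘ ρ, v mod ℤ)`. -/
def coboundary : (N →+ ℚ) →+ X.cocycles where
  toFun v := ⟨(fun i => v (X.ρ i), (QuotientAddGroup.mk' _).comp v), fun _ => rfl⟩
  map_zero' := by
    apply Subtype.ext
    refine Prod.ext (funext fun i => rfl) (AddMonoidHom.ext fun x => ?_)
    simp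
  map_add' v w := by
    apply Subtype.ext
    refine Prod.ext (funext fun i => rfl) (AddMonoidHom.ext fun x => ?_)
    simp

/-- The group `𝕃^∨ = H¹(Cone(ρ)^*)`, the Gale dual; it is the Picard group of the toric stack. -/
def LDual : Type _ := X.cocycles ⧸ X.coboundary.range

instance : AddCommGroup X.LDual :=
  inferInstanceAs (AddCommGroup (X.cocycles ⧸ X.coboundary.range))

/-- The class in `𝕃^∨` of a cocycle. -/
def toLDual : X.cocycles →+ X.LDual := QuotientAddGroup.mk' _

/-- The homomorphism on `𝕃^∨` induced by a homomorphism that vanishes on the coboundaries. -/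
def liftLDual {A : Type*} [AddCommGroup A] (φ : X.cocycles →+ A)
    (h : ∀ v, φ (X.coboundary v) = 0) : X.LDual →+ A :=
  QuotientAddGroup.lift _ φ (by
    rintro _ ⟨v, rfl⟩
    exact h v)

/-- `Dᵢ = ρ^∨(uᵢ) ∈ 𝕃^∨`, the image of the `i`-th vector of the dual standard basis. -/
def D (i : Fin n) : X.LDual :=
  X.toLDual ⟨(Pi.single i 1, 0), by
    intro k
    by_cases h : k = i
    · subst h
      simp [AddCircle.coe_period]
    · simp [h]⟩

/-- `G = Hom(𝕃^∨, ℂ^×)`, as a group of `ℂ`-valued (hence nowhere zero) characters. -/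
abbrev G : Type _ := AddChar X.LDual ℂ

/-- The action of `G` on `ℂⁿ` through `α : G → (ℂ^×)ⁿ`, `g ↦ (g(D₁), …, g(Dₙ))`. -/
def act (g : X.G) (z : Fin n → ℂ) : Fin n → ℂ := fun i => g (X.D i) * z i

/-- The set of anti-cones. -/
def anticones : Set (Finset (Fin n)) := {I | Iᶜ ∈ X.cones}

/-- `U_𝒜 = ℂⁿ ∖ ⋃_{I ∉ 𝒜} ℂ^I` where `ℂ^I = {z | zᵢ = 0 for all i ∉ I}`. The toric stack of `X`
is the quotient stack `[U_𝒜 / G]`. -/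
def U : Set (Fin n → ℂ) := {z | ∀ I ∉ X.anticones, ¬ ∀ i ∉ I, z i = 0}

lemma act_mem (g : X.G) {z : Fin n → ℂ} (hz : z ∈ X.U) : X.act g z ∈ X.U := by
  intro I hI h
  refine hz I hI fun i hi => ?_
  have h1 := h i hi
  rcases mul_eq_zero.1 h1 with h2 | h2
  · exact absurd h2 (g.val_isUnit _).ne_zero
  · exact h2

/-- The action of `G` on `U_𝒜`. -/
def actU (g : X.G) (z : X.U) : X.U := ⟨X.act g z, X.act_mem g z.2⟩

/-! ### Box elements -/

/-- `Box(σ)`. -/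
def Box (σ : Finset (Fin n)) : Set N :=
  {b | ∃ a : Fin n → ℝ, (∀ i, 0 ≤ a i ∧ a i < 1) ∧ (∀ i ∉ σ, a i = 0) ∧
    ∑ i, a i • toReal (X.ρ i) = toReal b}

variable {X} in
/-- The coordinates `bᵢ ∈ [0, 1)` of a box element `b`, `b̄ = ∑ bᵢ ρ̄ᵢ` with `bᵢ = 0` for `i ∉ σ`;
they are unique if `σ` is a cone of the fan. -/
def Box.coord {σ : Finset (Fin n)} (b : X.Box σ) : Fin n → ℝ := b.2.choose

variable {X} in
lemma Box.coord_spec {σ : Finset (Fin n)} (b : X.Box σ) :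
    (∀ i, 0 ≤ Box.coord b i ∧ Box.coord b i < 1) ∧ (∀ i ∉ σ, Box.coord b i = 0) ∧
      ∑ i, Box.coord b i • toReal (X.ρ i) = toReal (b : N) := b.2.choose_spec

/-- The map `ℚ/ℤ → ℝ/ℤ`. -/
def ratToRealCircle : AddCircle (1 : ℚ) →+ AddCircle (1 : ℝ) :=
  QuotientAddGroup.map _ _ (Rat.castHom ℝ).toAddMonoidHom (by
    rw [AddSubgroup.zmultiples_le]
    exact ⟨1, by simp⟩)

/-- The pairing of `(a, b) ∈ ℝⁿ × N` with `(u, χ)`, namely `∑ uᵢ aᵢ - χ(b) ∈ ℝ/ℤ`. -/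
def preLog (a : Fin n → ℝ) (b : N) : X.cocycles →+ AddCircle (1 : ℝ) where
  toFun p := ((∑ i, (p.1.1 i : ℝ) * a i : ℝ) : AddCircle (1 : ℝ)) - ratToRealCircle (p.1.2 b)
  map_zero' := by simp
  map_add' p q := by
    simp only [AddSubgroup.coe_add, Prod.fst_add, Prod.snd_add, Pi.add_apply, Rat.cast_add,
      add_mul, Finset.sum_add_distrib, AddMonoidHom.add_apply, map_add, AddCircle.coe_add]
    abel

lemma preLog_coboundary (a : Fin n → ℝ) (b : N) (h : ∑ i, a i • toReal (X.ρ i) = toReal b)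
    (v : N →+ ℚ) : X.preLog a b (X.coboundary v) = 0 := by
  let w : N →ₗ[ℤ] ℝ := ((Rat.castHom ℝ).toAddMonoidHom.comp v).toIntLinearMap
  have h1 := congrArg (w.liftBaseChange ℝ) h
  simp only [toReal, map_sum, map_smul, LinearMap.liftBaseChange_tmul, one_smul] at h1
  have h2 : ∑ i, ((v (X.ρ i) : ℚ) : ℝ) * a i = ((v b : ℚ) : ℝ) := by
    rw [show ((v b : ℚ) : ℝ) = w b from rfl, ← h1]
    refine Finset.sum_congr rfl fun i _ => ?_
    rw [smul_eq_mul, mul_comm]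
    rfl
  change ((∑ i, ((v (X.ρ i) : ℚ) : ℝ) * a i : ℝ) : AddCircle (1 : ℝ))
    - ((v b : ℝ) : AddCircle (1 : ℝ)) = 0
  rw [h2, sub_self]

/-- The element of finite order (or, for real `a`, in the maximal compact subgroup) of `G`
given by `a ∈ ℝⁿ` and `b ∈ N` with `∑ aᵢ ρ̄ᵢ = b̄`: it takes the class of `(u, χ)` to
`exp(2πi (∑ uᵢ aᵢ - χ(b)))`, and it acts on the coordinate `zᵢ` as `exp(2πi aᵢ)`. -/
def expElt (a : Fin n → ℝ) (b : N) (h : ∑ i, a i • toReal (X.ρ i) = toReal b) : X.G :=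
  Circle.coeHom.compAddChar (AddCircle.toCircle_addChar.compAddMonoidHom
    (X.liftLDual (X.preLog a b) (X.preLog_coboundary a b h)))

lemma expElt_D (a : Fin n → ℝ) (b : N) (h : ∑ i, a i • toReal (X.ρ i) = toReal b) (i : Fin n) :
    X.expElt a b h (X.D i) = Complex.exp (2 * Real.pi * Complex.I * a i) := by
  have : X.preLog a b ⟨(Pi.single i 1, 0), by
      intro k
      by_cases h : k = i
      · subst h
        simp [AddCircle.coe_period]
      · simp [h]⟩ = ((a i : ℝ) : AddCircle (1 : ℝ)) := by
    have e : ∀ k, (((Pi.single i 1 : Fin n → ℚ) k : ℚ) : ℝ) * a k = if k = i then a i else 0 := by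
      intro k
      by_cases h : k = i
      · subst h
        simp
      · simp [h]
    change ((∑ k, (((Pi.single i 1 : Fin n → ℚ) k : ℚ) : ℝ) * a k : ℝ) : AddCircle (1 : ℝ)) -
      ratToRealCircle 0 = _
    rw [Finset.sum_congr rfl fun k _ => e k]
    simp only [Finset.sum_ite_eq', Finset.mem_univ, if_true, map_zero, sub_zero]
  change ((AddCircle.toCircle (X.preLog a b _) : Circle) : ℂ) = _
  rw [this, AddCircle.toCircle_apply_mk, Circle.coe_exp]
  congr 1
  push_cast
  ring

variable {X} in
/-- The element of `G` that corresponds to a box element `b ∈ Box(σ)`. It acts on `zᵢ` as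
`exp(2πi bᵢ)`, and the component `IX_b` of the inertia stack is `[U_𝒜 ^ g / G]` for this `g`. -/
def Box.elt {σ : Finset (Fin n)} (b : X.Box σ) : X.G :=
  X.expElt (Box.coord b) b (Box.coord_spec b).2.2

variable {X} in
/-- The involution `b ↦ b̂` on `Box(σ)`, `b̂ = ∑_{bᵢ ≠ 0} ρᵢ - b`. -/
def Box.hat {σ : Finset (Fin n)} (b : X.Box σ) : X.Box σ :=
  ⟨∑ i, ⌈Box.coord b i⌉ • X.ρ i - b, fun i => (⌈Box.coord b i⌉ : ℝ) - Box.coord b i,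
    fun i => ⟨sub_nonneg.2 (Int.le_ceil _), by linarith [Int.ceil_lt_add_one (Box.coord b i)]⟩,
    fun i hi => by simp [(Box.coord_spec b).2.1 i hi], by
      simp only [sub_smul, Finset.sum_sub_distrib, (Box.coord_spec b).2.2]
      simp only [toReal, TensorProduct.tmul_sub, TensorProduct.tmul_sum]
      congr 1
      refine Finset.sum_congr rfl fun i _ => ?_
      rw [← TensorProduct.smul_tmul, TensorProduct.smul_tmul']
      simp⟩

end StackyFan

/-! ### The orbifold line `ℙ_{r₁,r₂}` -/

lemma toReal_int_injective {x y : ℝ} {k l : ℤ} (h : x • toReal k = y • toReal l) :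
    x * k = y * l := by
  have h1 := congrArg (((Int.castAddHom ℝ).toIntLinearMap).liftBaseChange ℝ) h
  simpa [toReal] using h1

/-- The stacky fan of `ℙ_{r₁,r₂}`: the complete fan in `ℤ ⊗ ℝ` with `ρ = (-r₁, r₂)`. Here
`U_𝒜 = ℂ² ∖ {0}`; the point `0` is `{x₀ = 0}` and the point `∞` is `{x₁ = 0}`. -/
def orbiLine (r₁ r₂ : ℕ+) : StackyFan ℤ 2 where
  ρ := ![-(r₁ : ℤ), (r₂ : ℤ)]
  finite_coker := by
    have hle : AddSubgroup.zmultiples (r₂ : ℤ) ≤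
        AddSubgroup.closure (Set.range ![-(r₁ : ℤ), (r₂ : ℤ)]) := by
      rw [AddSubgroup.zmultiples_le]
      exact AddSubgroup.subset_closure ⟨1, rfl⟩
    have : NeZero ((r₂ : ℕ)) := ⟨r₂.ne_zero⟩
    have : Finite (ℤ ⧸ AddSubgroup.zmultiples ((r₂ : ℕ) : ℤ)) :=
      Finite.of_equiv _ (Int.quotientZMultiplesNatEquivZMod (r₂ : ℕ)).symm.toEquiv
    exact Finite.of_surjective
      (QuotientAddGroup.map _ _ (AddMonoidHom.id ℤ) hle)
      (QuotientAddGroup.map_surjective_of_surjective _ _ _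
        (fun y => by
          obtain ⟨x, rfl⟩ := QuotientAddGroup.mk_surjective y
          exact ⟨x, rfl⟩) _)
  cones := {∅, {0}, {1}}
  empty_mem := by simp
  ray_mem := by
    intro i
    fin_cases i <;> simp
  face_mem := by
    rintro σ (rfl | rfl | rfl) τ hτ
    · simp [Finset.subset_empty.1 hτ]
    · rcases Finset.subset_singleton_iff.1 hτ with rfl | rfl <;> simp
    · rcases Finset.subset_singleton_iff.1 hτ with rfl | rfl <;> simp
  simplicial := by
    have key : ∀ k : ℤ, k ≠ 0 → toReal k ≠ 0 := by
      intro k hk h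
      have := @toReal_int_injective 1 0 k 0 (by simp [h])
      simp [hk] at this
    rintro σ (rfl | rfl | rfl)
    · exact linearIndependent_empty_type
    · have : Subsingleton (({0} : Finset (Fin 2)) : Type) :=
        ⟨fun a b => Subtype.ext
          ((Finset.mem_singleton.1 a.2).trans (Finset.mem_singleton.1 b.2).symm)⟩
      exact LinearIndependent.of_subsingleton ⟨0, by simp⟩ (key _ (by simp))
    · have : Subsingleton (({1} : Finset (Fin 2)) : Type) :=
        ⟨fun a b => Subtype.ext
          ((Finset.mem_singleton.1 a.2).trans (Finset.mem_singleton.1 b.2).symm)⟩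
      exact LinearIndependent.of_subsingleton ⟨1, by simp⟩ (key _ (by simp))
  inter_face := by
    have h1 : (0 : ℝ) < (r₁ : ℕ) := by exact_mod_cast r₁.pos
    have h2 : (0 : ℝ) < (r₂ : ℕ) := by exact_mod_cast r₂.pos
    have zmem : ∀ σ, (0 : RealSpan ℤ) ∈ coneHull ![-(r₁ : ℤ), (r₂ : ℤ)] σ :=
      fun σ => ⟨0, by simp, by simp, by simp⟩
    have hempty : ∀ v, v ∈ coneHull ![-(r₁ : ℤ), (r₂ : ℤ)] ∅ → v = 0 := by
      rintro v ⟨a, -, ha, rfl⟩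
      simp [fun i => ha i (by simp)]
    have h01 : ∀ v, v ∈ coneHull ![-(r₁ : ℤ), (r₂ : ℤ)] {0} →
        v ∈ coneHull ![-(r₁ : ℤ), (r₂ : ℤ)] {1} → v = 0 := by
      rintro v ⟨a, ha, ha', rfl⟩ ⟨b, hb, hb', h⟩
      have ha1 : a 1 = 0 := ha' 1 (by simp)
      have hb0 : b 0 = 0 := hb' 0 (by simp)
      simp only [Fin.sum_univ_two, ha1, hb0, zero_smul, add_zero, zero_add, Matrix.cons_val_zero,
        Matrix.cons_val_one] at h ⊢
      have h3 := toReal_int_injective h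
      push_cast at h3
      have : a 0 = 0 := by
        by_contra hne
        have : 0 < a 0 := lt_of_le_of_ne (ha 0) (Ne.symm hne)
        nlinarith [mul_pos this h1, mul_nonneg (hb 1) h2.le]
      simp [this]
    have e01 : ({0} ∩ {1} : Finset (Fin 2)) = ∅ := by decide
    have e10 : ({1} ∩ {0} : Finset (Fin 2)) = ∅ := by decide
    rintro σ (rfl | rfl | rfl) σ' (rfl | rfl | rfl) <;>
      simp only [Finset.inter_self, Finset.empty_inter, Finset.inter_empty, Set.inter_self,
        e01, e10] <;>
      ext v <;> constructor
    · exact fun h => h.1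
    · intro h; rw [hempty v h]; exact ⟨zmem _, zmem _⟩
    · exact fun h => h.1
    · intro h; rw [hempty v h]; exact ⟨zmem _, zmem _⟩
    · exact fun h => h.2
    · intro h; rw [hempty v h]; exact ⟨zmem _, zmem _⟩
    · intro h; rw [h01 v h.1 h.2]; exact zmem _
    · intro h; rw [hempty v h]; exact ⟨zmem _, zmem _⟩
    · exact fun h => h.2
    · intro h; rw [hempty v h]; exact ⟨zmem _, zmem _⟩
    · intro h; rw [h01 v h.2 h.1]; exact zmem _
    · intro h; rw [hempty v h]; exact ⟨zmem _, zmem _⟩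

namespace orbiLine

variable (r₁ r₂ : ℕ+)

/-- The generator `exp(2πi/r₁)` of the isotropy group `μ_{r₁}` at `0`; as an element of `G` it
acts on `ℂ²` by `(x₀, x₁) ↦ (exp(2πi/r₁) x₀, x₁)`. -/
def genZero : (orbiLine r₁ r₂).G :=
  (orbiLine r₁ r₂).expElt ![1 / (r₁ : ℝ), 0] (-1) (by
    have h : (r₁ : ℝ) ≠ 0 := by exact_mod_cast r₁.ne_zero
    have e : toReal (-(r₁ : ℤ)) = (r₁ : ℝ) • toReal (-1 : ℤ) := by
      rw [toReal, toReal, TensorProduct.smul_tmul',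
        show (-(r₁ : ℤ)) = (r₁ : ℤ) • (-1 : ℤ) by simp, ← TensorProduct.smul_tmul]
      simp
    simp only [Fin.sum_univ_two, orbiLine, Matrix.cons_val_zero, Matrix.cons_val_one, zero_smul,
      add_zero, e, smul_smul, one_div, inv_mul_cancel₀ h, one_smul])

/-- The generator `exp(2πi/r₂)` of the isotropy group `μ_{r₂}` at `∞`; as an element of `G` it
acts on `ℂ²` by `(x₀, x₁) ↦ (x₀, exp(2πi/r₂) x₁)`. -/
def genInfty : (orbiLine r₁ r₂).G :=
  (orbiLine r₁ r₂).expElt ![0, 1 / (r₂ : ℝ)] 1 (by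
    have h : (r₂ : ℝ) ≠ 0 := by exact_mod_cast r₂.ne_zero
    have e : toReal (r₂ : ℤ) = (r₂ : ℝ) • toReal (1 : ℤ) := by
      rw [toReal, toReal, TensorProduct.smul_tmul',
        show (r₂ : ℤ) = (r₂ : ℤ) • (1 : ℤ) by simp, ← TensorProduct.smul_tmul]
      simp
    simp only [Fin.sum_univ_two, orbiLine, Matrix.cons_val_zero, Matrix.cons_val_one, zero_smul,
      zero_add, e, smul_smul, one_div, inv_mul_cancel₀ h, one_smul])

/-- The degree `Pic(ℙ_{r₁,r₂}) = 𝕃^∨ → ℚ` of line bundles, the homomorphism with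
`deg D₀ = 1/r₁` (the class of the point `0`) and `deg D₁ = 1/r₂` (the class of `∞`). -/
def deg : (orbiLine r₁ r₂).LDual →+ ℚ :=
  (orbiLine r₁ r₂).liftLDual
    { toFun := fun p => p.1.1 0 / (r₁ : ℚ) + p.1.1 1 / (r₂ : ℚ)
      map_zero' := by simp
      map_add' := fun p q => by
        simp only [AddSubgroup.coe_add, Prod.fst_add, Pi.add_apply]
        ring } (by
      intro v
      have h1 : (r₁ : ℚ) ≠ 0 := by exact_mod_cast r₁.ne_zero
      have h2 : (r₂ : ℚ) ≠ 0 := by exact_mod_cast r₂.ne_zero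
      have e : ∀ k : ℤ, v k = k * v 1 := fun k => by
        have := map_zsmul v k 1
        simpa using this
      change v (-(r₁ : ℤ)) / (r₁ : ℚ) + v (r₂ : ℤ) / (r₂ : ℚ) = 0
      rw [e (-(r₁ : ℤ)), e (r₂ : ℤ)]
      push_cast
      field_simp
      ring)

variable {r₁ r₂} in
/-- Regular functions on `U_𝒜 = ℂ² ∖ {0}`: restrictions of polynomials. -/
def IsRegular (h : (orbiLine r₁ r₂).U → ℂ) : Prop :=
  ∃ p : MvPolynomial (Fin 2) ℂ, ∀ x, h x = MvPolynomial.eval x.1 p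

variable {r₁ r₂} in
/-- Regular functions on `G × (ℂ² ∖ {0})`: the elements of `ℂ[𝕃^∨] ⊗ ℂ[x₀, x₁]`, where `ℂ[𝕃^∨]` is
the coordinate ring of the diagonalizable group `G = Hom(𝕃^∨, ℂ^×)`. -/
def IsRegularArrow (h : (orbiLine r₁ r₂).G → (orbiLine r₁ r₂).U → ℂ) : Prop :=
  ∃ s : (orbiLine r₁ r₂).LDual →₀ MvPolynomial (Fin 2) ℂ,
    ∀ g x, h g x = s.sum fun χ p => g χ * MvPolynomial.eval x.1 p

end orbiLine

/-! ### Morphisms from `ℙ_{r₁,r₂}` to a toric stack -/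

variable {N : Type*} [AddCommGroup N] {n : ℕ}

/-- A morphism of stacks `ℙ_{r₁,r₂} = [(ℂ² ∖ {0})/G'] → [U_𝒜/G]`, as an algebraic functor between
the action groupoids: a regular map `ℂ² ∖ {0} → U_𝒜` on objects and a regular map on
arrows, which takes the arrow `g : x ⟶ g x` to an arrow `coc g x` from the image of `x` to that
of `g x`, compatibly with composition. (Every `G`-torsor on `ℂ² ∖ {0}` is trivial, because `G` is
diagonalizable, so every morphism of the stacks is of this form; a map to `G = Hom(𝕃^∨, ℂ^×)` is
regular iff its composites with all the characters `χ ∈ 𝕃^∨` are.) -/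
structure StackMor (r₁ r₂ : ℕ+) (X : StackyFan N n) where
  toFun : (orbiLine r₁ r₂).U → X.U
  coc : (orbiLine r₁ r₂).G → (orbiLine r₁ r₂).U → X.G
  regular_toFun : ∀ i, orbiLine.IsRegular fun x => (toFun x : Fin n → ℂ) i
  regular_coc : ∀ χ : X.LDual, orbiLine.IsRegularArrow fun g x => coc g x χ
  map_act : ∀ g x, toFun ((orbiLine r₁ r₂).actU g x) = X.actU (coc g x) (toFun x)
  map_mul : ∀ g h x, coc (g * h) x = coc g ((orbiLine r₁ r₂).actU h x) * coc h x

namespace StackMor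

variable {r₁ r₂ : ℕ+} {X : StackyFan N n}

/-- There is a 2-isomorphism between two morphisms: an algebraic natural isomorphism of the
functors, given by a regular map `l : ℂ² ∖ {0} → G`. -/
def TwoIso (f f' : StackMor r₁ r₂ X) : Prop :=
  ∃ l : (orbiLine r₁ r₂).U → X.G,
    (∀ χ : X.LDual, orbiLine.IsRegular fun x => l x χ) ∧
    (∀ x, f'.toFun x = X.actU (l x) (f.toFun x)) ∧
    ∀ g x, f'.coc g x * l x = l ((orbiLine r₁ r₂).actU g x) * f.coc g x

/-- Representability: the morphism is injective on isotropy groups. -/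
def Representable (f : StackMor r₁ r₂ X) : Prop :=
  ∀ x g h, (orbiLine r₁ r₂).actU g x = x → (orbiLine r₁ r₂).actU h x = x →
    f.coc g x = f.coc h x → g = h

/-- `f` is a toric morphism to (the closure of) a one-dimensional torus orbit: there is
a cone `τ` of codimension one such that `f` maps the open torus `(ℂ^×)²/G'` of `ℙ_{r₁,r₂}` to the
orbit `O_τ = {z | zᵢ = 0 ↔ i ∈ τ}/G`, and this map is a homomorphism of groups. Here `O_τ` is a
group under coordinatewise multiplication; it is the open torus of the toric
stack `X(Σ/τ) ≅ X(Σ)_τ`. -/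
def Toric (f : StackMor r₁ r₂ X) : Prop :=
  ∃ τ ∈ X.cones, τ.card + 1 = X.dim ∧
    (∀ x : (orbiLine r₁ r₂).U, (∀ k, x.1 k ≠ 0) → ∀ i, (f.toFun x).1 i = 0 ↔ i ∈ τ) ∧
    ∀ s t st : (orbiLine r₁ r₂).U, (∀ k, s.1 k ≠ 0) → (∀ k, t.1 k ≠ 0) → st.1 = s.1 * t.1 →
      ∃ g : X.G, (f.toFun st).1 = X.act g ((f.toFun s).1 * (f.toFun t).1)

/-- `f(0) = X(Σ)_σ`, for a top-dimensional cone `σ`; `X(Σ)_σ` is the point `{zᵢ = 0, i ∈ σ}/G`. -/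
def MapsZero (f : StackMor r₁ r₂ X) (σ : Finset (Fin n)) : Prop :=
  ∀ x : (orbiLine r₁ r₂).U, x.1 0 = 0 → ∀ i ∈ σ, (f.toFun x).1 i = 0

/-- `f(∞) = X(Σ)_σ`, for a top-dimensional cone `σ`. -/
def MapsInfty (f : StackMor r₁ r₂ X) (σ : Finset (Fin n)) : Prop :=
  ∀ x : (orbiLine r₁ r₂).U, x.1 1 = 0 → ∀ i ∈ σ, (f.toFun x).1 i = 0

/-- The line bundle `f^* O(Dᵢ)` has degree `q`. It is the line bundle on `ℙ_{r₁,r₂}` that is given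
by the character `L` of `G'` through which `G'` acts on the `i`-th coordinate. -/
def HasDegree (f : StackMor r₁ r₂ X) (i : Fin n) (q : ℚ) : Prop :=
  ∃ L : (orbiLine r₁ r₂).LDual, (∀ g x, f.coc g x (X.D i) = g L) ∧ orbiLine.deg r₁ r₂ L = q

end StackMor

/-- Representable toric morphisms `f : ℙ_{r₁,r₂} → X(Σ)`, for some `r₁`, `r₂`, with
`f(0) = X(Σ)_σ` and `f(∞) = X(Σ)_{σ'}`. -/
structure ToricCurve (X : StackyFan N n) (σ σ' : Finset (Fin n)) where
  r₁ : ℕ+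
  r₂ : ℕ+
  map : StackMor r₁ r₂ X
  representable : map.Representable
  toric : map.Toric
  mapsZero : map.MapsZero σ
  mapsInfty : map.MapsInfty σ'

namespace ToricCurve

variable {X : StackyFan N n} {σ σ' : Finset (Fin n)}

/-- The restriction `f|₀ : Bμ_{r₁} → X(Σ)_σ` gives the box element `b`: the generator
`exp(2πi/r₁)` of `μ_{r₁}` is mapped to the element of the isotropy group that corresponds to `b`. -/
def GivesZero (f : ToricCurve X σ σ') (b : X.Box σ) : Prop :=
  ∀ x : (orbiLine f.r₁ f.r₂).U, x.1 0 = 0 →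
    f.map.coc (orbiLine.genZero f.r₁ f.r₂) x = StackyFan.Box.elt b

/-- The restriction `f|_∞ : Bμ_{r₂} → X(Σ)_{σ'}` gives the box element `b`. -/
def GivesInfty (f : ToricCurve X σ σ') (b : X.Box σ') : Prop :=
  ∀ x : (orbiLine f.r₁ f.r₂).U, x.1 1 = 0 →
    f.map.coc (orbiLine.genInfty f.r₁ f.r₂) x = StackyFan.Box.elt b

/-- Two morphisms are identified if they have the same source and are 2-isomorphic. -/
inductive Iso : ToricCurve X σ σ' → ToricCurve X σ σ' → Prop
  | mk {r₁ r₂ : ℕ+} (f f' : StackMor r₁ r₂ X) (a b c d a' b' c' d') (h : f.TwoIso f') :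
      Iso ⟨r₁, r₂, f, a, b, c, d⟩ ⟨r₁, r₂, f', a', b', c', d'⟩

lemma actU_one (X : StackyFan N n) (z : X.U) : X.actU 1 z = z := by
  apply Subtype.ext
  funext i
  simp [StackyFan.actU, StackyFan.act]

lemma actU_mul (X : StackyFan N n) (g h : X.G) (z : X.U) :
    X.actU (g * h) z = X.actU g (X.actU h z) := by
  apply Subtype.ext
  funext i
  simp [StackyFan.actU, StackyFan.act, mul_assoc]

/-- The isomorphism classes. -/
def setoid (X : StackyFan N n) (σ σ' : Finset (Fin n)) : Setoid (ToricCurve X σ σ') where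
  r := Iso
  iseqv :=
    { refl := fun f => Iso.mk f.map f.map _ _ _ _ _ _ _ _
        ⟨fun _ => 1, fun χ => ⟨1, by simp⟩, fun x => (actU_one X _).symm, fun g x => by simp⟩
      symm := by
        rintro _ _ ⟨f, f', -, -, -, -, -, -, -, -, l, hl, h1, h2⟩
        refine Iso.mk f' f _ _ _ _ _ _ _ _ ⟨fun x => (l x)⁻¹, fun χ => ?_, fun x => ?_,
          fun g x => ?_⟩
        · simpa [AddChar.inv_apply] using hl (-χ)
        · rw [h1 x, ← actU_mul, inv_mul_cancel, actU_one]
        · rw [eq_inv_mul_iff_mul_eq, ← mul_assoc, ← h2 g x, mul_inv_cancel_right]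
      trans := by
        intro _ _ _ hf hf'
        cases hf with
        | mk f f' _ _ _ _ _ _ _ _ h =>
        cases hf' with
        | mk _ f'' _ _ _ _ _ _ _ _ h' =>
        obtain ⟨l, hl, h1, h2⟩ := h
        obtain ⟨l', hl', h1', h2'⟩ := h'
        refine Iso.mk f f'' _ _ _ _ _ _ _ _ ⟨fun x => l' x * l x, fun χ => ?_, fun x => ?_,
          fun g x => ?_⟩
        · obtain ⟨p, hp⟩ := hl χ
          obtain ⟨q, hq⟩ := hl' χ
          exact ⟨q * p, fun x => by simp [hp x, hq x]⟩
        · rw [h1' x, h1 x, actU_mul]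
        · rw [← mul_assoc, h2' g x, mul_assoc, h2 g x, mul_assoc] }

/-- The set of isomorphism classes of all the `f` with `f(0) = X(Σ)_σ` and `f(∞) = X(Σ)_{σ'}`. -/
abbrev Classes (X : StackyFan N n) (σ σ' : Finset (Fin n)) : Type _ := Quotient (setoid X σ σ')

/-- The set of isomorphism classes of those `f` for which `f|₀` gives the box element `b`. -/
abbrev ClassesAt (X : StackyFan N n) (σ σ' : Finset (Fin n)) (b : X.Box σ) : Type _ :=
  Quotient ((setoid X σ σ').comap (Subtype.val : {f // GivesZero f b} → ToricCurve X σ σ'))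

end ToricCurve

/-- Box elements `b₁ ∈ Box(σ₁)`, `b₂ ∈ Box(σ₂)` and integers `q₁, q₂ ≥ 0`, with
`q₁ ρ₁ + q₂ ρ₂ + b₁ + b₂ = 0` in `N`, and with `q₁`, `q₂`, `b̄₁`, `b̄₂` not all zero. -/
structure BoxRelation (X : StackyFan N 2) where
  b₁ : X.Box {0}
  b₂ : X.Box {1}
  q₁ : ℕ
  q₂ : ℕ
  rel : q₁ • X.ρ 0 + q₂ • X.ρ 1 + (b₁ : N) + (b₂ : N) = 0
  nontrivial : ¬ (q₁ = 0 ∧ q₂ = 0 ∧ toReal (b₁ : N) = 0 ∧ toReal (b₂ : N) = 0)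

/-- A box element `b₁ ∈ Box(σ₁)`, `b̄₁ = f₁ ρ̄₁`, and a rational number `l > 0` such that `w₂ l - f₁`
is a non-negative integer. -/
structure BoxDegree (X : StackyFan N 2) (w₂ : ℕ) where
  b₁ : X.Box {0}
  l : ℚ
  pos : 0 < l
  integral : ∃ k : ℕ, (w₂ : ℝ) * (l : ℝ) - StackyFan.Box.coord b₁ 0 = k

end

/-! A morphism `f` consists of a regular map `ℂ² ∖ {0} → U_𝒜` and a cocycle with values in `G`.
Nowhere vanishing regular functions on `ℂ² ∖ {0}` are constant, so the cocycle does not depend on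
the point. It is then a homomorphism of diagonalizable groups, dual to a homomorphism `f^* : 𝕃^∨ →
Pic ℙ_{r₁,r₂}` (`StackMor.exists_pic`).

If `f` is toric, each coordinate is zero or a monomial. The conditions at `0` and `∞` leave, up to
the action of `G`, only `zⱼ = x₀ᵃ` and `zⱼ' = x₁ᵇ`, where `j` and `j'` are the rays that `σ` and
`σ'` do not share (`ToricCurve.normal_form`). Since `f^*` determines `a` and `b`, the triple `(r₁,
r₂, f^*)` determines `f`; conversely, every `f^*` of the right shape occurs
(`exists_stackMor_of_pic`).

An element of `Pic ℙ_{r₁,r₂}` amounts to its degree and the action of `μ_{r₁}` on its fibre at `0`.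
Hence `f^*` is a pair `(δ, γ)` of homomorphisms from `𝕃^∨` to `ℚ` and `ℝ/ℤ`, with `r₁ γ = 0` and `r₂
(δ - γ) = 0` modulo `ℤ` (`orbiLine.exists_hom`). Here `γ` is the box element at `0`, and `δ - γ`
gives the isotropy at `∞`. Representability says that `r₁` and `r₂` are the orders of these two, so
the source is determined as well. The values `δ(Dᵢ)` form a relation between the `ρ̄ᵢ` supported on
`σ ∪ σ'`; such relations form a line, so `c = δ(Dⱼ)` determines `δ`. The only compatibility left is
`c ≡ bⱼ` modulo `ℤ`, and this proves (B).

For (A), the isotropy at `0` always comes from a unique box element: elements of finite order in `G`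
are exponentials of rational vectors (`exists_expLog_eq`), which rests on Pontryagin duality for
`N`. This gives (a) ↔ (c) with `c = w₂ l`. For (b) ↔ (c), a relation `q₁ρ₁ + q₂ρ₂ + b₁ + b₂ = 0` is
`l` times the minimal relation in `N ⊗ ℝ`, with coefficients split into integral and fractional
parts. The same relation shows that `δ - γ` is the logarithm of `b₂` (`log_add_log`). -/

noncomputable section

section

/-! ### Torsion and rationality in `N ⊗ ℝ` -/

section RealSpan

variable {N : Type*} [AddCommGroup N]

/-- The real functional on `N ⊗ ℝ` induced by a homomorphism `N → ℚ`. -/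
def realPair (v : N →+ ℚ) : RealSpan N →ₗ[ℝ] ℝ :=
  ((Rat.castHom ℝ).toAddMonoidHom.comp v).toIntLinearMap.liftBaseChange ℝ

@[simp] lemma realPair_toReal (v : N →+ ℚ) (x : N) : realPair v (toReal x) = v x := by
  simp [realPair, toReal]

lemma toReal_add (x y : N) : toReal (x + y) = toReal x + toReal y := TensorProduct.tmul_add _ _ _

lemma toReal_sub (x y : N) : toReal (x - y) = toReal x - toReal y := TensorProduct.tmul_sub _ _ _

lemma toReal_neg (x : N) : toReal (-x) = -toReal x := TensorProduct.tmul_neg _ _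

@[simp] lemma toReal_zero : toReal (0 : N) = 0 := TensorProduct.tmul_zero _ _

lemma toReal_sum {ι : Type*} (s : Finset ι) (f : ι → N) :
    toReal (∑ i ∈ s, f i) = ∑ i ∈ s, toReal (f i) := TensorProduct.tmul_sum _ _ _

lemma toReal_zsmul (k : ℤ) (x : N) : toReal (k • x) = (k : ℝ) • toReal x := by
  rw [toReal, ← TensorProduct.smul_tmul, toReal, TensorProduct.smul_tmul']
  simp

lemma toReal_nsmul (k : ℕ) (x : N) : toReal (k • x) = (k : ℝ) • toReal x := by
  rw [← natCast_zsmul, toReal_zsmul, Int.cast_natCast]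

lemma toReal_eq_zero_of_nsmul {x : N} {m : ℕ} (hm : 0 < m) (h : m • x = 0) : toReal x = 0 := by
  have h1 := toReal_nsmul m x
  rw [h, toReal_zero] at h1
  exact (smul_eq_zero.1 h1.symm).resolve_left (by exact_mod_cast hm.ne')

/-- Modulo torsion `N` is free, and the coordinates in a basis of the quotient are homomorphisms to
`ℤ ⊆ ℚ`; if they all vanish on `x`, then `x` is torsion. -/
lemma exists_nsmul_eq_zero_of_forall_hom [AddGroup.FG N] {x : N} (h : ∀ v : N →+ ℚ, v x = 0) :
    ∃ m : ℕ, 0 < m ∧ m • x = 0 := by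
  have : Module.Finite ℤ N := Module.Finite.iff_addGroup_fg.2 inferInstance
  let T := Submodule.torsion ℤ N
  have hT : Module.IsTorsionFree ℤ (N ⧸ T) := inferInstance
  have hF : Module.Free ℤ (N ⧸ T) := inferInstance
  let B := Module.Free.chooseBasis ℤ (N ⧸ T)
  have hx : T.mkQ x = 0 := by
    refine B.ext_elem fun i => ?_
    have := h ((Int.castAddHom ℚ).comp ((B.coord i).toAddMonoidHom.comp T.mkQ.toAddMonoidHom))
    simp only [AddMonoidHom.coe_comp, Function.comp_apply, Int.coe_castAddHom, Int.cast_eq_zero,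
      LinearMap.toAddMonoidHom_coe, Module.Basis.coord_apply] at this
    rw [this]
    simp
  rw [Submodule.mkQ_apply, Submodule.Quotient.mk_eq_zero] at hx
  obtain ⟨a, ha⟩ := (Submodule.mem_torsion_iff x).1 hx
  have ha0 : (a : ℤ) ≠ 0 := nonZeroDivisors.coe_ne_zero a
  refine ⟨(a : ℤ).natAbs, Int.natAbs_pos.2 ha0, ?_⟩
  have ha' : (a : ℤ) • x = 0 := ha
  rw [← natCast_zsmul]
  rcases Int.natAbs_eq (a : ℤ) with h' | h'
  · rw [← h', ha']
  · rw [← neg_eq_iff_eq_neg.2 h', neg_smul, ha', neg_zero]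

lemma toReal_eq_zero_of_forall_hom [AddGroup.FG N] {x : N} (h : ∀ v : N →+ ℚ, v x = 0) :
    toReal x = 0 := by
  obtain ⟨m, hm, h'⟩ := exists_nsmul_eq_zero_of_forall_hom h
  exact toReal_eq_zero_of_nsmul hm h'

lemma exists_nsmul_eq_zero_of_toReal [AddGroup.FG N] {x : N} (h : toReal x = 0) :
    ∃ m : ℕ, 0 < m ∧ m • x = 0 := by
  refine exists_nsmul_eq_zero_of_forall_hom fun v => ?_
  have := realPair_toReal v x
  rw [h, map_zero] at this
  exact_mod_cast this.symm

/-- A common denominator of finitely many rational numbers. -/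
lemma exists_common_denominator {n : ℕ} (a : Fin n → ℚ) :
    ∃ m : ℕ, 0 < m ∧ ∃ k : Fin n → ℤ, ∀ i, (m : ℚ) * a i = k i := by
  refine ⟨∏ i, (a i).den, Finset.prod_pos fun i _ => (a i).pos, fun i =>
    (∏ l ∈ Finset.univ.erase i, (a l).den : ℕ) * (a i).num, fun i => ?_⟩
  rw [← Finset.mul_prod_erase _ _ (Finset.mem_univ i)]
  push_cast
  rw [mul_comm ((a i).den : ℚ), mul_assoc, Rat.den_mul_eq_num]

/-- After multiplication by a common denominator, the difference of the two sides comes from an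
element of `N` killed by every rational functional, hence from a torsion element. -/
lemma sum_smul_toReal_eq_zero [AddGroup.FG N] {n : ℕ} {ρ : Fin n → N} {a : Fin n → ℚ} {b : N}
    (h : ∀ v : N →+ ℚ, ∑ i, v (ρ i) * a i = v b) :
    ∑ i, (a i : ℝ) • toReal (ρ i) = toReal b := by
  obtain ⟨m, hm, k, hk⟩ := exists_common_denominator a
  have h1 : toReal (∑ i, k i • ρ i - m • b) = 0 := by
    refine toReal_eq_zero_of_forall_hom fun v => ?_
    simp only [map_sub, map_sum, map_zsmul, map_nsmul, zsmul_eq_mul, nsmul_eq_mul, ← hk, ← h,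
      Finset.mul_sum]
    rw [sub_eq_zero]
    exact Finset.sum_congr rfl fun i _ => by ring
  have hm' : (m : ℝ) ≠ 0 := by exact_mod_cast hm.ne'
  have hk' : ∀ i, (k i : ℝ) = m * a i := fun i => by exact_mod_cast (hk i).symm
  simp only [toReal_sub, toReal_sum, toReal_zsmul, toReal_nsmul, hk', mul_smul] at h1
  rw [← Finset.smul_sum, ← smul_sub, smul_eq_zero, sub_eq_zero] at h1
  exact h1.resolve_left hm'

/-- A `ℚ`-linear retraction of `ℝ` onto `ℚ`. -/
lemma exists_rat_retraction : ∃ p : ℝ →ₗ[ℚ] ℚ, ∀ q : ℚ, p q = q := by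
  obtain ⟨p, hp⟩ := (Algebra.linearMap ℚ ℝ).exists_leftInverse_of_injective
    (LinearMap.ker_eq_bot.2 (algebraMap ℚ ℝ).injective)
  exact ⟨p, fun q => LinearMap.congr_fun hp q⟩

/-- The coordinates of an element of `N ⊗ ℚ` with respect to linearly independent vectors of
`N ⊗ ℚ` are rational. -/
lemma rational_of_linearIndependent {n : ℕ} {ρ : Fin n → N} {σ : Finset (Fin n)}
    (hσ : LinearIndependent ℝ (fun i : σ => toReal (ρ i))) {a : Fin n → ℝ}
    (ha : ∀ i ∉ σ, a i = 0) {c : ℚ} {b : N}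
    (h : ∑ i, a i • toReal (ρ i) = (c : ℝ) • toReal b) :
    ∃ q : Fin n → ℚ, ∀ i, a i = q i := by
  obtain ⟨p, hp⟩ := exists_rat_retraction
  -- Applying the retraction to the factor `ℝ` of `ℝ ⊗ N` fixes the right-hand side and replaces
  -- each `aᵢ` by the rational number `p aᵢ`; independence then gives `aᵢ = p aᵢ`.
  let P : ℝ →ₗ[ℤ] ℝ := ((Rat.castHom ℝ).toAddMonoidHom.comp p.toAddMonoidHom).toIntLinearMap
  have hP : ∀ x, P x = ((p x : ℚ) : ℝ) := fun x => rfl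
  have e : ∀ (x : ℝ) (y : N), P.rTensor N (x • toReal y) = ((p x : ℚ) : ℝ) • toReal y := by
    intro x y
    simp only [toReal, TensorProduct.smul_tmul', smul_eq_mul, mul_one, LinearMap.rTensor_tmul, hP]
  have h1 := congrArg (P.rTensor N) h
  rw [map_sum, e, hp, ← h] at h1
  simp only [e] at h1
  have h2 : ∑ i : σ, (((p (a i) : ℚ) : ℝ) - a i) • toReal (ρ i) = 0 := by
    rw [Finset.sum_coe_sort σ (fun i => (((p (a i) : ℚ) : ℝ) - a i) • toReal (ρ i)),
      Finset.sum_subset (Finset.subset_univ σ) fun i _ hi => by simp [ha i hi]]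
    simp only [sub_smul, Finset.sum_sub_distrib, h1, sub_self]
  refine ⟨fun i => p (a i), fun i => ?_⟩
  by_cases hi : i ∈ σ
  · exact (sub_eq_zero.1 (Fintype.linearIndependent_iff.1 hσ _ h2 ⟨i, hi⟩)).symm
  · simp [ha i hi]

lemma coord_unique {n : ℕ} {ρ : Fin n → N} {σ : Finset (Fin n)}
    (hσ : LinearIndependent ℝ (fun i : σ => toReal (ρ i))) {a a' : Fin n → ℝ}
    (ha : ∀ i ∉ σ, a i = 0) (ha' : ∀ i ∉ σ, a' i = 0)
    (h : ∑ i, a i • toReal (ρ i) = ∑ i, a' i • toReal (ρ i)) : a = a' := by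
  have h2 : ∑ i : σ, (a i - a' i) • toReal (ρ i) = 0 := by
    rw [Finset.sum_coe_sort σ (fun i => (a i - a' i) • toReal (ρ i)),
      Finset.sum_subset (Finset.subset_univ σ) fun i _ hi => by simp [ha i hi, ha' i hi]]
    simp only [sub_smul, Finset.sum_sub_distrib, h, sub_self]
  funext i
  by_cases hi : i ∈ σ
  · exact sub_eq_zero.1 (Fintype.linearIndependent_iff.1 hσ _ h2 ⟨i, hi⟩)
  · rw [ha i hi, ha' i hi]

end RealSpan

/-! ### Polynomials without zeros on the torus -/

section Polynomial

open MvPolynomial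

/-- A polynomial in two variables without zeros in the torus is a monomial. -/
lemma monomial_of_ne_zero_on_torus {p : MvPolynomial (Fin 2) ℂ}
    (hp : ∀ x : Fin 2 → ℂ, (∀ k, x k ≠ 0) → eval x p ≠ 0) :
    ∃ (c : ℂ) (a b : ℕ), c ≠ 0 ∧ p = C c * (X 0 ^ a * X 1 ^ b) := by
  -- Nullstellensatz: `x₀x₁` vanishes on the zero set of `p`, so `p` divides a power of it. As `x₀`
  -- and `x₁` are prime, the divisors of such a power are monomials up to units.
  have h1 : (X 0 * X 1 : MvPolynomial (Fin 2) ℂ) ∈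
      vanishingIdeal ℂ (zeroLocus ℂ (Ideal.span {p})) := by
    rw [mem_vanishingIdeal_iff]
    intro x hx
    have hpx : eval x p = 0 := by
      have := hx p (Ideal.mem_span_singleton_self p)
      rwa [aeval_eq_eval] at this
    by_contra hne
    rw [aeval_eq_eval] at hne
    simp only [map_mul, eval_X, mul_eq_zero, not_or] at hne
    exact hp x (by intro k; fin_cases k; exacts [hne.1, hne.2]) hpx
  rw [vanishingIdeal_zeroLocus_eq_radical] at h1
  obtain ⟨m, hm⟩ := h1
  rw [Ideal.mem_span_singleton, mul_pow] at hm
  obtain ⟨d, e, hd, he, rfl⟩ := exists_dvd_and_dvd_of_dvd_mul hm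
  obtain ⟨a, -, ha⟩ := (dvd_prime_pow (X_prime (R := ℂ) (i := (0 : Fin 2))) _).1 hd
  obtain ⟨b, -, hb⟩ := (dvd_prime_pow (X_prime (R := ℂ) (i := (1 : Fin 2))) _).1 he
  obtain ⟨u, hu⟩ := (ha.mul_mul hb).symm
  obtain ⟨c, hc, hcu⟩ := isUnit_iff_eq_C_of_isReduced.1 u.isUnit
  exact ⟨c, a, b, hc.ne_zero, by rw [← hu, hcu, mul_comm]⟩

/-- A polynomial in two variables without zeros outside the origin is constant. -/
lemma constant_of_ne_zero_off_origin {p : MvPolynomial (Fin 2) ℂ}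
    (hp : ∀ x : Fin 2 → ℂ, x ≠ 0 → eval x p ≠ 0) : ∃ c : ℂ, c ≠ 0 ∧ p = C c := by
  obtain ⟨c, a, b, hc, rfl⟩ := monomial_of_ne_zero_on_torus
    (fun x hx => hp x fun h => hx 0 (by simp [h]))
  have ha : a = 0 := by
    by_contra h
    exact hp ![0, 1] (fun h => by simpa using congrFun h 1) (by simp [h])
  have hb : b = 0 := by
    by_contra h
    exact hp ![1, 0] (fun h => by simpa using congrFun h 0) (by simp [h])
  exact ⟨c, hc, by simp [ha, hb]⟩

/-- A polynomial that vanishes on the torus is zero. -/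
lemma eq_zero_of_eq_zero_on_torus {p : MvPolynomial (Fin 2) ℂ}
    (hp : ∀ x : Fin 2 → ℂ, (∀ k, x k ≠ 0) → eval x p = 0) : p = 0 := by
  have h : X 0 * X 1 * p = 0 := by
    refine MvPolynomial.funext fun x => ?_
    by_cases hx : ∀ k, x k ≠ 0
    · simp [hp x hx]
    · push Not at hx
      obtain ⟨k, hk⟩ := hx
      fin_cases k <;> simp_all
  simpa using h

end Polynomial

end

section

/-! ### Unitary characters and the groups `ℚ/ℤ`, `ℝ/ℤ` -/

section CircleChar

variable {A : Type*} [AddCommGroup A]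

/-- The unitary character `exp(2πi γ)`. -/
def circleChar (γ : A →+ AddCircle (1 : ℝ)) : AddChar A ℂ :=
  Circle.coeHom.compAddChar (AddCircle.toCircle_addChar.compAddMonoidHom γ)

lemma circleChar_apply (γ : A →+ AddCircle (1 : ℝ)) (x : A) :
    circleChar γ x = (AddCircle.toCircle (γ x) : ℂ) := rfl

lemma toCircle_coe_injective :
    Function.Injective fun x : AddCircle (1 : ℝ) => (AddCircle.toCircle x : ℂ) :=
  Circle.coe_injective.comp (AddCircle.injective_toCircle one_ne_zero)

lemma circleChar_injective : Function.Injective (circleChar (A := A)) := by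
  intro γ γ' h
  ext x
  exact toCircle_coe_injective (DFunLike.congr_fun h x)

lemma circleChar_zero : circleChar (0 : A →+ AddCircle (1 : ℝ)) = 1 := by
  ext x
  simp [circleChar_apply]

lemma circleChar_nsmul (k : ℕ) (γ : A →+ AddCircle (1 : ℝ)) :
    circleChar (k • γ) = circleChar γ ^ k := by
  ext x
  simp [circleChar_apply, AddCircle.toCircle_nsmul]

end CircleChar

section RatCircle

lemma exists_coe_eq_ratCircle (x : AddCircle (1 : ℚ)) : ∃ q : ℚ, (q : AddCircle (1 : ℚ)) = x :=
  QuotientAddGroup.mk_surjective x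

lemma ratCircle_coe_eq_zero_iff {q : ℚ} : (q : AddCircle (1 : ℚ)) = 0 ↔ ∃ k : ℤ, q = k := by
  rw [AddCircle.coe_eq_zero_iff]
  simp [eq_comm]

lemma realCircle_coe_eq_zero_iff {q : ℝ} : (q : AddCircle (1 : ℝ)) = 0 ↔ ∃ k : ℤ, q = k := by
  rw [AddCircle.coe_eq_zero_iff]
  simp [eq_comm]

lemma realCircle_coe_eq_iff {x y : ℝ} :
    (x : AddCircle (1 : ℝ)) = y ↔ ∃ k : ℤ, x - y = k := by
  rw [← realCircle_coe_eq_zero_iff, AddCircle.coe_sub, sub_eq_zero]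

lemma realCircle_coe_sum {ι : Type*} (s : Finset ι) (f : ι → ℝ) :
    ((∑ i ∈ s, f i : ℝ) : AddCircle (1 : ℝ)) = ∑ i ∈ s, (f i : AddCircle (1 : ℝ)) :=
  map_sum (QuotientAddGroup.mk' (AddSubgroup.zmultiples (1 : ℝ))) f s

lemma ratToRealCircle_coe (q : ℚ) :
    StackyFan.ratToRealCircle (q : AddCircle (1 : ℚ)) = ((q : ℝ) : AddCircle (1 : ℝ)) := rfl

lemma ratToRealCircle_eq_zero {x : AddCircle (1 : ℚ)} (h : StackyFan.ratToRealCircle x = 0) :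
    x = 0 := by
  obtain ⟨q, rfl⟩ := exists_coe_eq_ratCircle x
  rw [ratToRealCircle_coe, realCircle_coe_eq_zero_iff] at h
  obtain ⟨k, hk⟩ := h
  exact ratCircle_coe_eq_zero_iff.2 ⟨k, by exact_mod_cast hk⟩

/-- A character of a finitely generated group with values in `ℚ/ℤ` has finite order. -/
lemma exists_nsmul_character_eq_zero {N : Type*} [AddCommGroup N] [AddGroup.FG N]
    (χ : N →+ AddCircle (1 : ℚ)) : ∃ m : ℕ, 0 < m ∧ m • χ = 0 := by
  have : Module.Finite ℤ N := Module.Finite.iff_addGroup_fg.2 inferInstance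
  obtain ⟨r, s, hs⟩ := Module.Finite.exists_fin (R := ℤ) (M := N)
  choose q hq using fun i => exists_coe_eq_ratCircle (χ (s i))
  obtain ⟨m, hm, k, hk⟩ := exists_common_denominator q
  refine ⟨m, hm, ?_⟩
  have h : (m • χ).toIntLinearMap = 0 := by
    refine LinearMap.ext_on_range hs fun i => ?_
    change m • χ (s i) = 0
    rw [← hq, ← AddCircle.coe_nsmul, ratCircle_coe_eq_zero_iff, nsmul_eq_mul]
    exact ⟨k i, hk i⟩
  ext x
  exact LinearMap.congr_fun h x

end RatCircle

/-! ### Homomorphisms from the Gale dual to `ℚ` and to `ℝ/ℤ` -/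

namespace StackyFan

variable {N : Type*} [AddCommGroup N] {n : ℕ} (X : StackyFan N n)

lemma toLDual_surjective : Function.Surjective X.toLDual := QuotientAddGroup.mk'_surjective _

variable {X} in
lemma hom_ext_toLDual {A : Type*} [AddCommGroup A] {φ ψ : X.LDual →+ A}
    (h : ∀ p, φ (X.toLDual p) = ψ (X.toLDual p)) : φ = ψ := by
  ext x
  obtain ⟨p, rfl⟩ := X.toLDual_surjective x
  exact h p

lemma toLDual_coboundary (v : N →+ ℚ) : X.toLDual (X.coboundary v) = 0 :=
  (QuotientAddGroup.eq_zero_iff _).2 ⟨v, rfl⟩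

lemma exists_cocycle (χ : N →+ AddCircle (1 : ℚ)) : ∃ p : X.cocycles, p.1.2 = χ := by
  choose u hu using fun i => exists_coe_eq_ratCircle (χ (X.ρ i))
  exact ⟨⟨(u, χ), hu⟩, rfl⟩

/-- The cocycle of an integral vector. -/
def intCocycle (k : Fin n → ℤ) : X.cocycles :=
  ⟨(fun i => k i, 0), fun i => ratCircle_coe_eq_zero_iff.2 ⟨k i, rfl⟩⟩

lemma toLDual_intCocycle (k : Fin n → ℤ) : X.toLDual (X.intCocycle k) = ∑ i, k i • X.D i := by
  simp only [D, ← map_zsmul, ← map_sum]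
  congr 1
  refine Subtype.ext (Prod.ext ?_ ?_)
  · funext l
    simp [intCocycle, Prod.fst_sum, Finset.sum_apply, Pi.single_apply]
  · simp [intCocycle, Prod.snd_sum]

/-- The `Dᵢ` generate a subgroup of finite index in `𝕃^∨`. -/
lemma exists_nsmul_toLDual [AddGroup.FG N] (p : X.cocycles) :
    ∃ m : ℕ, 0 < m ∧ ∃ k : Fin n → ℤ, (∀ i, (m : ℚ) * p.1.1 i = k i) ∧
      m • X.toLDual p = ∑ i, k i • X.D i := by
  obtain ⟨m, hm, hχ⟩ := exists_nsmul_character_eq_zero p.1.2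
  have h : ∀ i, ∃ k : ℤ, (m : ℚ) * p.1.1 i = k := by
    intro i
    rw [← ratCircle_coe_eq_zero_iff, ← nsmul_eq_mul, AddCircle.coe_nsmul, p.2 i]
    exact DFunLike.congr_fun hχ _
  choose k hk using h
  refine ⟨m, hm, k, hk, ?_⟩
  rw [← toLDual_intCocycle, ← map_nsmul]
  congr 1
  refine Subtype.ext (Prod.ext (funext fun i => ?_) hχ)
  simpa [intCocycle] using hk i

variable {X} in
-- A multiple of the class of `p` is an integral combination of the `Dᵢ`, and `ℚ` is torsion-free.
lemma ratHom_toLDual [AddGroup.FG N] (δ : X.LDual →+ ℚ) (p : X.cocycles) :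
    δ (X.toLDual p) = ∑ i, p.1.1 i * δ (X.D i) := by
  obtain ⟨m, hm, k, hk, h⟩ := X.exists_nsmul_toLDual p
  have hm' : (m : ℚ) ≠ 0 := by exact_mod_cast hm.ne'
  have h1 := congrArg δ h
  rw [map_nsmul, map_sum, nsmul_eq_mul] at h1
  refine mul_left_cancel₀ hm' (h1.trans ?_)
  rw [Finset.mul_sum]
  refine Finset.sum_congr rfl fun i _ => ?_
  rw [map_zsmul, zsmul_eq_mul, ← hk, mul_assoc]

variable {X} in
lemma ratHom_ext [AddGroup.FG N] {δ δ' : X.LDual →+ ℚ} (h : ∀ i, δ (X.D i) = δ' (X.D i)) :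
    δ = δ' :=
  hom_ext_toLDual fun p => by simp only [ratHom_toLDual, h]

variable {X} in
-- Coboundaries are zero in `𝕃^∨`, so `∑ v(ρᵢ) δ(Dᵢ) = 0` for every `v : N → ℚ`, and these
-- functionals detect vanishing in `N ⊗ ℚ`.
lemma ratHom_relation [AddGroup.FG N] (δ : X.LDual →+ ℚ) :
    ∑ i, (δ (X.D i) : ℝ) • toReal (X.ρ i) = 0 := by
  rw [← toReal_zero]
  refine sum_smul_toReal_eq_zero fun v => ?_
  have := ratHom_toLDual δ (X.coboundary v)
  rw [toLDual_coboundary, map_zero] at this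
  rw [map_zero]
  exact this.symm

lemma sum_mul_of_relation {a : Fin n → ℝ} {b : N} (h : ∑ i, a i • toReal (X.ρ i) = toReal b)
    (v : N →+ ℚ) : ∑ i, (v (X.ρ i) : ℝ) * a i = v b := by
  have h1 := congrArg (realPair v) h
  rw [map_sum] at h1
  simp only [map_smul, realPair_toReal, smul_eq_mul] at h1
  rw [← h1]
  exact Finset.sum_congr rfl fun i _ => mul_comm _ _

/-- The homomorphism `𝕃^∨ → ℚ` given by a relation between the `ρ̄ᵢ`. -/
def degLift (d : Fin n → ℚ) (h : ∑ i, (d i : ℝ) • toReal (X.ρ i) = 0) : X.LDual →+ ℚ :=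
  X.liftLDual
    { toFun := fun p => ∑ i, p.1.1 i * d i
      map_zero' := by simp
      map_add' := fun p q => by
        simp only [AddSubgroup.coe_add, Prod.fst_add, Pi.add_apply, add_mul,
          Finset.sum_add_distrib] } (by
      intro v
      have := X.sum_mul_of_relation (b := 0) (h.trans toReal_zero.symm) v
      rw [map_zero] at this
      change ∑ i, v (X.ρ i) * d i = 0
      exact_mod_cast this)

lemma degLift_toLDual (d : Fin n → ℚ) (h) (p : X.cocycles) :
    X.degLift d h (X.toLDual p) = ∑ i, p.1.1 i * d i := rfl

lemma degLift_D (d : Fin n → ℚ) (h) (i : Fin n) : X.degLift d h (X.D i) = d i := by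
  rw [D, degLift_toLDual]
  simp [Pi.single_apply]

/-- The logarithm of `expElt`. -/
def expLog (a : Fin n → ℝ) (b : N) (h : ∑ i, a i • toReal (X.ρ i) = toReal b) :
    X.LDual →+ AddCircle (1 : ℝ) :=
  X.liftLDual (X.preLog a b) (X.preLog_coboundary a b h)

lemma expLog_toLDual (a : Fin n → ℝ) (b : N) (h) (p : X.cocycles) :
    X.expLog a b h (X.toLDual p) =
      ((∑ i, (p.1.1 i : ℝ) * a i : ℝ) : AddCircle (1 : ℝ)) - ratToRealCircle (p.1.2 b) := rfl

lemma expLog_D (a : Fin n → ℝ) (b : N) (h) (i : Fin n) :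
    X.expLog a b h (X.D i) = (a i : AddCircle (1 : ℝ)) := by
  have e : ∑ k, (((Pi.single i 1 : Fin n → ℚ) k : ℚ) : ℝ) * a k = a i := by
    rw [Finset.sum_eq_single i (fun k _ hk => by simp [hk]) (by simp)]
    simp
  rw [D, expLog_toLDual, e, AddMonoidHom.zero_apply, map_zero, sub_zero]

lemma expLog_add (a a' : Fin n → ℝ) (b b' : N) (h h' h'') :
    X.expLog (a + a') (b + b') h'' = X.expLog a b h + X.expLog a' b' h' := by
  refine hom_ext_toLDual fun p => ?_
  simp only [AddMonoidHom.add_apply, expLog_toLDual, Pi.add_apply, mul_add,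
    Finset.sum_add_distrib, AddCircle.coe_add, map_add]
  abel

lemma expLog_sub (a a' : Fin n → ℝ) (b b' : N) (h h' h'') :
    X.expLog (a - a') (b - b') h'' = X.expLog a b h - X.expLog a' b' h' := by
  rw [eq_sub_iff_add_eq, ← expLog_add _ _ _ _ _ _ _ (by simpa using h)]
  congr 1 <;> abel

lemma nsmul_relation {a : Fin n → ℝ} {b : N} (h : ∑ i, a i • toReal (X.ρ i) = toReal b) (m : ℕ) :
    ∑ i, (m • a) i • toReal (X.ρ i) = toReal (m • b) := by
  rw [toReal_nsmul, ← h, Finset.smul_sum]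
  simp [mul_smul]

lemma expLog_nsmul (a : Fin n → ℝ) (b : N) (h) (m : ℕ) :
    X.expLog (m • a) (m • b) (X.nsmul_relation h m) = m • X.expLog a b h := by
  refine hom_ext_toLDual fun p => ?_
  rw [AddMonoidHom.nsmul_apply]
  simp only [expLog_toLDual, map_nsmul, smul_sub, ← AddCircle.coe_nsmul, Finset.smul_sum,
    Pi.smul_apply, mul_smul_comm]

/-- Places degrees modulo `ℤ` and box elements in one family, where they can be added and compared.
-/
lemma coe_degLift (d : Fin n → ℚ) (h) (x : X.LDual) :
    ((X.degLift d h x : ℝ) : AddCircle (1 : ℝ)) =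
      X.expLog (fun i => d i) 0 (h.trans toReal_zero.symm) x := by
  obtain ⟨p, rfl⟩ := X.toLDual_surjective x
  simp [degLift_toLDual, expLog_toLDual]

/-- The values on the `Dᵢ` force `a` to be an integral vector `k`. The homomorphism then takes the
class of `(u, χ)` to `χ(∑ kᵢ ρᵢ - b)`; every `χ` occurs in a cocycle, and characters with values in
`ℚ/ℤ` separate the points of `N`. -/
lemma expLog_eq_zero_iff (a : Fin n → ℝ) (b : N) (h) :
    X.expLog a b h = 0 ↔ ∃ k : Fin n → ℤ, (∀ i, a i = k i) ∧ b = ∑ i, k i • X.ρ i := by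
  have key : ∀ k : Fin n → ℤ, (∀ i, a i = k i) → ∀ p : X.cocycles,
      X.expLog a b h (X.toLDual p) = ratToRealCircle (p.1.2 (∑ i, k i • X.ρ i - b)) := by
    intro k hk p
    rw [expLog_toLDual, map_sub, map_sub, map_sum]
    congr 1
    rw [realCircle_coe_sum]
    refine (Finset.sum_congr rfl fun i _ => ?_).trans (map_sum _ _ _).symm
    rw [map_zsmul, map_zsmul, ← p.2 i, ratToRealCircle_coe, ← AddCircle.coe_zsmul, hk, zsmul_eq_mul,
      mul_comm]
  constructor
  · intro h0
    have h1 : ∀ i, ∃ k : ℤ, a i = k := fun i => by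
      rw [← realCircle_coe_eq_zero_iff, ← X.expLog_D a b h, h0, AddMonoidHom.zero_apply]
    choose k hk using h1
    refine ⟨k, hk, (sub_eq_zero.1 (CharacterModule.eq_zero_of_character_apply fun χ => ?_)).symm⟩
    obtain ⟨p, rfl⟩ := X.exists_cocycle χ
    refine ratToRealCircle_eq_zero ?_
    have := key k hk p
    rw [h0, AddMonoidHom.zero_apply] at this
    exact this.symm
  · rintro ⟨k, hk, hb⟩
    refine hom_ext_toLDual fun p => ?_
    rw [key k hk, hb, sub_self, map_zero, map_zero, AddMonoidHom.zero_apply]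

/-- One multiple makes `a` integral; what then remains is a torsion element of `N`, killed by a
further multiple. -/
lemma exists_nsmul_expLog_eq_zero [AddGroup.FG N] (a : Fin n → ℚ) (b : N)
    (h : ∑ i, (a i : ℝ) • toReal (X.ρ i) = toReal b) :
    ∃ m : ℕ, 0 < m ∧ m • X.expLog (fun i => a i) b h = 0 := by
  obtain ⟨m, hm, k, hk⟩ := exists_common_denominator a
  have hk' : ∀ i, (m : ℝ) * a i = k i := fun i => by exact_mod_cast hk i
  have h1 : toReal (m • b - ∑ i, k i • X.ρ i) = 0 := by
    simp only [toReal_sub, toReal_sum, toReal_zsmul, toReal_nsmul, ← h, ← hk', mul_smul,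
      Finset.smul_sum, sub_self]
  obtain ⟨m', hm', h2⟩ := exists_nsmul_eq_zero_of_toReal h1
  refine ⟨m' * m, Nat.mul_pos hm' hm, ?_⟩
  rw [← expLog_nsmul, expLog_eq_zero_iff]
  refine ⟨fun i => m' * k i, fun i => ?_, ?_⟩
  · simp [← hk', mul_assoc]
  · rw [smul_sub, sub_eq_zero] at h2
    rw [mul_smul, h2, Finset.smul_sum]
    simp [mul_smul]

end StackyFan

end

/-! ### The Picard group of `ℙ_{r₁,r₂}` -/

section

namespace orbiLine

open StackyFan

variable (r₁ r₂ : ℕ+)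

lemma mem_U_iff (x : Fin 2 → ℂ) : x ∈ (orbiLine r₁ r₂).U ↔ x ≠ 0 := by
  constructor
  · rintro hx rfl
    refine hx ∅ ?_ (by simp)
    change ¬ ((∅ : Finset (Fin 2))ᶜ = ∅ ∨ (∅ : Finset (Fin 2))ᶜ = {0} ∨
      (∅ : Finset (Fin 2))ᶜ = {1})
    decide
  · intro hx I hI h
    change ¬ (Iᶜ = ∅ ∨ Iᶜ = {0} ∨ Iᶜ = {1}) at hI
    have key : ∀ J : Finset (Fin 2), ¬ (Jᶜ = ∅ ∨ Jᶜ = {0} ∨ Jᶜ = {1}) → J = ∅ := by decide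
    obtain rfl := key I hI
    exact hx (funext fun i => h i (by simp))

/-- A character of `ℤ` lifts to `ℚ`, so a coboundary can be subtracted to make the character
component zero; the remaining vector is integral. -/
lemma toLDual_eq (p : (orbiLine r₁ r₂).cocycles) :
    ∃ k : Fin 2 → ℤ, (orbiLine r₁ r₂).toLDual p = ∑ i, k i • (orbiLine r₁ r₂).D i := by
  obtain ⟨q, hq⟩ := exists_coe_eq_ratCircle (p.1.2 1)
  let v : ℤ →+ ℚ := zmultiplesHom ℚ q
  have hv : (p - (orbiLine r₁ r₂).coboundary v).1.2 = 0 := by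
    refine AddMonoidHom.ext_int ?_
    change p.1.2 1 - ((v 1 : ℚ) : AddCircle (1 : ℚ)) = 0
    simp [v, hq]
  have h : ∀ i, ∃ k : ℤ, (p - (orbiLine r₁ r₂).coboundary v).1.1 i = k := by
    intro i
    rw [← ratCircle_coe_eq_zero_iff, (p - (orbiLine r₁ r₂).coboundary v).2 i, hv]
    rfl
  choose k hk using h
  refine ⟨k, ?_⟩
  rw [← toLDual_intCocycle, ← sub_zero ((orbiLine r₁ r₂).toLDual p), ← toLDual_coboundary _ v,
    ← map_sub]
  congr 1
  exact Subtype.ext (Prod.ext (funext hk) hv)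

lemma LDual_eq (L : (orbiLine r₁ r₂).LDual) :
    ∃ k l : ℤ, L = k • (orbiLine r₁ r₂).D 0 + l • (orbiLine r₁ r₂).D 1 := by
  obtain ⟨p, rfl⟩ := (orbiLine r₁ r₂).toLDual_surjective L
  obtain ⟨k, hk⟩ := toLDual_eq r₁ r₂ p
  exact ⟨k 0, k 1, by rw [hk, Fin.sum_univ_two]⟩

variable {r₁ r₂} in
lemma hom_ext {A : Type*} [AddCommGroup A] {φ ψ : (orbiLine r₁ r₂).LDual →+ A}
    (h0 : φ ((orbiLine r₁ r₂).D 0) = ψ ((orbiLine r₁ r₂).D 0))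
    (h1 : φ ((orbiLine r₁ r₂).D 1) = ψ ((orbiLine r₁ r₂).D 1)) : φ = ψ := by
  ext L
  obtain ⟨k, l, rfl⟩ := LDual_eq r₁ r₂ L
  simp only [map_add, map_zsmul, h0, h1]

variable {r₁ r₂} in
lemma char_ext {g h : (orbiLine r₁ r₂).G}
    (h0 : g ((orbiLine r₁ r₂).D 0) = h ((orbiLine r₁ r₂).D 0))
    (h1 : g ((orbiLine r₁ r₂).D 1) = h ((orbiLine r₁ r₂).D 1)) : g = h := by
  ext L
  obtain ⟨k, l, rfl⟩ := LDual_eq r₁ r₂ L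
  simp only [AddChar.map_add_eq_mul, AddChar.map_zsmul_eq_zpow, h0, h1]

lemma relation : (r₁ : ℕ) • (orbiLine r₁ r₂).D 0 = (r₂ : ℕ) • (orbiLine r₁ r₂).D 1 := by
  have h := toLDual_coboundary (orbiLine r₁ r₂) (Int.castAddHom ℚ)
  have e : (orbiLine r₁ r₂).coboundary (Int.castAddHom ℚ) =
      (orbiLine r₁ r₂).intCocycle ![-(r₁ : ℤ), r₂] := by
    refine Subtype.ext (Prod.ext (funext fun i => ?_) (AddMonoidHom.ext_int ?_))
    · rfl
    · exact ratCircle_coe_eq_zero_iff.2 ⟨1, by simp⟩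
  rw [e, toLDual_intCocycle, Fin.sum_univ_two] at h
  simp only [Matrix.cons_val_zero, Matrix.cons_val_one, neg_smul, natCast_zsmul] at h
  exact neg_add_eq_zero.1 h

lemma deg_toLDual (p : (orbiLine r₁ r₂).cocycles) :
    deg r₁ r₂ ((orbiLine r₁ r₂).toLDual p) = p.1.1 0 / (r₁ : ℚ) + p.1.1 1 / (r₂ : ℚ) := rfl

@[simp] lemma deg_D_zero : deg r₁ r₂ ((orbiLine r₁ r₂).D 0) = 1 / (r₁ : ℚ) := by
  rw [StackyFan.D, deg_toLDual]
  simp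

@[simp] lemma deg_D_one : deg r₁ r₂ ((orbiLine r₁ r₂).D 1) = 1 / (r₂ : ℚ) := by
  rw [StackyFan.D, deg_toLDual]
  simp

lemma cast_ne_zero (r : ℕ+) : (r : ℝ) ≠ 0 := by exact_mod_cast r.ne_zero

lemma ratCast_ne_zero (r : ℕ+) : (r : ℚ) ≠ 0 := by exact_mod_cast r.ne_zero

/-- The logarithm of `genZero`. -/
def logZero : (orbiLine r₁ r₂).LDual →+ AddCircle (1 : ℝ) :=
  (orbiLine r₁ r₂).expLog ![1 / (r₁ : ℝ), 0] (-1) (by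
    have e : toReal (-(r₁ : ℤ)) = (r₁ : ℝ) • toReal (-1 : ℤ) := by
      rw [show (-(r₁ : ℤ)) = (r₁ : ℕ) • (-1 : ℤ) by simp, toReal_nsmul]
    rw [Fin.sum_univ_two]
    change (1 / (r₁ : ℝ)) • toReal (-(r₁ : ℤ)) + (0 : ℝ) • toReal (r₂ : ℤ) = _
    rw [zero_smul, add_zero, e, smul_smul, one_div_mul_cancel (cast_ne_zero r₁), one_smul])

/-- The logarithm of `genInfty`. -/
def logInfty : (orbiLine r₁ r₂).LDual →+ AddCircle (1 : ℝ) :=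
  (orbiLine r₁ r₂).expLog ![0, 1 / (r₂ : ℝ)] 1 (by
    have e : toReal (r₂ : ℤ) = (r₂ : ℝ) • toReal (1 : ℤ) := by
      conv_lhs => rw [show (r₂ : ℤ) = (r₂ : ℕ) • (1 : ℤ) by simp, toReal_nsmul]
    rw [Fin.sum_univ_two]
    change (0 : ℝ) • toReal (-(r₁ : ℤ)) + (1 / (r₂ : ℝ)) • toReal (r₂ : ℤ) = _
    rw [zero_smul, zero_add, e, smul_smul, one_div_mul_cancel (cast_ne_zero r₂), one_smul])

lemma genZero_eq : genZero r₁ r₂ = circleChar (logZero r₁ r₂) := rfl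

lemma genInfty_eq : genInfty r₁ r₂ = circleChar (logInfty r₁ r₂) := rfl

@[simp] lemma logZero_D_zero :
    logZero r₁ r₂ ((orbiLine r₁ r₂).D 0) = ((1 / (r₁ : ℝ) : ℝ) : AddCircle (1 : ℝ)) :=
  expLog_D _ _ _ _ _

@[simp] lemma logZero_D_one : logZero r₁ r₂ ((orbiLine r₁ r₂).D 1) = 0 := expLog_D _ _ _ _ _

@[simp] lemma logInfty_D_zero : logInfty r₁ r₂ ((orbiLine r₁ r₂).D 0) = 0 := expLog_D _ _ _ _ _

@[simp] lemma logInfty_D_one :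
    logInfty r₁ r₂ ((orbiLine r₁ r₂).D 1) = ((1 / (r₂ : ℝ) : ℝ) : AddCircle (1 : ℝ)) :=
  expLog_D _ _ _ _ _

/-- Reduction modulo `ℤ` of homomorphisms to `ℚ`. -/
def _root_.ratReduce : ℚ →+ AddCircle (1 : ℝ) :=
  (QuotientAddGroup.mk' (AddSubgroup.zmultiples (1 : ℝ))).comp (Rat.castHom ℝ).toAddMonoidHom

lemma _root_.ratReduce_apply (q : ℚ) : ratReduce q = ((q : ℝ) : AddCircle (1 : ℝ)) := rfl

/-- It suffices to check `D₀` and `D₁`. The identity makes the isotropy action at `∞` a function of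
the degree and of the action at `0`. -/
lemma ratReduce_comp_deg : ratReduce.comp (deg r₁ r₂) = logZero r₁ r₂ + logInfty r₁ r₂ := by
  refine hom_ext ?_ ?_ <;> simp [ratReduce_apply]

lemma ratReduce_deg (L : (orbiLine r₁ r₂).LDual) :
    ratReduce (deg r₁ r₂ L) = logZero r₁ r₂ L + logInfty r₁ r₂ L :=
  DFunLike.congr_fun (ratReduce_comp_deg r₁ r₂) L

lemma nsmul_one_div (r : ℕ+) :
    (r : ℕ) • ((1 / (r : ℝ) : ℝ) : AddCircle (1 : ℝ)) = 0 := by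
  rw [← AddCircle.coe_nsmul, realCircle_coe_eq_zero_iff]
  exact ⟨1, by rw [nsmul_eq_mul, mul_one_div_cancel (cast_ne_zero r), Int.cast_one]⟩

lemma nsmul_logZero : (r₁ : ℕ) • logZero r₁ r₂ = 0 := by
  refine hom_ext ?_ ?_
  · rw [AddMonoidHom.nsmul_apply, logZero_D_zero, nsmul_one_div, AddMonoidHom.zero_apply]
  · simp

lemma nsmul_logInfty : (r₂ : ℕ) • logInfty r₁ r₂ = 0 := by
  refine hom_ext ?_ ?_
  · simp
  · rw [AddMonoidHom.nsmul_apply, logInfty_D_one, nsmul_one_div, AddMonoidHom.zero_apply]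

/-- An element of `Pic(ℙ_{r₁,r₂})` is determined by its degree and by the action of the isotropy
group at `0`. -/
lemma eq_zero_of_deg_of_logZero {L : (orbiLine r₁ r₂).LDual} (hd : deg r₁ r₂ L = 0)
    (h0 : logZero r₁ r₂ L = 0) : L = 0 := by
  obtain ⟨k, l, rfl⟩ := LDual_eq r₁ r₂ L
  have h1 := ratCast_ne_zero r₁
  have h2 := ratCast_ne_zero r₂
  rw [map_add, map_zsmul, map_zsmul, logZero_D_zero, logZero_D_one, smul_zero, add_zero,
    ← AddCircle.coe_zsmul, realCircle_coe_eq_zero_iff] at h0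
  obtain ⟨m, hm⟩ := h0
  have hk : (k : ℚ) = m * r₁ := by
    rw [zsmul_eq_mul, mul_one_div, div_eq_iff (cast_ne_zero r₁)] at hm
    exact_mod_cast hm
  rw [map_add, map_zsmul, map_zsmul, deg_D_zero, deg_D_one, zsmul_eq_mul, zsmul_eq_mul, hk] at hd
  field_simp at hd
  have hk' : k = m * ((r₁ : ℕ) : ℤ) := by exact_mod_cast hk
  have hl : l = -m * ((r₂ : ℕ) : ℤ) := by
    have : (l : ℚ) = -m * r₂ := by linarith
    exact_mod_cast this
  -- Trivial isotropy at `0` gives `k = m r₁` and degree zero gives `l = -m r₂`, so the element is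
  -- `m (r₁ D₀ - r₂ D₁) = 0`.
  rw [hk', hl, mul_smul, mul_smul, natCast_zsmul, natCast_zsmul, relation, neg_smul,
    add_neg_cancel]

lemma eq_of_deg_of_logZero {L L' : (orbiLine r₁ r₂).LDual} (hd : deg r₁ r₂ L = deg r₁ r₂ L')
    (h0 : logZero r₁ r₂ L = logZero r₁ r₂ L') : L = L' := by
  rw [← sub_eq_zero]
  exact eq_zero_of_deg_of_logZero r₁ r₂ (by rw [map_sub, hd, sub_self])
    (by rw [map_sub, h0, sub_self])

/-- If `t` lifts `y`, the conditions say that `k = r₁ t` and `l = r₂ (x - t)` are integers, and `k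
D₀ + l D₁` has the required invariants. -/
lemma exists_deg_logZero {x : ℚ} {y : AddCircle (1 : ℝ)} (h1 : (r₁ : ℕ) • y = 0)
    (h2 : (r₂ : ℕ) • (ratReduce x - y) = 0) : ∃ L, deg r₁ r₂ L = x ∧ logZero r₁ r₂ L = y := by
  obtain ⟨t, rfl⟩ := QuotientAddGroup.mk_surjective y
  change (r₁ : ℕ) • (t : AddCircle (1 : ℝ)) = 0 at h1
  change (r₂ : ℕ) • (((x : ℝ) : AddCircle (1 : ℝ)) - (t : AddCircle (1 : ℝ))) = 0 at h2
  rw [← AddCircle.coe_nsmul, realCircle_coe_eq_zero_iff, nsmul_eq_mul] at h1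
  rw [← AddCircle.coe_sub, ← AddCircle.coe_nsmul, realCircle_coe_eq_zero_iff, nsmul_eq_mul] at h2
  obtain ⟨k, hk⟩ := h1
  obtain ⟨l, hl⟩ := h2
  have c1 := cast_ne_zero r₁
  have c2 := cast_ne_zero r₂
  refine ⟨k • (orbiLine r₁ r₂).D 0 + l • (orbiLine r₁ r₂).D 1, ?_, ?_⟩
  · rw [map_add, map_zsmul, map_zsmul, deg_D_zero, deg_D_one, zsmul_eq_mul, zsmul_eq_mul]
    have : (k : ℝ) * (1 / (r₁ : ℝ)) + l * (1 / (r₂ : ℝ)) = x := by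
      rw [← hk, ← hl]
      field_simp
      ring
    refine Rat.cast_injective (α := ℝ) ?_
    push_cast
    exact this
  · rw [map_add, map_zsmul, map_zsmul, logZero_D_zero, logZero_D_one, smul_zero, add_zero,
      ← AddCircle.coe_zsmul, zsmul_eq_mul, ← hk, mul_one_div, mul_div_cancel_left₀ _ c1]

/-- The values are chosen separately for each element of `A`; because degree and isotropy at `0`
determine them, the choice is automatically additive. -/
lemma exists_hom {A : Type*} [AddCommGroup A] (δ : A →+ ℚ) (γ : A →+ AddCircle (1 : ℝ))
    (h1 : (r₁ : ℕ) • γ = 0) (h2 : (r₂ : ℕ) • (ratReduce.comp δ - γ) = 0) :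
    ∃ Φ : A →+ (orbiLine r₁ r₂).LDual,
      (deg r₁ r₂).comp Φ = δ ∧ (logZero r₁ r₂).comp Φ = γ := by
  choose f hf hf' using fun a => exists_deg_logZero r₁ r₂ (x := δ a) (y := γ a)
    (DFunLike.congr_fun h1 a) (DFunLike.congr_fun h2 a)
  refine ⟨AddMonoidHom.mk' f fun a b => eq_of_deg_of_logZero r₁ r₂ ?_ ?_, ?_, ?_⟩
  · simp only [map_add, hf]
  · simp only [map_add, hf']
  · ext a
    exact hf a
  · ext a
    exact hf' a

/-- The characters of `𝕃^∨` separate points. -/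
lemma eq_of_forall_char {L L' : (orbiLine r₁ r₂).LDual}
    (h : ∀ g : (orbiLine r₁ r₂).G, g L = g L') : L = L' := by
  have key : ∀ γ : (orbiLine r₁ r₂).LDual →+ AddCircle (1 : ℝ), γ (L - L') = 0 := fun γ => by
    rw [map_sub, sub_eq_zero]
    exact toCircle_coe_injective (h (circleChar γ))
  rw [← sub_eq_zero]
  refine eq_zero_of_deg_of_logZero r₁ r₂ ?_ (key _)
  by_contra hd
  -- The degree divided by twice its value at `L - L'`: this homomorphism would take the value `1/2
  -- ≠ 0` in `ℝ/ℤ` there.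
  have := key ((QuotientAddGroup.mk' (AddSubgroup.zmultiples (1 : ℝ))).comp
    ((AddMonoidHom.mulRight (1 / (2 * (deg r₁ r₂ (L - L') : ℝ)))).comp
      ((Rat.castHom ℝ).toAddMonoidHom.comp (deg r₁ r₂))))
  change (((deg r₁ r₂ (L - L') : ℝ) * (1 / (2 * (deg r₁ r₂ (L - L') : ℝ))) : ℝ) :
    AddCircle (1 : ℝ)) = 0 at this
  obtain ⟨k, hk⟩ := realCircle_coe_eq_zero_iff.1 this
  have hd' : (deg r₁ r₂ (L - L') : ℝ) ≠ 0 := by exact_mod_cast hd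
  have hk' : (1 : ℝ) = 2 * k := by
    rw [← hk]
    field_simp
  have : (1 : ℤ) = 2 * k := by exact_mod_cast hk'
  omega

lemma exists_pow_of_pow_eq_one (r : ℕ+) {t : ℂ} (h : t ^ (r : ℕ) = 1) : ∃ k : ℕ,
    t = (AddCircle.toCircle ((1 / (r : ℝ) : ℝ) : AddCircle (1 : ℝ)) : ℂ) ^ k := by
  have : NeZero (r : ℕ) := ⟨r.ne_zero⟩
  obtain ⟨k, -, hk⟩ := (Complex.isPrimitiveRoot_exp (r : ℕ) r.ne_zero).eq_pow_of_pow_eq_one h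
  refine ⟨k, ?_⟩
  rw [← hk, AddCircle.toCircle_apply_mk, Circle.coe_exp]
  congr 2
  push_cast
  ring

/-- The relation `r₁ D₀ = r₂ D₁` makes `g(D₀)` an `r₁`-th root of unity. -/
lemma eq_genZero_pow {g : (orbiLine r₁ r₂).G} (h : g ((orbiLine r₁ r₂).D 1) = 1) :
    ∃ k : ℕ, g = genZero r₁ r₂ ^ k := by
  obtain ⟨k, hk⟩ := exists_pow_of_pow_eq_one r₁ (t := g ((orbiLine r₁ r₂).D 0)) (by
    rw [← AddChar.map_nsmul_eq_pow, relation, AddChar.map_nsmul_eq_pow, h, one_pow])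
  refine ⟨k, char_ext ?_ ?_⟩
  · rw [hk, AddChar.pow_apply, genZero_eq, circleChar_apply, logZero_D_zero]
  · rw [h, AddChar.pow_apply, genZero_eq, circleChar_apply, logZero_D_one, AddCircle.toCircle_zero,
      Circle.coe_one, one_pow]

lemma eq_genInfty_pow {g : (orbiLine r₁ r₂).G} (h : g ((orbiLine r₁ r₂).D 0) = 1) :
    ∃ k : ℕ, g = genInfty r₁ r₂ ^ k := by
  obtain ⟨k, hk⟩ := exists_pow_of_pow_eq_one r₂ (t := g ((orbiLine r₁ r₂).D 1)) (by
    rw [← AddChar.map_nsmul_eq_pow, ← relation, AddChar.map_nsmul_eq_pow, h, one_pow])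
  refine ⟨k, char_ext ?_ ?_⟩
  · rw [h, AddChar.pow_apply, genInfty_eq, circleChar_apply, logInfty_D_zero,
      AddCircle.toCircle_zero, Circle.coe_one, one_pow]
  · rw [hk, AddChar.pow_apply, genInfty_eq, circleChar_apply, logInfty_D_one]

end orbiLine

end

/-! ### Morphisms as homomorphisms of Picard groups; representability -/

section

namespace orbiLine

open StackyFan

variable {r₁ r₂ : ℕ+}

/-- A point of `ℂ² ∖ {0}`. -/
def mkPoint (x : Fin 2 → ℂ) (hx : x ≠ 0) : (orbiLine r₁ r₂).U := ⟨x, (mem_U_iff r₁ r₂ x).2 hx⟩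

lemma point_ne_zero (x : (orbiLine r₁ r₂).U) : x.1 ≠ 0 := (mem_U_iff r₁ r₂ x.1).1 x.2

/-- The point `(1, 1)`. -/
def unitPoint : (orbiLine r₁ r₂).U := mkPoint 1 one_ne_zero

/-- The point `(0, 1)` over `0`. -/
def pointZero : (orbiLine r₁ r₂).U :=
  mkPoint ![0, 1] fun h => one_ne_zero (α := ℂ) (congrFun h 1)

/-- The point `(1, 0)` over `∞`. -/
def pointInfty : (orbiLine r₁ r₂).U :=
  mkPoint ![1, 0] fun h => one_ne_zero (α := ℂ) (congrFun h 0)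

/-- Units on `ℂ² ∖ {0}` are constant, since the origin has codimension two. -/
lemma IsRegular.eq_of_ne_zero {h : (orbiLine r₁ r₂).U → ℂ} (hr : IsRegular h)
    (h0 : ∀ x, h x ≠ 0) (x y : (orbiLine r₁ r₂).U) : h x = h y := by
  obtain ⟨p, hp⟩ := hr
  obtain ⟨c, -, rfl⟩ := constant_of_ne_zero_off_origin (p := p) fun x hx => by
    exact fun h => h0 (mkPoint x hx) ((hp _).trans h)
  rw [hp, hp, MvPolynomial.eval_C, MvPolynomial.eval_C]

lemma IsRegularArrow.isRegular {h : (orbiLine r₁ r₂).G → (orbiLine r₁ r₂).U → ℂ}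
    (hr : IsRegularArrow h) (g : (orbiLine r₁ r₂).G) : IsRegular (h g) := by
  obtain ⟨s, hs⟩ := hr
  refine ⟨s.sum fun t p => MvPolynomial.C (g t) * p, fun x => ?_⟩
  rw [hs, Finsupp.sum, Finsupp.sum, map_sum]
  simp

/-- Evaluation at an element of `𝕃^∨`, as a character of the group `Hom(𝕃^∨, ℂ^×)`. -/
def evalHom (L : (orbiLine r₁ r₂).LDual) : (orbiLine r₁ r₂).G →* ℂ where
  toFun g := g L
  map_one' := rfl
  map_mul' _ _ := rfl

/-- A multiplicative regular function on the diagonalizable group is one of its characters. -/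
lemma exists_eq_evalHom (φ : (orbiLine r₁ r₂).G →* ℂ) (s : (orbiLine r₁ r₂).LDual →₀ ℂ)
    (h : ∀ g, φ g = s.sum fun L c => g L * c) : ∃ L, φ = evalHom L := by
  by_contra hne
  have hφ : φ ∉ Set.range (evalHom (r₁ := r₁) (r₂ := r₂)) := by
    rintro ⟨L, hL⟩
    exact hne ⟨L, hL.symm⟩
  -- Dedekind's independence of characters: a character in the span of the evaluations must be one
  -- of them.
  refine (linearIndependent_monoidHom (orbiLine r₁ r₂).G ℂ).notMem_span_image hφ ?_
  have e : (φ : (orbiLine r₁ r₂).G → ℂ) = s.sum fun L c => c • (evalHom L : _ → ℂ) := by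
    funext g
    rw [h, Finsupp.sum, Finsupp.sum, Finset.sum_apply]
    exact Finset.sum_congr rfl fun L _ => mul_comm _ _
  rw [e]
  exact Submodule.sum_mem _ fun L _ => Submodule.smul_mem _ _
    (Submodule.subset_span ⟨evalHom L, ⟨L, rfl⟩, rfl⟩)

lemma dvd_of_nsmul_one_div {r : ℕ+} {k : ℕ}
    (h : k • ((1 / (r : ℝ) : ℝ) : AddCircle (1 : ℝ)) = 0) : (r : ℕ) ∣ k := by
  rw [← AddCircle.coe_nsmul, realCircle_coe_eq_zero_iff] at h
  obtain ⟨m, hm⟩ := h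
  rw [nsmul_eq_mul, mul_one_div, div_eq_iff (cast_ne_zero r)] at hm
  have : (k : ℤ) = m * (r : ℕ) := by exact_mod_cast hm
  exact Int.natCast_dvd_natCast.1 ⟨m, by rw [this, mul_comm]⟩

lemma dvd_of_nsmul_logZero {k : ℕ} (h : k • logZero r₁ r₂ = 0) : (r₁ : ℕ) ∣ k :=
  dvd_of_nsmul_one_div (by
    rw [← logZero_D_zero r₁ r₂, ← AddMonoidHom.nsmul_apply, h, AddMonoidHom.zero_apply])

lemma dvd_of_nsmul_logInfty {k : ℕ} (h : k • logInfty r₁ r₂ = 0) : (r₂ : ℕ) ∣ k :=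
  dvd_of_nsmul_one_div (by
    rw [← logInfty_D_one r₁ r₂, ← AddMonoidHom.nsmul_apply, h, AddMonoidHom.zero_apply])

lemma genZero_pow_act {x : (orbiLine r₁ r₂).U} (hx : x.1 0 = 0) (k : ℕ) :
    (orbiLine r₁ r₂).actU (genZero r₁ r₂ ^ k) x = x := by
  refine Subtype.ext (funext fun i => ?_)
  change (genZero r₁ r₂ ^ k) ((orbiLine r₁ r₂).D i) * x.1 i = x.1 i
  fin_cases i
  · simp [hx]
  · simp [genZero_eq, circleChar_apply]

lemma genInfty_pow_act {x : (orbiLine r₁ r₂).U} (hx : x.1 1 = 0) (k : ℕ) :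
    (orbiLine r₁ r₂).actU (genInfty r₁ r₂ ^ k) x = x := by
  refine Subtype.ext (funext fun i => ?_)
  change (genInfty r₁ r₂ ^ k) ((orbiLine r₁ r₂).D i) * x.1 i = x.1 i
  fin_cases i
  · simp [genInfty_eq, circleChar_apply]
  · simp [hx]

lemma eq_one_of_act {g : (orbiLine r₁ r₂).G} {x : (orbiLine r₁ r₂).U}
    (h : (orbiLine r₁ r₂).actU g x = x) {i : Fin 2} (hi : x.1 i ≠ 0) :
    g ((orbiLine r₁ r₂).D i) = 1 :=
  mul_right_cancel₀ hi ((congrFun (congrArg Subtype.val h) i).trans (one_mul _).symm)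

end orbiLine

namespace StackMor

open orbiLine

variable {N : Type*} [AddCommGroup N] {n : ℕ} {X : StackyFan N n} {r₁ r₂ : ℕ+}

lemma char_eq_of_regular {l : (orbiLine r₁ r₂).U → X.G}
    (hl : ∀ χ : X.LDual, orbiLine.IsRegular fun x => l x χ) (x y : (orbiLine r₁ r₂).U) :
    l x = l y := by
  ext χ
  exact (hl χ).eq_of_ne_zero (fun x => ((l x).val_isUnit χ).ne_zero) x y

lemma coc_eq (f : StackMor r₁ r₂ X) (g : (orbiLine r₁ r₂).G) (x y : (orbiLine r₁ r₂).U) :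
    f.coc g x = f.coc g y :=
  char_eq_of_regular (fun χ => (f.regular_coc χ).isRegular g) x y

/-- Independence of the point turns the cocycle identity into multiplicativity. Composed with `χ`,
the cocycle is a regular character, hence evaluation at some `L`; this `L` is additive in `χ`
because characters separate the points of `Pic ℙ_{r₁,r₂}`. -/
lemma exists_pic (f : StackMor r₁ r₂ X) : ∃ Φ : X.LDual →+ (orbiLine r₁ r₂).LDual,
    ∀ g x χ, f.coc g x χ = g (Φ χ) := by
  have h : ∀ χ, ∃ L : (orbiLine r₁ r₂).LDual, ∀ g x, f.coc g x χ = g L := by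
    intro χ
    have hmul : ∀ g h, f.coc (g * h) unitPoint = f.coc g unitPoint * f.coc h unitPoint :=
      fun g h => by rw [f.map_mul, f.coc_eq g _ unitPoint]
    let φ : (orbiLine r₁ r₂).G →* ℂ :=
      { toFun := fun g => f.coc g unitPoint χ
        map_one' := by
          have : f.coc 1 unitPoint = 1 := by
            have := hmul 1 1
            rwa [one_mul, left_eq_mul] at this
          rw [this, AddChar.one_apply]
        map_mul' := fun g h => by rw [hmul, AddChar.mul_apply] }
    obtain ⟨s, hs⟩ := f.regular_coc χ
    obtain ⟨L, hL⟩ := exists_eq_evalHom φ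
      (s.mapRange (MvPolynomial.eval (unitPoint : (orbiLine r₁ r₂).U).1) (map_zero _)) (fun g => by
        rw [Finsupp.sum_mapRange_index (by simp)]
        exact hs g unitPoint)
    exact ⟨L, fun g x => by rw [f.coc_eq g x unitPoint]; exact DFunLike.congr_fun hL g⟩
  choose Φ hΦ using h
  refine ⟨AddMonoidHom.mk' Φ fun χ ψ => eq_of_forall_char r₁ r₂ fun g => ?_, fun g x χ => hΦ χ g x⟩
  rw [AddChar.map_add_eq_mul, ← hΦ _ g unitPoint, ← hΦ _ g unitPoint, ← hΦ _ g unitPoint,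
    AddChar.map_add_eq_mul]

/-- The homomorphism `f^* : Pic X(Σ) → Pic ℙ_{r₁,r₂}`. -/
def pic (f : StackMor r₁ r₂ X) : X.LDual →+ (orbiLine r₁ r₂).LDual := f.exists_pic.choose

lemma coc_apply (f : StackMor r₁ r₂ X) (g : (orbiLine r₁ r₂).G) (x : (orbiLine r₁ r₂).U)
    (χ : X.LDual) : f.coc g x χ = g (f.pic χ) := f.exists_pic.choose_spec g x χ

lemma pic_eq_of_coc {f : StackMor r₁ r₂ X} {Φ : X.LDual →+ (orbiLine r₁ r₂).LDual}
    (h : ∀ g x χ, f.coc g x χ = g (Φ χ)) : f.pic = Φ := by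
  ext χ
  exact eq_of_forall_char r₁ r₂ fun g => by rw [← h g unitPoint, coc_apply]

lemma hasDegree_iff (f : StackMor r₁ r₂ X) (i : Fin n) (q : ℚ) :
    f.HasDegree i q ↔ deg r₁ r₂ (f.pic (X.D i)) = q := by
  constructor
  · rintro ⟨L, hL, rfl⟩
    congr 1
    exact eq_of_forall_char r₁ r₂ fun g => by rw [← hL g unitPoint, coc_apply]
  · exact fun h => ⟨_, fun g x => f.coc_apply g x _, h⟩

/-- A 2-isomorphism is a constant map to the commutative group `G`, so it cancels in the naturality
condition. -/
lemma TwoIso.pic_eq {f f' : StackMor r₁ r₂ X} (h : f.TwoIso f') : f.pic = f'.pic := by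
  obtain ⟨l, hl, -, h2⟩ := h
  refine pic_eq_of_coc fun g x χ => ?_
  have := h2 g x
  rw [char_eq_of_regular hl ((orbiLine r₁ r₂).actU g x) x, mul_comm, mul_right_inj] at this
  rw [← this, coc_apply]

lemma circleChar_comp_pic (f : StackMor r₁ r₂ X) (γ : (orbiLine r₁ r₂).LDual →+ AddCircle (1 : ℝ))
    (x : (orbiLine r₁ r₂).U) : f.coc (circleChar γ) x = circleChar (γ.comp f.pic) := by
  ext χ
  rw [coc_apply]
  rfl

lemma nsmul_comp (γ : (orbiLine r₁ r₂).LDual →+ AddCircle (1 : ℝ)) (k : ℕ)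
    (Φ : X.LDual →+ (orbiLine r₁ r₂).LDual) : k • γ.comp Φ = (k • γ).comp Φ := rfl

/-- If `k` is the order of the composite, the `k`-th power of the isotropy generator has the same
image as `1`; injectivity gives `k γ = 0`, so `r ∣ k`. -/
lemma addOrderOf_of_injective_on_isotropy (f : StackMor r₁ r₂ X) (hf : f.Representable)
    {γ : (orbiLine r₁ r₂).LDual →+ AddCircle (1 : ℝ)} {r : ℕ} {x : (orbiLine r₁ r₂).U}
    (hx : ∀ k, (orbiLine r₁ r₂).actU (circleChar γ ^ k) x = x) (h0 : r • γ = 0)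
    (hd : ∀ k : ℕ, k • γ = 0 → r ∣ k) : addOrderOf (γ.comp f.pic) = r := by
  refine Nat.dvd_antisymm (addOrderOf_dvd_of_nsmul_eq_zero ?_) (hd _ (circleChar_injective ?_))
  · rw [nsmul_comp, h0, AddMonoidHom.zero_comp]
  · have h1 := addOrderOf_nsmul_eq_zero (γ.comp f.pic)
    rw [circleChar_nsmul, circleChar_zero]
    refine hf x _ _ (hx _) (by simpa using hx 0) ?_
    rw [← circleChar_nsmul, circleChar_comp_pic, ← nsmul_comp, h1, ← circleChar_zero,
      circleChar_comp_pic, AddMonoidHom.zero_comp]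

lemma eq_of_coc_eq (f : StackMor r₁ r₂ X) {γ : (orbiLine r₁ r₂).LDual →+ AddCircle (1 : ℝ)} {r : ℕ}
    (h0 : r • γ = 0) (hr : addOrderOf (γ.comp f.pic) = r) {x : (orbiLine r₁ r₂).U} {k l : ℕ}
    (h : f.coc (circleChar γ ^ k) x = f.coc (circleChar γ ^ l) x) :
    circleChar γ ^ k = circleChar γ ^ l := by
  rw [← circleChar_nsmul, ← circleChar_nsmul, circleChar_comp_pic, circleChar_comp_pic] at h
  have h1 := circleChar_injective h
  rw [← nsmul_comp, ← nsmul_comp, nsmul_eq_nsmul_iff_modEq, hr] at h1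
  rw [← circleChar_nsmul, ← circleChar_nsmul,
    nsmul_eq_nsmul_iff_modEq.2 (h1.of_dvd (addOrderOf_dvd_of_nsmul_eq_zero h0))]

/-- Representability means that the isotropy generators have images of the maximal order. -/
lemma representable_iff (f : StackMor r₁ r₂ X) :
    f.Representable ↔ addOrderOf ((logZero r₁ r₂).comp f.pic) = (r₁ : ℕ) ∧
      addOrderOf ((logInfty r₁ r₂).comp f.pic) = (r₂ : ℕ) := by
  constructor
  · intro hf
    exact ⟨f.addOrderOf_of_injective_on_isotropy hf (x := pointZero) (genZero_pow_act rfl)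
        (nsmul_logZero r₁ r₂) fun k => dvd_of_nsmul_logZero,
      f.addOrderOf_of_injective_on_isotropy hf (x := pointInfty) (genInfty_pow_act rfl)
        (nsmul_logInfty r₁ r₂) fun k => dvd_of_nsmul_logInfty⟩
  · rintro ⟨h1, h2⟩ x g h hg hh hgh
    -- A nonzero coordinate forces an element of the stabilizer to act trivially on it, so the
    -- stabilizer consists of powers of `genZero` if `x₀ = 0`, and of powers of `genInfty`
    -- otherwise.
    by_cases hx0 : x.1 0 = 0
    · have hx1 : x.1 1 ≠ 0 := fun hx1 => point_ne_zero x (by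
        funext i
        fin_cases i
        exacts [hx0, hx1])
      obtain ⟨k, rfl⟩ := eq_genZero_pow r₁ r₂ (eq_one_of_act hg hx1)
      obtain ⟨l, rfl⟩ := eq_genZero_pow r₁ r₂ (eq_one_of_act hh hx1)
      exact f.eq_of_coc_eq (nsmul_logZero r₁ r₂) h1 hgh
    · obtain ⟨k, rfl⟩ := eq_genInfty_pow r₁ r₂ (eq_one_of_act hg hx0)
      obtain ⟨l, rfl⟩ := eq_genInfty_pow r₁ r₂ (eq_one_of_act hh hx0)
      exact f.eq_of_coc_eq (nsmul_logInfty r₁ r₂) h2 hgh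

end StackMor

end

/-! ### Monomial normal form of toric morphisms -/

section

namespace StackyFan

variable {N : Type*} [AddCommGroup N] {n : ℕ} {X : StackyFan N n}

lemma zeroSet_mem_cones {z : Fin n → ℂ} (hz : z ∈ X.U) {Z : Finset (Fin n)}
    (hZ : ∀ i, i ∈ Z ↔ z i = 0) : Z ∈ X.cones := by
  by_contra h
  refine hz Zᶜ ?_ fun i hi => (hZ i).1 (by simpa using hi)
  change Zᶜᶜ ∉ X.cones
  rwa [compl_compl]

lemma mem_U_of_zeroSet {z : Fin n → ℂ} {Z : Finset (Fin n)} (hZ : Z ∈ X.cones)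
    (h : ∀ i, z i = 0 → i ∈ Z) : z ∈ X.U := by
  intro I hI h'
  refine hI (X.face_mem Z hZ _ fun i hi => h i (h' i ?_))
  simpa using hi

lemma card_le_dim [AddGroup.FG N] {κ : Finset (Fin n)} (hκ : κ ∈ X.cones) : κ.card ≤ X.dim := by
  have : Module.Finite ℤ N := Module.Finite.iff_addGroup_fg.2 inferInstance
  have := (X.simplicial κ hκ).fintype_card_le_finrank
  rwa [Fintype.card_coe] at this

lemma eq_of_subset_of_top [AddGroup.FG N] {σ κ : Finset (Fin n)} (hσ : σ.card = X.dim)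
    (hκ : κ ∈ X.cones) (h : σ ⊆ κ) : σ = κ :=
  Finset.eq_of_subset_of_card_le h (by rw [hσ]; exact card_le_dim hκ)

variable (X) in
/-- Adjacent top-dimensional cones `σ = τ ∪ {j}` and `σ' = τ ∪ {j'}`. -/
structure AdjacentAlong (σ σ' : Finset (Fin n)) (j j' : Fin n) : Prop where
  adjacent : X.Adjacent σ σ'
  left : ∀ i, (i ∈ σ ∧ i ∉ σ') ↔ i = j
  right : ∀ i, (i ∈ σ' ∧ i ∉ σ) ↔ i = j'

lemma Adjacent.exists_along {σ σ' : Finset (Fin n)} (h : X.Adjacent σ σ') {j : Fin n}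
    (hj : j ∈ σ) (hj' : j ∉ σ') : ∃ j', X.AdjacentAlong σ σ' j j' := by
  obtain ⟨h1, h2, h3, h4, h5⟩ := h
  have e1 := Finset.card_sdiff_add_card_inter σ σ'
  have e2 := Finset.card_sdiff_add_card_inter σ' σ
  rw [Finset.inter_comm] at e2
  obtain ⟨k, hk⟩ := Finset.card_eq_one.1 (show (σ \ σ').card = 1 by omega)
  obtain ⟨j', hj''⟩ := Finset.card_eq_one.1 (show (σ' \ σ).card = 1 by omega)
  have hjk : j = k := by
    rw [← Finset.mem_singleton, ← hk, Finset.mem_sdiff]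
    exact ⟨hj, hj'⟩
  subst hjk
  refine ⟨j', ⟨h1, h2, h3, h4, h5⟩, fun i => ?_, fun i => ?_⟩
  · rw [← Finset.mem_sdiff, hk, Finset.mem_singleton]
  · rw [← Finset.mem_sdiff, hj'', Finset.mem_singleton]

end StackyFan

open StackyFan orbiLine

variable {N : Type*} [AddCommGroup N] {n : ℕ} {X : StackyFan N n} {σ σ' : Finset (Fin n)}
  {j j' : Fin n}

/-- The monomial map `ℂ² → ℂⁿ` with `zⱼ = x₀ᵃ`, `zⱼ' = x₁ᵇ`, with `zᵢ = 0` for `i ∈ σ ∩ σ'`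
and `zᵢ = 1` for the other `i`. -/
def monomialMap (σ σ' : Finset (Fin n)) (j j' : Fin n) (a b : ℕ) (x : Fin 2 → ℂ) : Fin n → ℂ :=
  fun i => if i ∈ σ ∩ σ' then 0 else
    (if i = j then x 0 ^ a else 1) * (if i = j' then x 1 ^ b else 1)

/-- Up to the action of `G`, a toric morphism is a monomial map. -/
lemma ToricCurve.normal_form [AddGroup.FG N] (H : X.AdjacentAlong σ σ' j j')
    (f : ToricCurve X σ σ') : ∃ a b : ℕ, 0 < a ∧ 0 < b ∧
      (∃ g : X.G, ∀ x, (f.map.toFun x).1 = X.act g (monomialMap σ σ' j j' a b x.1)) ∧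
      f.map.pic (X.D j) = a • (orbiLine f.r₁ f.r₂).D 0 ∧
      f.map.pic (X.D j') = b • (orbiLine f.r₁ f.r₂).D 1 ∧
      ∀ i, i ∉ σ → i ∉ σ' → f.map.pic (X.D i) = 0 := by
  obtain ⟨hσ, hσ', hcσ, hcσ', hcτ⟩ := H.adjacent
  obtain ⟨τ, hτ, hcard, hz, hhom⟩ := f.toric
  -- On the torus each coordinate vanishes identically (`i ∈ τ`) or nowhere, so it is zero or a
  -- monomial.
  have hmon : ∀ i, ∃ (c : ℂ) (a b : ℕ), (c = 0 ↔ i ∈ τ) ∧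
      ∀ x, (f.map.toFun x).1 i = c * (x.1 0 ^ a * x.1 1 ^ b) := by
    intro i
    obtain ⟨p, hp⟩ := f.map.regular_toFun i
    replace hp : ∀ x, (f.map.toFun x).1 i = MvPolynomial.eval x.1 p := hp
    have hx0 : ∀ x : Fin 2 → ℂ, (∀ k, x k ≠ 0) → x ≠ 0 := fun x hx h => hx 0 (by simp [h])
    have hzp : ∀ x : Fin 2 → ℂ, (∀ k, x k ≠ 0) → (MvPolynomial.eval x p = 0 ↔ i ∈ τ) := by
      intro x hx
      rw [← hz (mkPoint x (hx0 x hx)) hx i, hp]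
      rfl
    by_cases hi : i ∈ τ
    · have h0 := eq_zero_of_eq_zero_on_torus fun x hx => (hzp x hx).2 hi
      exact ⟨0, 0, 0, by simp [hi], fun x => by simp [hp, h0]⟩
    · obtain ⟨c, a, b, hc, h0⟩ := monomial_of_ne_zero_on_torus fun x hx h => hi ((hzp x hx).1 h)
      exact ⟨c, a, b, by simp [hi, hc], fun x => by simp [hp, h0]⟩
  choose c A B hc hF using hmon
  -- The vanishing coordinates at `(0, 1)` form a cone containing `σ`, hence equal to `σ` because
  -- `σ` is top-dimensional.
  have hA : ∀ i, i ∈ σ ↔ i ∈ τ ∨ A i ≠ 0 := by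
    classical
    let Z : Finset (Fin n) := Finset.univ.filter fun i => (f.map.toFun pointZero).1 i = 0
    have hZ : σ = Z := eq_of_subset_of_top hcσ
      (zeroSet_mem_cones (f.map.toFun pointZero).2 fun i => by simp [Z])
      fun i hi => by simpa [Z] using f.mapsZero pointZero rfl i hi
    intro i
    rw [hZ, Finset.mem_filter, hF, ← hc]
    simp [pointZero, mkPoint]
  have hB : ∀ i, i ∈ σ' ↔ i ∈ τ ∨ B i ≠ 0 := by
    classical
    let Z : Finset (Fin n) := Finset.univ.filter fun i => (f.map.toFun pointInfty).1 i = 0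
    have hZ : σ' = Z := eq_of_subset_of_top hcσ'
      (zeroSet_mem_cones (f.map.toFun pointInfty).2 fun i => by simp [Z])
      fun i hi => by simpa [Z] using f.mapsInfty pointInfty rfl i hi
    intro i
    rw [hZ, Finset.mem_filter, hF, ← hc]
    simp [pointInfty, mkPoint]
  have hτ' : τ = σ ∩ σ' := Finset.eq_of_subset_of_card_le
    (fun i hi => Finset.mem_inter.2 ⟨(hA i).2 (Or.inl hi), (hB i).2 (Or.inl hi)⟩) (by omega)
  have hτi : ∀ i, i ∈ τ ↔ i ∈ σ ∧ i ∈ σ' := fun i => by rw [hτ', Finset.mem_inter]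
  have hAj : ∀ i ∉ τ, (A i ≠ 0 ↔ i = j) := by
    intro i hi
    have h1 := hA i
    have h2 := hτi i
    have h3 := H.left i
    tauto
  have hBj : ∀ i ∉ τ, (B i ≠ 0 ↔ i = j') := by
    intro i hi
    have h1 := hB i
    have h2 := hτi i
    have h3 := H.right i
    tauto
  have hjτ : j ∉ τ := fun h => ((H.left j).2 rfl).2 ((hτi j).1 h).2
  have hj'τ : j' ∉ τ := fun h => ((H.right j').2 rfl).2 ((hτi j').1 h).1
  have hjj' : j ≠ j' := fun h => ((H.left j).2 rfl).2 (h ▸ ((H.right j').2 rfl).1)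
  -- Equivariance at `(1, 1)`, where the coordinate is the nonzero coefficient `cᵢ`; for `i ∈ τ` the
  -- coordinate is zero and gives no information.
  have hpic : ∀ i ∉ τ, f.map.pic (X.D i) =
      A i • (orbiLine f.r₁ f.r₂).D 0 + B i • (orbiLine f.r₁ f.r₂).D 1 := by
    intro i hi
    refine eq_of_forall_char _ _ fun g => ?_
    have h1 := congrFun (congrArg Subtype.val (f.map.map_act g unitPoint)) i
    rw [hF] at h1
    change c i * ((g ((orbiLine f.r₁ f.r₂).D 0) * 1) ^ A i *
      (g ((orbiLine f.r₁ f.r₂).D 1) * 1) ^ B i) = f.map.coc g unitPoint (X.D i) * _ at h1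
    rw [f.map.coc_apply, hF] at h1
    change _ = _ * (c i * (1 ^ A i * 1 ^ B i)) at h1
    rw [one_pow, one_pow, mul_one, mul_one, mul_one, mul_one, mul_comm] at h1
    rw [AddChar.map_add_eq_mul, AddChar.map_nsmul_eq_pow, AddChar.map_nsmul_eq_pow]
    exact (mul_right_cancel₀ (mt (hc i).1 hi) h1).symm
  refine ⟨A j, B j', Nat.pos_of_ne_zero ((hAj j hjτ).2 rfl),
    Nat.pos_of_ne_zero ((hBj j' hj'τ).2 rfl), ?_, ?_, ?_, ?_⟩
  -- The homomorphism property at `1 · 1 = 1` reads `cᵢ = g(Dᵢ) cᵢ²`, so `g⁻¹` carries the monomials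
  -- with coefficient `1` to the given coordinates.
  · obtain ⟨g, hg⟩ := hhom unitPoint unitPoint unitPoint (fun _ => one_ne_zero)
      (fun _ => one_ne_zero) (mul_one _).symm
    have hgc : ∀ i ∉ τ, g⁻¹ (X.D i) = c i := by
      intro i hi
      have h1 := congrFun hg i
      change (f.map.toFun unitPoint).1 i = g (X.D i) *
        ((f.map.toFun unitPoint).1 i * (f.map.toFun unitPoint).1 i) at h1
      have h2 : (f.map.toFun unitPoint).1 i = c i := by
        rw [hF]
        change c i * (1 ^ A i * 1 ^ B i) = c i
        simp
      have hci : c i ≠ 0 := mt (hc i).1 hi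
      rw [h2, ← mul_assoc, right_eq_mul₀ hci] at h1
      rw [AddChar.inv_apply']
      exact (eq_inv_of_mul_eq_one_right h1).symm
    refine ⟨g⁻¹, fun x => funext fun i => ?_⟩
    rw [hF]
    change _ = g⁻¹ (X.D i) * monomialMap σ σ' j j' (A j) (B j') x.1 i
    rw [monomialMap, ← hτ']
    split_ifs with h1 h2 h3 h3
    · simp [(hc i).2 h1]
    · exact absurd (h2.symm.trans h3) hjj'
    · subst h2
      have := mt (hBj i h1).1 h3
      push Not at this
      rw [hgc i h1, this]
      simp
    · subst h3
      have := mt (hAj i h1).1 h2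
      push Not at this
      rw [hgc i h1, this]
      simp
    · have hBi := mt (hBj i h1).1 h3
      have hAi := mt (hAj i h1).1 h2
      push Not at hBi hAi
      rw [hgc i h1, hAi, hBi]
      simp
  · have := mt (hBj j hjτ).1 hjj'
    push Not at this
    rw [hpic j hjτ, this, zero_smul, add_zero]
  · have := mt (hAj j' hj'τ).1 hjj'.symm
    push Not at this
    rw [hpic j' hj'τ, this, zero_smul, zero_add]
  · intro i hi hi'
    have hiτ : i ∉ τ := fun h => hi ((hτi i).1 h).1
    have h1 := mt (hA i).2 hi
    have h2 := mt (hB i).2 hi'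
    push Not at h1 h2
    rw [hpic i hiτ, h1.2, h2.2, zero_smul, zero_smul, add_zero]

lemma nsmul_D_zero_injective (r₁ r₂ : ℕ+) {a a' : ℕ}
    (h : a • (orbiLine r₁ r₂).D 0 = a' • (orbiLine r₁ r₂).D 0) : a = a' := by
  have := congrArg (deg r₁ r₂) h
  rw [map_nsmul, map_nsmul, deg_D_zero, nsmul_eq_mul, nsmul_eq_mul] at this
  exact_mod_cast mul_right_cancel₀ (one_div_ne_zero (ratCast_ne_zero r₁)) this

lemma nsmul_D_one_injective (r₁ r₂ : ℕ+) {b b' : ℕ}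
    (h : b • (orbiLine r₁ r₂).D 1 = b' • (orbiLine r₁ r₂).D 1) : b = b' := by
  have := congrArg (deg r₁ r₂) h
  rw [map_nsmul, map_nsmul, deg_D_one, nsmul_eq_mul, nsmul_eq_mul] at this
  exact_mod_cast mul_right_cancel₀ (one_div_ne_zero (ratCast_ne_zero r₂)) this

/-- A toric morphism is determined by its source and by the pullback of line bundles. -/
lemma ToricCurve.iso_of_pic_eq [AddGroup.FG N] (H : X.AdjacentAlong σ σ' j j') {r₁ r₂ : ℕ+}
    {m m' : StackMor r₁ r₂ X} (a b c d a' b' c' d') (h : m.pic = m'.pic) :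
    ToricCurve.Iso (⟨r₁, r₂, m, a, b, c, d⟩ : ToricCurve X σ σ')
      ⟨r₁, r₂, m', a', b', c', d'⟩ := by
  refine ToricCurve.Iso.mk _ _ _ _ _ _ _ _ _ _ ?_
  obtain ⟨A, B, -, -, ⟨g, hg⟩, hj, hj', -⟩ :=
    (⟨r₁, r₂, m, a, b, c, d⟩ : ToricCurve X σ σ').normal_form H
  obtain ⟨A', B', -, -, ⟨g', hg'⟩, hk, hk', -⟩ :=
    (⟨r₁, r₂, m', a', b', c', d'⟩ : ToricCurve X σ σ').normal_form H
  dsimp only at hg hg' hj hj' hk hk'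
  obtain rfl := nsmul_D_zero_injective r₁ r₂ (hj.symm.trans ((DFunLike.congr_fun h _).trans hk))
  obtain rfl := nsmul_D_one_injective r₁ r₂ (hj'.symm.trans ((DFunLike.congr_fun h _).trans hk'))
  -- The exponents now agree, so both maps are translates of the same monomial map by constants `g`
  -- and `g'`.
  refine ⟨fun _ => g' * g⁻¹, fun χ => ⟨MvPolynomial.C ((g' * g⁻¹) χ), fun x => by simp⟩,
    fun x => Subtype.ext ?_, fun k x => ?_⟩
  · change _ = X.act (g' * g⁻¹) (m.toFun x).1
    rw [hg, hg']
    funext i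
    simp only [StackyFan.act, ← mul_assoc, ← AddChar.mul_apply, inv_mul_cancel_right]
  · rw [mul_comm]
    congr 1
    ext χ
    rw [m.coc_apply, m'.coc_apply, h]

/-- The toric morphism with given pullback of line bundles. -/
lemma exists_stackMor_of_pic (H : X.AdjacentAlong σ σ' j j') {r₁ r₂ : ℕ+}
    (Φ : X.LDual →+ (orbiLine r₁ r₂).LDual) {a b : ℕ} (ha : 0 < a) (hb : 0 < b)
    (hj : Φ (X.D j) = a • (orbiLine r₁ r₂).D 0) (hj' : Φ (X.D j') = b • (orbiLine r₁ r₂).D 1)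
    (h0 : ∀ i, i ∉ σ → i ∉ σ' → Φ (X.D i) = 0) :
    ∃ m : StackMor r₁ r₂ X, m.pic = Φ ∧ m.Toric ∧ m.MapsZero σ ∧ m.MapsInfty σ' := by
  obtain ⟨hσ, hσ', hcσ, hcσ', hcτ⟩ := H.adjacent
  have hjj' : j ≠ j' := fun h => ((H.left j).2 rfl).2 (h ▸ ((H.right j').2 rfl).1)
  have hcases : ∀ i, i ∉ σ ∩ σ' → i ≠ j → i ≠ j' → i ∉ σ ∧ i ∉ σ' := by
    intro i hi h1 h2
    have h3 := H.left i
    have h4 := H.right i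
    rw [Finset.mem_inter] at hi
    tauto
  let M := monomialMap σ σ' j j' a b
  -- The vanishing coordinates lie in `σ` if `x₀ = 0`, and in `σ'` if `x₀ ≠ 0`.
  have hM : ∀ x : (orbiLine r₁ r₂).U, M x.1 ∈ X.U := by
    intro x
    by_cases hx : x.1 0 = 0
    · have hx1 : x.1 1 ≠ 0 := fun hx1 => point_ne_zero x (by
        funext i
        fin_cases i
        exacts [hx, hx1])
      refine mem_U_of_zeroSet hσ fun i hi => ?_
      by_contra hiσ
      have h1 : i ≠ j := fun h => hiσ ((H.left i).2 h).1
      simp only [M, monomialMap, Finset.mem_inter, hiσ, false_and, if_false, h1, one_mul] at hi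
      split_ifs at hi
      · exact pow_ne_zero _ hx1 hi
      · exact one_ne_zero hi
    · refine mem_U_of_zeroSet hσ' fun i hi => ?_
      by_contra hiσ
      have h1 : i ≠ j' := fun h => hiσ ((H.right i).2 h).1
      simp only [M, monomialMap, Finset.mem_inter, hiσ, and_false, if_false, h1, mul_one] at hi
      split_ifs at hi
      · exact pow_ne_zero _ hx hi
      · exact one_ne_zero hi
  let m : StackMor r₁ r₂ X :=
    { toFun := fun x => ⟨M x.1, hM x⟩
      coc := fun g _ => g.compAddMonoidHom Φ
      regular_toFun := fun i => ⟨if i ∈ σ ∩ σ' then 0 else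
        (if i = j then MvPolynomial.X 0 ^ a else 1) *
          (if i = j' then MvPolynomial.X 1 ^ b else 1), fun x => by
          simp only [M, monomialMap]
          split_ifs <;> simp⟩
      regular_coc := fun χ => ⟨Finsupp.single (Φ χ) 1, fun g x => by simp⟩
      map_act := fun g x => Subtype.ext (funext fun i => by
        change M (fun k => g ((orbiLine r₁ r₂).D k) * x.1 k) i = g (Φ (X.D i)) * M x.1 i
        simp only [M, monomialMap]
        by_cases h1 : i ∈ σ ∩ σ'
        · simp [h1]
        · by_cases h2 : i = j
          · subst h2
            simp [h1, hjj', hj, mul_pow, AddChar.map_nsmul_eq_pow]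
          · by_cases h3 : i = j'
            · subst h3
              simp [h1, h2, hj', mul_pow, AddChar.map_nsmul_eq_pow]
            · simp [h1, h2, h3, h0 i (hcases i h1 h2 h3).1 (hcases i h1 h2 h3).2])
      map_mul := fun g h x => rfl }
  refine ⟨m, m.pic_eq_of_coc fun g x χ => rfl, ⟨σ ∩ σ', X.face_mem σ hσ _ Finset.inter_subset_left,
    hcτ, fun x hx i => ?_, fun s t st hs ht hst => ⟨1, ?_⟩⟩, fun x hx i hi => ?_,
    fun x hx i hi => ?_⟩
  · change M x.1 i = 0 ↔ _
    by_cases h1 : i ∈ σ ∩ σ'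
    · simp only [M, monomialMap, h1, if_true]
    · simp only [M, monomialMap, h1, if_false, iff_false]
      refine mul_ne_zero ?_ ?_ <;> split_ifs
      exacts [pow_ne_zero _ (hx 0), one_ne_zero, pow_ne_zero _ (hx 1), one_ne_zero]
  · change M st.1 = X.act 1 (M s.1 * M t.1)
    funext i
    simp only [StackyFan.act, AddChar.one_apply, one_mul, Pi.mul_apply, M, monomialMap, hst]
    split_ifs <;> ring
  · change M x.1 i = 0
    simp only [M, monomialMap]
    by_cases h1 : i ∈ σ ∩ σ'
    · rw [if_pos h1]
    · have h2 : i = j := (H.left i).1 ⟨hi, fun h => h1 (Finset.mem_inter.2 ⟨hi, h⟩)⟩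
      rw [if_neg h1, if_pos h2, hx, zero_pow ha.ne', zero_mul]
  · change M x.1 i = 0
    simp only [M, monomialMap]
    by_cases h1 : i ∈ σ ∩ σ'
    · rw [if_pos h1]
    · have h2 : i = j' := (H.right i).1 ⟨hi, fun h => h1 (Finset.mem_inter.2 ⟨h, hi⟩)⟩
      rw [if_neg h1, if_pos h2, hx, zero_pow hb.ne', mul_zero]

end

/-! ### Classification by the box element at `0` and one degree -/

section

open StackyFan orbiLine

variable {N : Type*} [AddCommGroup N] {n : ℕ} {X : StackyFan N n} {σ σ' : Finset (Fin n)}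
  {j j' : Fin n}

namespace StackyFan

/-- The logarithm of the element of `G` that corresponds to a box element. -/
def Box.log (b : X.Box σ) : X.LDual →+ AddCircle (1 : ℝ) :=
  X.expLog (Box.coord b) b (Box.coord_spec b).2.2

lemma Box.elt_eq (b : X.Box σ) : Box.elt b = circleChar (Box.log b) := rfl

lemma Box.log_D (b : X.Box σ) (i : Fin n) :
    Box.log b (X.D i) = ((Box.coord b i : ℝ) : AddCircle (1 : ℝ)) := expLog_D _ _ _ _ _

lemma Box.exists_rat_coord (hσ : σ ∈ X.cones) (b : X.Box σ) :
    ∃ q : Fin n → ℚ, ∀ i, Box.coord b i = q i :=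
  rational_of_linearIndependent (X.simplicial σ hσ) (Box.coord_spec b).2.1 (c := 1) (b := b) (by
    rw [Rat.cast_one, one_smul, (Box.coord_spec b).2.2])

lemma expLog_congr {a a' : Fin n → ℝ} {b b' : N} (ha : a = a') (hb : b = b') (h h') :
    X.expLog a b h = X.expLog a' b' h' := by
  subst ha hb
  rfl

/-- The relation between the rays of two adjacent cones. -/
lemma AdjacentAlong.exists_relation [AddGroup.FG N] (H : X.AdjacentAlong σ σ' j j') {c : ℚ}
    (hc : 0 < c) : ∃ d : Fin n → ℚ, ∑ i, (d i : ℝ) • toReal (X.ρ i) = 0 ∧ d j = c ∧ 0 < d j' ∧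
      ∀ i, i ∉ σ → i ∉ σ' → d i = 0 := by
  obtain ⟨hσ, hσ', hcσ, hcσ', hcτ⟩ := H.adjacent
  have hfin : Module.Finite ℤ N := Module.Finite.iff_addGroup_fg.2 inferInstance
  have hjσ := (H.left j).2 rfl
  have hj'σ := (H.right j').2 rfl
  have hspan := (X.simplicial σ' hσ').span_eq_top_of_card_eq_finrank'
    (by rw [Fintype.card_coe]; exact hcσ')
  -- The rays of `σ'` form a basis, so `-c ρ̄ⱼ` expands in them, with rational coefficients; moving
  -- it to the other side gives the relation.
  have hmem : ((-c : ℚ) : ℝ) • toReal (X.ρ j) ∈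
      Submodule.span ℝ (Set.range fun i : σ' => toReal (X.ρ i)) := by
    rw [hspan]
    trivial
  obtain ⟨e, he⟩ := (Submodule.mem_span_range_iff_exists_fun ℝ).1 hmem
  let a : Fin n → ℝ := fun i => if h : i ∈ σ' then e ⟨i, h⟩ else 0
  have ha0 : ∀ i ∉ σ', a i = 0 := fun i hi => by simp [a, hi]
  have ha : ∑ i, a i • toReal (X.ρ i) = ((-c : ℚ) : ℝ) • toReal (X.ρ j) := by
    rw [← he, ← Finset.sum_subset (Finset.subset_univ σ') fun i _ hi => by simp [ha0 i hi],
      ← Finset.sum_coe_sort]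
    exact Finset.sum_congr rfl fun i _ => by simp [a]
  obtain ⟨q, hq⟩ := rational_of_linearIndependent (X.simplicial σ' hσ') ha0 ha
  let d : Fin n → ℚ := fun i => q i + if i = j then c else 0
  have hqz : ∀ i ∉ σ', q i = 0 := fun i hi => by
    have := ha0 i hi
    rw [hq] at this
    exact_mod_cast this
  have hdj : d j = c := by simp [d, hqz j hjσ.2]
  have hd : ∑ i, (d i : ℝ) • toReal (X.ρ i) = 0 := by
    have e1 : ∀ i, (d i : ℝ) • toReal (X.ρ i) =
        a i • toReal (X.ρ i) + if i = j then (c : ℝ) • toReal (X.ρ j) else 0 := by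
      intro i
      by_cases h : i = j
      · subst h
        simp [d, hq, add_smul]
      · simp [d, h, hq]
    simp only [e1, Finset.sum_add_distrib, ha]
    simp
  have hd0 : ∀ i, i ∉ σ → i ∉ σ' → d i = 0 := fun i hi hi' => by
    have hij : i ≠ j := fun h => hi (h ▸ hjσ.1)
    simp [d, hqz i hi', hij]
  refine ⟨d, hd, hdj, ?_, hd0⟩
  -- If `d j' ≤ 0`, the positive part of the relation is supported on `σ` and the negative part on
  -- `σ'`. Their common value lies in the cone of `σ ∩ σ'`, so uniqueness of coordinates in `σ`
  -- makes the coefficient of `ρ̄ⱼ` zero, although it is at least `c > 0`.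
  by_contra hneg
  push Not at hneg
  let P : Fin n → ℝ := fun i => max (d i : ℝ) 0
  let M : Fin n → ℝ := fun i => max (-(d i : ℝ)) 0
  have hPM : ∀ i, P i - M i = d i := fun i => by
    simp only [P, M]
    rcases le_total (d i : ℝ) 0 with h | h
    · rw [max_eq_right h, max_eq_left (by linarith)]
      ring
    · rw [max_eq_left h, max_eq_right (by linarith)]
      ring
  have hsum : ∑ i, P i • toReal (X.ρ i) = ∑ i, M i • toReal (X.ρ i) := by
    rw [← sub_eq_zero, ← Finset.sum_sub_distrib, ← hd]
    exact Finset.sum_congr rfl fun i _ => by rw [← sub_smul, hPM]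
  have hP0 : ∀ i ∉ σ, P i = 0 := by
    intro i hi
    refine max_eq_right ?_
    by_cases hi' : i ∈ σ'
    · rw [(H.right i).1 ⟨hi', hi⟩]
      exact_mod_cast hneg
    · rw [hd0 i hi hi', Rat.cast_zero]
  have hM0 : ∀ i ∉ σ', M i = 0 := by
    intro i hi
    refine max_eq_right ?_
    by_cases hi' : i ∈ σ
    · rw [(H.left i).1 ⟨hi', hi⟩, hdj]
      exact neg_nonpos.2 (by exact_mod_cast hc.le)
    · rw [hd0 i hi' hi, Rat.cast_zero, neg_zero]
  have hcone : ∑ i, P i • toReal (X.ρ i) ∈ coneHull X.ρ σ ∩ coneHull X.ρ σ' :=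
    ⟨⟨P, fun i => le_max_right _ _, hP0, rfl⟩, ⟨M, fun i => le_max_right _ _, hM0, hsum⟩⟩
  rw [X.inter_face σ hσ σ' hσ'] at hcone
  obtain ⟨t, -, ht0, ht⟩ := hcone
  have hPt := coord_unique (X.simplicial σ hσ) hP0
    (fun i hi => ht0 i fun h => hi (Finset.mem_inter.1 h).1) ht
  have h1 : P j = 0 := by
    rw [hPt]
    exact ht0 j fun h => hjσ.2 (Finset.mem_inter.1 h).2
  have h2 : (c : ℝ) ≤ P j := by
    rw [← hdj]
    exact le_max_left _ _
  have h3 : (0 : ℝ) < c := by exact_mod_cast hc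
  linarith

/-- The coefficients at `j` cancel in the difference, which is then a relation between the
independent rays of `σ'`. -/
lemma AdjacentAlong.relation_unique (H : X.AdjacentAlong σ σ' j j') {d d' : Fin n → ℚ}
    (hd : ∑ i, (d i : ℝ) • toReal (X.ρ i) = 0) (hd' : ∑ i, (d' i : ℝ) • toReal (X.ρ i) = 0)
    (h0 : ∀ i, i ∉ σ → i ∉ σ' → d i = 0) (h0' : ∀ i, i ∉ σ → i ∉ σ' → d' i = 0)
    (hj : d j = d' j) : d = d' := by
  have key : (fun i => (d i : ℝ) - d' i) = 0 := by
    refine coord_unique (X.simplicial σ' H.adjacent.2.1) (fun i hi => ?_) (fun _ _ => rfl) ?_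
    · by_cases hi' : i ∈ σ
      · rw [(H.left i).1 ⟨hi', hi⟩, hj, sub_self]
      · rw [h0 i hi' hi, h0' i hi' hi, sub_self]
    · simp [sub_smul, hd, hd']
  funext i
  have := congrFun key i
  exact_mod_cast sub_eq_zero.1 this

end StackyFan

namespace ToricCurve

lemma givesZero_iff (f : ToricCurve X σ σ') (b : X.Box σ) :
    f.GivesZero b ↔ (logZero f.r₁ f.r₂).comp f.map.pic = Box.log b := by
  constructor
  · intro h
    have := h pointZero rfl
    rw [genZero_eq, StackMor.circleChar_comp_pic] at this
    exact circleChar_injective this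
  · intro h x _
    rw [genZero_eq, StackMor.circleChar_comp_pic, h, Box.elt_eq]

lemma givesInfty_iff (f : ToricCurve X σ σ') (b : X.Box σ') :
    f.GivesInfty b ↔ (logInfty f.r₁ f.r₂).comp f.map.pic = Box.log b := by
  constructor
  · intro h
    have := h pointInfty rfl
    rw [genInfty_eq, StackMor.circleChar_comp_pic] at this
    exact circleChar_injective this
  · intro h x _
    rw [genInfty_eq, StackMor.circleChar_comp_pic, h, Box.elt_eq]

/-- The degree of `f^* O(Dᵢ)`. -/
def degree (f : ToricCurve X σ σ') : X.LDual →+ ℚ := (deg f.r₁ f.r₂).comp f.map.pic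

lemma logInfty_comp_pic (f : ToricCurve X σ σ') :
    (logInfty f.r₁ f.r₂).comp f.map.pic =
      ratReduce.comp f.degree - (logZero f.r₁ f.r₂).comp f.map.pic := by
  ext χ
  refine eq_sub_of_add_eq' ?_
  exact (ratReduce_deg f.r₁ f.r₂ _).symm

lemma hasDegree_degree (f : ToricCurve X σ σ') (i : Fin n) :
    f.map.HasDegree i (f.degree (X.D i)) := (f.map.hasDegree_iff i _).2 rfl

lemma Iso.degree_eq {f f' : ToricCurve X σ σ'} (h : ToricCurve.Iso f f') :
    f.degree = f'.degree := by
  obtain ⟨m, m', _, _, _, _, _, _, _, _, h⟩ := h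
  simp only [degree, h.pic_eq]

lemma Iso.givesZero {f f' : ToricCurve X σ σ'} (h : ToricCurve.Iso f f') {b : X.Box σ}
    (hb : f.GivesZero b) : f'.GivesZero b := by
  rw [givesZero_iff] at hb ⊢
  obtain ⟨m, m', _, _, _, _, _, _, _, _, h⟩ := h
  simpa only [h.pic_eq] using hb

lemma degree_D_eq_zero [AddGroup.FG N] (H : X.AdjacentAlong σ σ' j j') (f : ToricCurve X σ σ')
    {i : Fin n} (hi : i ∉ σ) (hi' : i ∉ σ') : f.degree (X.D i) = 0 := by
  obtain ⟨a, b, -, -, -, -, -, h⟩ := f.normal_form H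
  rw [degree, AddMonoidHom.comp_apply, h i hi hi', map_zero]

lemma degree_pos [AddGroup.FG N] (H : X.AdjacentAlong σ σ' j j') (f : ToricCurve X σ σ') :
    0 < f.degree (X.D j) := by
  obtain ⟨a, b, ha, -, -, h, -, -⟩ := f.normal_form H
  rw [degree, AddMonoidHom.comp_apply, h, map_nsmul, deg_D_zero, nsmul_eq_mul]
  have h1 : (0 : ℚ) < a := by exact_mod_cast ha
  have h2 : (0 : ℚ) < (f.r₁ : ℚ) := by exact_mod_cast f.r₁.pos
  positivity

/-- `f^* Dⱼ` is a multiple of `D₀`, on which the isotropy group at `∞` acts trivially. -/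
lemma ratReduce_degree [AddGroup.FG N] (H : X.AdjacentAlong σ σ' j j') (f : ToricCurve X σ σ') :
    ratReduce (f.degree (X.D j)) = logZero f.r₁ f.r₂ (f.map.pic (X.D j)) := by
  obtain ⟨a, b, ha, -, -, h, -, -⟩ := f.normal_form H
  rw [degree, AddMonoidHom.comp_apply, ratReduce_deg, h, map_nsmul (logInfty _ _), logInfty_D_zero,
    smul_zero, add_zero]

lemma logZero_pic_D_eq_zero [AddGroup.FG N] (H : X.AdjacentAlong σ σ' j j')
    (f : ToricCurve X σ σ') {i : Fin n} (hi : i ∉ σ) :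
    logZero f.r₁ f.r₂ (f.map.pic (X.D i)) = 0 := by
  obtain ⟨a, b, -, -, -, -, h, h'⟩ := f.normal_form H
  by_cases hi' : i ∈ σ'
  · rw [(H.right i).1 ⟨hi', hi⟩, h, map_nsmul, logZero_D_one, smul_zero]
  · rw [h' i hi hi', map_zero]

lemma fract_eq_of_ratReduce_eq {c : ℚ} {t : ℝ} (h : ratReduce c = (t : AddCircle (1 : ℝ)))
    (h0 : 0 ≤ t) (h1 : t < 1) : ((Int.fract c : ℚ) : ℝ) = t := by
  rw [Rat.cast_fract, Int.fract_eq_iff]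
  exact ⟨h0, h1, realCircle_coe_eq_iff.1 h⟩

lemma ratReduce_eq_of_fract_eq {c : ℚ} {t : ℝ} (h : ((Int.fract c : ℚ) : ℝ) = t) :
    ratReduce c = (t : AddCircle (1 : ℝ)) := by
  rw [ratReduce_apply, realCircle_coe_eq_iff, ← h, Rat.cast_fract]
  exact ⟨⌊(c : ℝ)⌋, by rw [Int.self_sub_fract]⟩

lemma GivesZero.fract_degree [AddGroup.FG N] (H : X.AdjacentAlong σ σ' j j')
    {f : ToricCurve X σ σ'} {b : X.Box σ} (hb : f.GivesZero b) :
    ((Int.fract (f.degree (X.D j)) : ℚ) : ℝ) = Box.coord b j := by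
  refine fract_eq_of_ratReduce_eq ?_ ((Box.coord_spec b).1 j).1 ((Box.coord_spec b).1 j).2
  rw [f.ratReduce_degree H, ← Box.log_D, ← (f.givesZero_iff b).1 hb]
  rfl

/-- A toric morphism is determined by the box element at `0` and by one degree. -/
lemma iso_of_degree_eq [AddGroup.FG N] (H : X.AdjacentAlong σ σ' j j') {f f' : ToricCurve X σ σ'}
    {b : X.Box σ} (hb : f.GivesZero b) (hb' : f'.GivesZero b)
    (hd : f.degree (X.D j) = f'.degree (X.D j)) : ToricCurve.Iso f f' := by
  have hdeg : f.degree = f'.degree := ratHom_ext fun i => congrFun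
    (H.relation_unique (d := fun i => f.degree (X.D i)) (d' := fun i => f'.degree (X.D i))
      (ratHom_relation _) (ratHom_relation _) (fun i hi hi' => f.degree_D_eq_zero H hi hi')
      (fun i hi hi' => f'.degree_D_eq_zero H hi hi') hd) i
  rw [givesZero_iff] at hb hb'
  have hlog := f.logInfty_comp_pic
  have hlog' := f'.logInfty_comp_pic
  rw [hb, hdeg] at hlog
  rw [hb'] at hlog'
  obtain ⟨h1, h2⟩ := f.map.representable_iff.1 f.representable
  obtain ⟨h1', h2'⟩ := f'.map.representable_iff.1 f'.representable
  -- The isotropy homomorphisms at `0` and `∞` agree for both morphisms; by representability their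
  -- orders are `r₁` and `r₂`.
  have e1 : f.r₁ = f'.r₁ := PNat.eq (by rw [← h1, ← h1', hb, hb'])
  have e2 : f.r₂ = f'.r₂ := PNat.eq (by rw [← h2, ← h2', hlog, hlog'])
  obtain ⟨r₁, r₂, m, _, _, _, _⟩ := f
  obtain ⟨r₁', r₂', m', _, _, _, _⟩ := f'
  dsimp only at e1 e2 hb hb'
  subst e1 e2
  refine iso_of_pic_eq H _ _ _ _ _ _ _ _ ?_
  ext χ
  exact eq_of_deg_of_logZero r₁ r₂ (DFunLike.congr_fun hdeg χ)
    ((DFunLike.congr_fun hb χ).trans (DFunLike.congr_fun hb' χ).symm)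

/-- The pair `(δ, γ)`, with `δ` the relation normalized by `c` and `γ` the logarithm of `b`, defines
a pullback homomorphism. The congruence `c ≡ bⱼ` and the vanishing of `b` outside `σ` make it take
`Dⱼ` to a multiple of `D₀` and `Dⱼ'` to a multiple of `D₁`; these multiples are positive because `c`
and `d j'` are. -/
lemma exists_of_degree [AddGroup.FG N] (H : X.AdjacentAlong σ σ' j j') (b : X.Box σ) {c : ℚ}
    (hc : 0 < c) (hfr : ((Int.fract c : ℚ) : ℝ) = Box.coord b j) :
    ∃ f : ToricCurve X σ σ', f.GivesZero b ∧ f.degree (X.D j) = c := by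
  obtain ⟨d, hd, hdj, hdj', hd0⟩ := H.exists_relation hc
  obtain ⟨q, hq⟩ := Box.exists_rat_coord H.adjacent.1 b
  have hcoord : Box.coord b = fun i => (q i : ℝ) := funext hq
  have hq' : ∑ i, (q i : ℝ) • toReal (X.ρ i) = toReal (b : N) := by
    rw [← (Box.coord_spec b).2.2, hcoord]
  have hlog : Box.log b = X.expLog (fun i => q i) b hq' := expLog_congr hcoord rfl _ _
  let δ := X.degLift d hd
  have hδ : ratReduce.comp δ - Box.log b =
      X.expLog (fun i => ((d i - q i : ℚ) : ℝ)) (0 - b) (by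
        simp only [Rat.cast_sub, sub_smul, Finset.sum_sub_distrib, hd, hq', toReal_sub,
          toReal_zero]) := by
    have e1 : ratReduce.comp δ = X.expLog (fun i => d i) 0 (hd.trans toReal_zero.symm) :=
      AddMonoidHom.ext fun x => X.coe_degLift d hd x
    rw [e1, hlog, ← X.expLog_sub _ _ _ _ _ _ (by
      simp only [Pi.sub_apply, sub_smul, Finset.sum_sub_distrib, hd, hq', toReal_sub,
        toReal_zero])]
    exact expLog_congr (funext fun i => by simp) rfl _ _
  have hpos1 : 0 < addOrderOf (Box.log b) := by
    obtain ⟨m, hm, h⟩ := X.exists_nsmul_expLog_eq_zero q b hq'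
    rw [← hlog] at h
    exact addOrderOf_pos_iff.2 (isOfFinAddOrder_iff_nsmul_eq_zero.2 ⟨m, hm, h⟩)
  have hpos2 : 0 < addOrderOf (ratReduce.comp δ - Box.log b) := by
    obtain ⟨m, hm, h⟩ := X.exists_nsmul_expLog_eq_zero (fun i => d i - q i) (0 - b) _
    rw [hδ]
    exact addOrderOf_pos_iff.2 (isOfFinAddOrder_iff_nsmul_eq_zero.2 ⟨m, hm, h⟩)
  -- The orders of the two isotropy homomorphisms: the only choice that makes the morphism
  -- representable.
  let r₁ : ℕ+ := ⟨_, hpos1⟩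
  let r₂ : ℕ+ := ⟨_, hpos2⟩
  have hr₁ : addOrderOf (Box.log b) = (r₁ : ℕ) := rfl
  have hr₂ : addOrderOf (ratReduce.comp δ - Box.log b) = (r₂ : ℕ) := rfl
  have h1 : (r₁ : ℕ) • Box.log b = 0 := by rw [← hr₁, addOrderOf_nsmul_eq_zero]
  have h2 : (r₂ : ℕ) • (ratReduce.comp δ - Box.log b) = 0 := by
    rw [← hr₂, addOrderOf_nsmul_eq_zero]
  clear_value r₁ r₂
  obtain ⟨Φ, hΦ, hΦ'⟩ := orbiLine.exists_hom r₁ r₂ δ (Box.log b) h1 h2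
  have hint : ∀ (r : ℕ+) (x : ℚ), 0 < x → (r : ℕ) • ratReduce x = 0 →
      ∃ k : ℕ, 0 < k ∧ x = k * (1 / (r : ℚ)) := by
    intro r x hx h
    rw [ratReduce_apply, ← AddCircle.coe_nsmul, realCircle_coe_eq_zero_iff, nsmul_eq_mul] at h
    obtain ⟨k, hk⟩ := h
    have hk' : (r : ℚ) * x = k := by exact_mod_cast hk
    have hr : (0 : ℚ) < (r : ℚ) := by exact_mod_cast r.pos
    have hk0 : 0 < k := by
      have : (0 : ℚ) < k := by
        rw [← hk']
        positivity
      exact_mod_cast this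
    refine ⟨k.toNat, by omega, ?_⟩
    have : ((k.toNat : ℕ) : ℚ) = k := by exact_mod_cast Int.toNat_of_nonneg hk0.le
    rw [this, ← hk']
    field_simp
  have hδD : ∀ i, deg r₁ r₂ (Φ (X.D i)) = d i := fun i =>
    (DFunLike.congr_fun hΦ _).trans (X.degLift_D d hd i)
  have hlD : ∀ i, logZero r₁ r₂ (Φ (X.D i)) = ((Box.coord b i : ℝ) : AddCircle (1 : ℝ)) :=
    fun i => (DFunLike.congr_fun hΦ' _).trans (Box.log_D b i)
  have hcj := ratReduce_eq_of_fract_eq hfr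
  have hbσ : ∀ i ∉ σ, ((Box.coord b i : ℝ) : AddCircle (1 : ℝ)) = 0 := fun i hi => by
    rw [(Box.coord_spec b).2.1 i hi, AddCircle.coe_zero]
  have hj'σ := ((H.right j').2 rfl).2
  obtain ⟨k, hk0, hk⟩ := hint r₁ c hc (by
    rw [hcj, ← Box.log_D, ← AddMonoidHom.nsmul_apply, h1, AddMonoidHom.zero_apply])
  obtain ⟨l, hl0, hl⟩ := hint r₂ (d j') hdj' (by
    have := DFunLike.congr_fun h2 (X.D j')
    rw [AddMonoidHom.nsmul_apply, AddMonoidHom.sub_apply, Box.log_D, hbσ j' hj'σ, sub_zero,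
      AddMonoidHom.comp_apply, X.degLift_D, AddMonoidHom.zero_apply] at this
    exact this)
  obtain ⟨m, hm, hm1, hm2, hm3⟩ := exists_stackMor_of_pic H Φ hk0 hl0
    (eq_of_deg_of_logZero r₁ r₂
      (by rw [hδD, hdj, map_nsmul, deg_D_zero, nsmul_eq_mul, hk])
      (by
        rw [hlD, ← hcj, map_nsmul, logZero_D_zero, ratReduce_apply, ← AddCircle.coe_nsmul, hk,
          nsmul_eq_mul]
        push_cast
        rfl))
    (eq_of_deg_of_logZero r₁ r₂
      (by rw [hδD, map_nsmul, deg_D_one, nsmul_eq_mul, hl])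
      (by rw [hlD, hbσ j' hj'σ, map_nsmul, logZero_D_one, smul_zero]))
    (fun i hi hi' => eq_of_deg_of_logZero r₁ r₂ (by rw [hδD, hd0 i hi hi', map_zero])
      (by rw [hlD, hbσ i hi, map_zero]))
  have hinf : (logInfty r₁ r₂).comp Φ = ratReduce.comp δ - Box.log b := by
    rw [← hΦ, ← hΦ']
    ext χ
    exact eq_sub_of_add_eq' (ratReduce_deg r₁ r₂ _).symm
  refine ⟨⟨r₁, r₂, m, m.representable_iff.2 ?_, hm1, hm2, hm3⟩, ?_, ?_⟩
  · rw [hm, hΦ', hinf]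
    exact ⟨hr₁, hr₂⟩
  · rw [givesZero_iff]
    change (logZero r₁ r₂).comp m.pic = _
    rw [hm, hΦ']
  · change deg r₁ r₂ (m.pic (X.D j)) = c
    rw [hm, hδD, hdj]

/-- Toric morphisms with a given box element at `0` are classified by the degree of `Dⱼ`. -/
lemma exists_classesAt_equiv [AddGroup.FG N] (H : X.AdjacentAlong σ σ' j j') (b : X.Box σ) :
    ∃ E : ClassesAt X σ σ' b ≃ {c : ℚ // 0 < c ∧ ((Int.fract c : ℚ) : ℝ) = Box.coord b j},
      ∀ f : {f : ToricCurve X σ σ' // f.GivesZero b},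
        f.1.map.HasDegree j (E (Quotient.mk ((setoid X σ σ').comap Subtype.val) f) : ℚ) := by
  let F : ClassesAt X σ σ' b → {c : ℚ // 0 < c ∧ ((Int.fract c : ℚ) : ℝ) = Box.coord b j} :=
    Quotient.lift (fun f => ⟨f.1.degree (X.D j), f.1.degree_pos H, f.2.fract_degree H⟩)
      fun f f' h => Subtype.ext (DFunLike.congr_fun (Iso.degree_eq h) _)
  refine ⟨Equiv.ofBijective F ⟨?_, ?_⟩, fun f => f.1.hasDegree_degree j⟩
  · rintro ⟨f⟩ ⟨f'⟩ h
    exact Quotient.sound (iso_of_degree_eq H f.2 f'.2 (congrArg Subtype.val h))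
  · rintro ⟨c, hc, hfr⟩
    obtain ⟨f, hf, hfc⟩ := exists_of_degree H b hc hfr
    exact ⟨Quotient.mk _ ⟨f, hf⟩, Subtype.ext hfc⟩

end ToricCurve

end

/-! ### Duality for `N`, and box elements as elements of finite order -/

section

open StackyFan orbiLine

section Bidual

/-- Every homomorphism `Hom(A, ℚ/ℤ) → ℝ/ℤ` that is linear on the images of the lines `ℚ v`,
`v ∈ Hom(A, ℤ)`, is the evaluation at an element of `A`. -/
def EvaluationProperty (A : Type*) [AddCommGroup A] : Prop :=
  ∀ Λ : (A →+ AddCircle (1 : ℚ)) →+ AddCircle (1 : ℝ),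
    (∀ v : A →+ ℤ, ∃ y : ℝ, ∀ q : ℚ,
      Λ ((zmultiplesHom _ (q : AddCircle (1 : ℚ))).comp v) = ((q * y : ℝ) : AddCircle (1 : ℝ))) →
    ∃ b : A, ∀ χ, Λ χ = ratToRealCircle (χ b)

/-- Characters of `ℤ` form the single line of all `q` modulo `ℤ`. Periodicity at `q = 1` forces the
slope `y` to be an integer, and that integer is the required element. -/
lemma evaluationProperty_int : EvaluationProperty ℤ := by
  intro Λ h
  obtain ⟨y, hy⟩ := h (AddMonoidHom.id ℤ)
  have hz : (zmultiplesHom (AddCircle (1 : ℚ)) ((1 : ℚ) : AddCircle (1 : ℚ))).comp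
      (AddMonoidHom.id ℤ) = 0 :=
    AddMonoidHom.ext_int (by simp [AddCircle.coe_period])
  have h1 : Λ 0 = _ := (congrArg Λ hz).symm.trans (hy 1)
  rw [map_zero, Rat.cast_one, one_mul, eq_comm, realCircle_coe_eq_zero_iff] at h1
  obtain ⟨k, rfl⟩ := h1
  refine ⟨k, fun χ => ?_⟩
  obtain ⟨q, hq⟩ := exists_coe_eq_ratCircle (χ 1)
  have hχ : χ = (zmultiplesHom _ (q : AddCircle (1 : ℚ))).comp (AddMonoidHom.id ℤ) :=
    AddMonoidHom.ext_int (by simp [hq])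
  conv_lhs => rw [hχ, hy]
  have e : χ k = ((k * q : ℚ) : AddCircle (1 : ℚ)) := by
    rw [← zsmul_eq_mul, AddCircle.coe_zsmul, hq, ← map_zsmul, smul_eq_mul, mul_one]
  rw [e, ratToRealCircle_coe]
  push_cast
  rw [mul_comm]

/-- The characters are the multiples of `χ₀ : 1 ↦ 1/m`; as `m χ₀ = 0`, the value of `Λ` there is
some `s/m`, and `s` is the required element. -/
lemma evaluationProperty_zmod (m : ℕ) [NeZero m] : EvaluationProperty (ZMod m) := by
  intro Λ _
  have hm : (m : ℚ) ≠ 0 := by exact_mod_cast NeZero.ne m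
  have hm' : (m : ℝ) ≠ 0 := by exact_mod_cast NeZero.ne m
  have hper :
      zmultiplesHom (AddCircle (1 : ℚ)) ((1 / m : ℚ) : AddCircle (1 : ℚ)) (m : ℤ) = 0 := by
    rw [zmultiplesHom_apply, ← AddCircle.coe_zsmul, ratCircle_coe_eq_zero_iff]
    exact ⟨1, by simp [hm]⟩
  let χ₀ : ZMod m →+ AddCircle (1 : ℚ) := ZMod.lift m ⟨_, hper⟩
  have hgen : ∀ (χ : ZMod m →+ AddCircle (1 : ℚ)) (k : ℤ), χ (k : ZMod m) = k • χ 1 := fun χ k => by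
    rw [← map_zsmul, zsmul_one]
  have hext : ∀ χ χ' : ZMod m →+ AddCircle (1 : ℚ), χ 1 = χ' 1 → χ = χ' := fun χ χ' h => by
    ext x
    obtain ⟨k, rfl⟩ := ZMod.intCast_surjective x
    rw [hgen, hgen, h]
  have hone : ∀ χ : ZMod m →+ AddCircle (1 : ℚ), m • χ = 0 := fun χ => hext _ _ (by
    rw [AddMonoidHom.nsmul_apply, ← map_nsmul, nsmul_one, ZMod.natCast_self, map_zero,
      AddMonoidHom.zero_apply])
  have hχ₀ : χ₀ 1 = ((1 / m : ℚ) : AddCircle (1 : ℚ)) := by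
    have := ZMod.lift_coe m ⟨_, hper⟩ 1
    rw [Int.cast_one] at this
    exact this.trans (one_zsmul _)
  obtain ⟨t, ht⟩ := QuotientAddGroup.mk_surjective (Λ χ₀)
  change (t : AddCircle (1 : ℝ)) = Λ χ₀ at ht
  obtain ⟨s, hs⟩ : ∃ s : ℤ, (m : ℝ) * t = s := by
    rw [← realCircle_coe_eq_zero_iff, ← nsmul_eq_mul, AddCircle.coe_nsmul, ht, ← map_nsmul, hone,
      map_zero]
  refine ⟨(s : ZMod m), fun χ => ?_⟩
  obtain ⟨q, hq⟩ := exists_coe_eq_ratCircle (χ 1)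
  obtain ⟨c, hc⟩ : ∃ c : ℤ, (m : ℚ) * q = c := by
    rw [← ratCircle_coe_eq_zero_iff, ← nsmul_eq_mul, AddCircle.coe_nsmul, hq,
      ← AddMonoidHom.nsmul_apply, hone, AddMonoidHom.zero_apply]
  have hqc : q = c * (1 / m : ℚ) := by
    rw [← hc]
    field_simp
  have hχ : χ = c • χ₀ := hext _ _ (by
    rw [← hq, AddMonoidHom.zsmul_apply, hχ₀, ← AddCircle.coe_zsmul, zsmul_eq_mul, hqc])
  rw [hgen, ← hq, ← AddCircle.coe_zsmul, ratToRealCircle_coe, hχ, map_zsmul, ← ht,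
    ← AddCircle.coe_zsmul]
  congr 1
  have hqc' : (q : ℝ) = c * (1 / m) := by
    rw [hqc]
    push_cast
    rfl
  rw [zsmul_eq_mul, zsmul_eq_mul, Rat.cast_mul, Rat.cast_intCast, ← hs, hqc']
  field_simp

lemma evaluationProperty_pi {ι : Type*} [Fintype ι] {C : ι → Type*} [∀ i, AddCommGroup (C i)]
    (h : ∀ i, EvaluationProperty (C i)) : EvaluationProperty (∀ i, C i) := by
  classical
  intro Λ hΛ
  choose b hb using fun i => h i
    (Λ.comp (AddMonoidHom.compHom.flip (Pi.evalAddMonoidHom C i))) fun v => by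
      obtain ⟨y, hy⟩ := hΛ (v.comp (Pi.evalAddMonoidHom C i))
      exact ⟨y, fun q => hy q⟩
  refine ⟨b, fun χ => ?_⟩
  have hχ : χ = ∑ i, (χ.comp (AddMonoidHom.single C i)).comp (Pi.evalAddMonoidHom C i) := by
    refine AddMonoidHom.ext fun x => ?_
    rw [AddMonoidHom.finsetSum_apply]
    simp only [AddMonoidHom.comp_apply, Pi.evalAddMonoidHom_apply, AddMonoidHom.single_apply]
    rw [← map_sum, Finset.univ_sum_single]
  have e : χ b = ∑ i, χ (Pi.single i (b i)) := by rw [← map_sum, Finset.univ_sum_single]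
  conv_lhs => rw [hχ, map_sum]
  rw [e, map_sum]
  exact Finset.sum_congr rfl fun i _ => hb i (χ.comp (AddMonoidHom.single C i))

lemma evaluationProperty_prod {A B : Type*} [AddCommGroup A] [AddCommGroup B]
    (hA : EvaluationProperty A) (hB : EvaluationProperty B) : EvaluationProperty (A × B) := by
  intro Λ hΛ
  obtain ⟨a, ha⟩ := hA (Λ.comp (AddMonoidHom.compHom.flip (AddMonoidHom.fst A B))) fun v => by
    obtain ⟨y, hy⟩ := hΛ (v.comp (AddMonoidHom.fst A B))
    exact ⟨y, fun q => hy q⟩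
  obtain ⟨b, hb⟩ := hB (Λ.comp (AddMonoidHom.compHom.flip (AddMonoidHom.snd A B))) fun v => by
    obtain ⟨y, hy⟩ := hΛ (v.comp (AddMonoidHom.snd A B))
    exact ⟨y, fun q => hy q⟩
  refine ⟨(a, b), fun χ => ?_⟩
  have e : ∀ x y, χ (x, y) = χ (x, 0) + χ (0, y) := fun x y => by
    rw [← map_add, Prod.mk_add_mk, add_zero, zero_add]
  have hχ : χ = (χ.comp (AddMonoidHom.inl A B)).comp (AddMonoidHom.fst A B) +
      (χ.comp (AddMonoidHom.inr A B)).comp (AddMonoidHom.snd A B) :=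
    AddMonoidHom.ext fun x => e x.1 x.2
  conv_lhs => rw [hχ, map_add]
  rw [e, map_add]
  exact congrArg₂ _ (ha (χ.comp (AddMonoidHom.inl A B))) (hb (χ.comp (AddMonoidHom.inr A B)))

lemma EvaluationProperty.of_equiv {A B : Type*} [AddCommGroup A] [AddCommGroup B] (e : A ≃+ B)
    (h : EvaluationProperty B) : EvaluationProperty A := by
  intro Λ hΛ
  obtain ⟨b, hb⟩ := h (Λ.comp (AddMonoidHom.compHom.flip e.toAddMonoidHom)) fun v => by
    obtain ⟨y, hy⟩ := hΛ (v.comp e.toAddMonoidHom)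
    exact ⟨y, fun q => hy q⟩
  refine ⟨e.symm b, fun χ => ?_⟩
  refine Eq.trans ?_ (hb (χ.comp e.symm.toAddMonoidHom))
  change Λ χ = Λ ((χ.comp e.symm.toAddMonoidHom).comp e.toAddMonoidHom)
  congr 1
  ext x
  simp

lemma evaluationProperty_of_fg (N : Type*) [AddCommGroup N] [AddGroup.FG N] :
    EvaluationProperty N := by
  obtain ⟨r, ι, _, p, hp, e, ⟨E⟩⟩ := AddCommGroup.equiv_free_prod_directSum_zmod N
  have : ∀ i, NeZero (p i ^ e i) := fun i => ⟨pow_ne_zero _ (hp i).ne_zero⟩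
  refine EvaluationProperty.of_equiv E (evaluationProperty_prod ?_ ?_)
  · exact EvaluationProperty.of_equiv (Finsupp.linearEquivFunOnFinite ℤ ℤ (Fin r)).toAddEquiv
      (evaluationProperty_pi fun _ => evaluationProperty_int)
  · exact EvaluationProperty.of_equiv (DirectSum.addEquivProd _)
      (evaluationProperty_pi fun _ => evaluationProperty_zmod _)

end Bidual

namespace StackyFan

variable {N : Type*} [AddCommGroup N] {n : ℕ} {X : StackyFan N n} {σ σ' : Finset (Fin n)}
  {j j' : Fin n}

/-- The elements of finite order of `G` are the `exp` of rational vectors. -/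
lemma exists_expLog_eq [AddGroup.FG N] {γ : X.LDual →+ AddCircle (1 : ℝ)} {m : ℕ} (hm : 0 < m)
    (hγ : m • γ = 0) : ∃ (a : Fin n → ℝ) (b : N) (h : ∑ i, a i • toReal (X.ρ i) = toReal b),
      (∀ i, 0 ≤ a i ∧ a i < 1) ∧ γ = X.expLog a b h := by
  have hmr : (m : ℝ) ≠ 0 := by exact_mod_cast hm.ne'
  -- The vector is forced by the values on the `Dᵢ`, which are rational modulo `ℤ` because `γ` has
  -- finite order.
  have hq : ∀ i, ∃ q : ℚ, (0 ≤ q ∧ q < 1) ∧ ((q : ℝ) : AddCircle (1 : ℝ)) = γ (X.D i) := by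
    intro i
    obtain ⟨t, ht⟩ := QuotientAddGroup.mk_surjective (γ (X.D i))
    change (t : AddCircle (1 : ℝ)) = _ at ht
    obtain ⟨s, hs⟩ : ∃ s : ℤ, (m : ℝ) * t = s := by
      rw [← realCircle_coe_eq_zero_iff, ← nsmul_eq_mul, AddCircle.coe_nsmul, ht,
        ← AddMonoidHom.nsmul_apply, hγ, AddMonoidHom.zero_apply]
    refine ⟨Int.fract (s / m : ℚ), ⟨Int.fract_nonneg _, Int.fract_lt_one _⟩, ?_⟩
    rw [← ht, realCircle_coe_eq_iff, Rat.cast_fract]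
    have : t = ((s / m : ℚ) : ℝ) := by
      push_cast
      rw [← hs]
      field_simp
    rw [← this]
    exact ⟨-⌊t⌋, by rw [Int.fract]; push_cast; ring⟩
  choose q hq01 hqγ using hq
  -- The term `χ(b)` still to be accounted for. It vanishes when `χ = 0`, so it descends to a
  -- homomorphism `Λ` on characters of `N`; on coboundaries it is linear because `γ` vanishes there,
  -- and so `Λ` is evaluation at some `b`.
  let V : X.cocycles →+ AddCircle (1 : ℝ) := AddMonoidHom.mk'
    (fun p => ((∑ i, (p.1.1 i : ℝ) * q i : ℝ) : AddCircle (1 : ℝ)) - γ (X.toLDual p)) (by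
      intro p p'
      simp only [AddSubgroup.coe_add, Prod.fst_add, Pi.add_apply, Rat.cast_add, add_mul,
        Finset.sum_add_distrib, map_add, AddCircle.coe_add]
      abel)
  have hV : ∀ p, V p = ((∑ i, (p.1.1 i : ℝ) * q i : ℝ) : AddCircle (1 : ℝ)) - γ (X.toLDual p) :=
    fun p => rfl
  have hV0 : ∀ p : X.cocycles, p.1.2 = 0 → V p = 0 := by
    intro p hp
    have hk : ∀ i, ∃ k : ℤ, p.1.1 i = k := fun i => by
      rw [← ratCircle_coe_eq_zero_iff, p.2 i, hp, AddMonoidHom.zero_apply]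
    choose k hk using hk
    have e : p = X.intCocycle k := Subtype.ext (Prod.ext (funext hk) hp)
    rw [hV]
    conv_lhs => rw [e, toLDual_intCocycle, map_sum]
    rw [sub_eq_zero, realCircle_coe_sum]
    refine Finset.sum_congr rfl fun i _ => ?_
    rw [map_zsmul, ← hqγ, ← AddCircle.coe_zsmul, zsmul_eq_mul]
    simp [intCocycle]
  have hVeq : ∀ p p' : X.cocycles, p.1.2 = p'.1.2 → V p = V p' := fun p p' h => by
    rw [← sub_eq_zero, ← map_sub]
    exact hV0 _ (by rw [AddSubgroup.coe_sub, Prod.snd_sub, h, sub_self])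
  have hVcob : ∀ v : N →+ ℚ, V (X.coboundary v) =
      ((∑ i, (v (X.ρ i) : ℝ) * q i : ℝ) : AddCircle (1 : ℝ)) := fun v => by
    rw [hV, toLDual_coboundary, map_zero, sub_zero]
    rfl
  choose P hP using X.exists_cocycle
  let Λ : (N →+ AddCircle (1 : ℚ)) →+ AddCircle (1 : ℝ) := AddMonoidHom.mk' (fun χ => V (P χ))
    fun χ χ' => by
      rw [← map_add]
      exact hVeq _ _ (by rw [hP, AddSubgroup.coe_add, Prod.snd_add, hP, hP])
  have hΛ : ∀ p : X.cocycles, Λ p.1.2 = V p := fun p => hVeq _ _ (hP _)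
  obtain ⟨b, hb⟩ := evaluationProperty_of_fg N Λ fun v => by
    refine ⟨∑ i, (v (X.ρ i) : ℝ) * q i, fun t => ?_⟩
    let w : N →+ ℚ := (AddMonoidHom.mulLeft t).comp ((Int.castAddHom ℚ).comp v)
    have e : (zmultiplesHom _ (t : AddCircle (1 : ℚ))).comp v = (X.coboundary w).1.2 := by
      ext x
      change v x • (t : AddCircle (1 : ℚ)) = ((t * (v x : ℚ) : ℚ) : AddCircle (1 : ℚ))
      rw [← AddCircle.coe_zsmul, zsmul_eq_mul, mul_comm]
    rw [e, hΛ, hVcob, Finset.mul_sum]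
    congr 1
    refine Finset.sum_congr rfl fun i _ => ?_
    simp [w, mul_assoc]
  have hrel : ∑ i, (q i : ℝ) • toReal (X.ρ i) = toReal b := by
    refine sum_smul_toReal_eq_zero fun v => ?_
    by_contra hne
    -- Scales `v` so that the discrepancy becomes `1/2`, whereas the coboundary of every rational
    -- functional requires an integer.
    let t : ℚ := 1 / (2 * (∑ i, v (X.ρ i) * q i - v b))
    let w : N →+ ℚ := (AddMonoidHom.mulLeft t).comp v
    have h1 := hVcob w
    rw [← hΛ, hb] at h1
    change ((((t * v b : ℚ)) : ℝ) : AddCircle (1 : ℝ)) =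
      ((∑ i, ((t * v (X.ρ i) : ℚ) : ℝ) * q i : ℝ) : AddCircle (1 : ℝ)) at h1
    obtain ⟨k, hk⟩ := realCircle_coe_eq_iff.1 h1
    have hk' : t * v b - ∑ i, (t * v (X.ρ i)) * q i = k := by exact_mod_cast hk
    have hne' : ∑ i, v (X.ρ i) * q i - v b ≠ 0 := sub_ne_zero.2 hne
    have h2 : t * (2 * (∑ i, v (X.ρ i) * q i - v b)) = 1 :=
      one_div_mul_cancel (mul_ne_zero two_ne_zero hne')
    have h3 : (-(2 * k) : ℚ) = 1 := by
      rw [← hk', ← h2]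
      simp only [mul_assoc, ← Finset.mul_sum]
      ring
    have h4 : -(2 * k) = 1 := by exact_mod_cast h3
    omega
  refine ⟨fun i => q i, b, hrel, fun i => ⟨Rat.cast_nonneg.2 (hq01 i).1,
    by dsimp only; exact_mod_cast (hq01 i).2⟩, hom_ext_toLDual fun p => ?_⟩
  rw [expLog_toLDual, ← hb, hΛ, hV, sub_sub_cancel]

/-- If the logarithms agree, the coordinates differ by integers in `(-1, 1)`, hence by zero; the
elements of `N` then agree, including their torsion part. -/
lemma Box.log_injective : Function.Injective (Box.log (X := X) (σ := σ)) := by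
  intro b b' h
  have h0 : X.expLog (Box.coord b - Box.coord b') ((b : N) - b') (by
      simp only [Pi.sub_apply, sub_smul, Finset.sum_sub_distrib, (Box.coord_spec b).2.2,
        (Box.coord_spec b').2.2, toReal_sub]) = 0 := by
    rw [expLog_sub _ _ _ _ _ (Box.coord_spec b).2.2 (Box.coord_spec b').2.2]
    exact sub_eq_zero.2 h
  obtain ⟨k, hk, hb⟩ := (X.expLog_eq_zero_iff _ _ _).1 h0
  have hk0 : ∀ i, k i = 0 := fun i => by
    have h1 := (Box.coord_spec b).1 i
    have h2 := (Box.coord_spec b').1 i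
    have h3 := hk i
    rw [Pi.sub_apply] at h3
    have h4 : (k i : ℝ) < 1 := by linarith
    have h5 : (-1 : ℝ) < k i := by linarith
    have h4' : k i < 1 := by exact_mod_cast h4
    have h5' : -1 < k i := by exact_mod_cast h5
    omega
  refine Subtype.ext (sub_eq_zero.1 ?_)
  rw [hb]
  simp [hk0]

/-- The order of the automorphism that corresponds to a box element of a ray. -/
lemma Box.addOrderOf_log {i : Fin n} (b : X.Box {i}) :
    addOrderOf (Box.log b) = addOrderOf ((b : N) : N ⧸ AddSubgroup.zmultiples (X.ρ i)) := by
  have hρ : toReal (X.ρ i) ≠ 0 :=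
    (X.simplicial _ (X.ray_mem i)).ne_zero ⟨i, Finset.mem_singleton_self i⟩
  have h0 : ∀ l, l ≠ i → Box.coord b l = 0 := fun l hl =>
    (Box.coord_spec b).2.1 l (by simpa using hl)
  have hb : Box.coord b i • toReal (X.ρ i) = toReal (b : N) := by
    rw [← (Box.coord_spec b).2.2]
    exact (Finset.sum_eq_single (f := fun l => Box.coord b l • toReal (X.ρ l)) i
      (fun l _ hl => by rw [h0 l hl, zero_smul]) (by simp)).symm
  rw [addOrderOf_eq_addOrderOf_iff]
  intro m
  rw [← QuotientAddGroup.mk_nsmul, QuotientAddGroup.eq_zero_iff, AddSubgroup.mem_zmultiples_iff,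
    Box.log, ← expLog_nsmul, expLog_eq_zero_iff]
  constructor
  · rintro ⟨k, hk, h⟩
    refine ⟨k i, ?_⟩
    rw [h, Finset.sum_eq_single i (fun l _ hl => ?_) (by simp)]
    have : (k l : ℝ) = 0 := by
      rw [← hk, Pi.smul_apply, h0 l hl, smul_zero]
    rw [show k l = 0 by exact_mod_cast this, zero_smul]
  · rintro ⟨k, hk⟩
    refine ⟨Pi.single i k, fun l => ?_, ?_⟩
    · by_cases hl : l = i
      · subst hl
        have h1 := congrArg toReal hk
        rw [toReal_zsmul, toReal_nsmul, ← hb, smul_smul] at h1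
        rw [Pi.single_eq_same, Pi.smul_apply, nsmul_eq_mul]
        exact (smul_left_injective ℝ hρ h1).symm
      · simp [hl, h0 l hl]
    · rw [← hk, Finset.sum_eq_single i (fun l _ hl => by simp [hl]) (by simp)]
      simp

end StackyFan

variable {N : Type*} [AddCommGroup N] {n : ℕ} {X : StackyFan N n} {σ σ' : Finset (Fin n)}
  {j j' : Fin n}

/-- The isotropy homomorphism is killed by `r₁`, so it is the exponential of a vector in `[0, 1)ⁿ`.
It is trivial on `Dᵢ` for `i ∉ σ`, where the coordinate is therefore an integer in `[0, 1)`. -/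
lemma ToricCurve.exists_givesZero [AddGroup.FG N] (H : X.AdjacentAlong σ σ' j j')
    (f : ToricCurve X σ σ') : ∃ b : X.Box σ, f.GivesZero b := by
  obtain ⟨a, b, h, ha, hγ⟩ := exists_expLog_eq (X := X) f.r₁.pos
    (γ := (logZero f.r₁ f.r₂).comp f.map.pic) (by
      rw [StackMor.nsmul_comp, nsmul_logZero, AddMonoidHom.zero_comp])
  have ha0 : ∀ i ∉ σ, a i = 0 := by
    intro i hi
    have h1 := f.logZero_pic_D_eq_zero H hi
    rw [← AddMonoidHom.comp_apply, hγ, expLog_D, realCircle_coe_eq_zero_iff] at h1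
    obtain ⟨k, hk⟩ := h1
    obtain ⟨h2, h3⟩ := ha i
    rw [hk] at h2 h3 ⊢
    have h2' : 0 ≤ k := by exact_mod_cast h2
    have h3' : k < 1 := by exact_mod_cast h3
    rw [show k = 0 by omega, Int.cast_zero]
  let B : X.Box σ := ⟨b, a, ha, ha0, h⟩
  refine ⟨B, (f.givesZero_iff B).2 (hγ.trans (expLog_congr ?_ rfl _ _))⟩
  exact coord_unique (X.simplicial σ H.adjacent.1) ha0 (Box.coord_spec B).2.1
    (h.trans (Box.coord_spec B).2.2.symm)

lemma ToricCurve.GivesZero.unique {f : ToricCurve X σ σ'} {b b' : X.Box σ} (h : f.GivesZero b)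
    (h' : f.GivesZero b') : b = b' := by
  rw [ToricCurve.givesZero_iff] at h h'
  exact Box.log_injective (h.symm.trans h')

end

/-! ### One-dimensional targets -/

section

open StackyFan orbiLine

section OneDimensional

variable {N : Type*} [AddCommGroup N] {X : StackyFan N 2}

lemma toReal_ray_ne_zero (i : Fin 2) : toReal (X.ρ i) ≠ 0 :=
  (X.simplicial _ (X.ray_mem i)).ne_zero ⟨i, Finset.mem_singleton_self i⟩

lemma adjacentAlong_of_dim_one (hX : X.dim = 1) : X.AdjacentAlong {0} {1} 0 1 where
  adjacent := ⟨X.ray_mem 0, X.ray_mem 1, by simp [hX], by simp [hX], by rw [hX]; decide⟩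
  left := by decide
  right := by decide

lemma StackyFan.Box.coord_one_eq_zero (b : X.Box {0}) : Box.coord b 1 = 0 :=
  (Box.coord_spec b).2.1 1 (by decide)

lemma StackyFan.Box.coord_zero_eq_zero (b : X.Box {1}) : Box.coord b 0 = 0 :=
  (Box.coord_spec b).2.1 0 (by decide)

lemma StackyFan.Box.toReal_zero_ray (b : X.Box {0}) :
    toReal (b : N) = Box.coord b 0 • toReal (X.ρ 0) := by
  rw [← (Box.coord_spec b).2.2, Fin.sum_univ_two, Box.coord_one_eq_zero, zero_smul, add_zero]

lemma StackyFan.Box.toReal_one_ray (b : X.Box {1}) :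
    toReal (b : N) = Box.coord b 1 • toReal (X.ρ 1) := by
  rw [← (Box.coord_spec b).2.2, Fin.sum_univ_two, Box.coord_zero_eq_zero, zero_smul, zero_add]

variable {w₁ w₂ : ℕ}

lemma real_relation (hw : w₂ • X.ρ 0 + w₁ • X.ρ 1 = 0) :
    (w₂ : ℝ) • toReal (X.ρ 0) + (w₁ : ℝ) • toReal (X.ρ 1) = 0 := by
  rw [← toReal_nsmul, ← toReal_nsmul, ← toReal_add, hw, toReal_zero]

/-- With `l` fixed by the coefficient of `ρ̄₁`, subtracting `l` times the given relation leaves a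
multiple of `ρ̄₂ ≠ 0`, which must vanish. Positivity is the nontriviality condition: if `l ≤ 0`, all
the nonnegative terms are zero. -/
lemma BoxRelation.exists_degree (h₁ : 0 < w₁) (h₂ : 0 < w₂)
    (hw : w₂ • X.ρ 0 + w₁ • X.ρ 1 = 0) (d : BoxRelation X) :
    ∃ l : ℚ, 0 < l ∧ (w₂ : ℝ) * l = d.q₁ + Box.coord d.b₁ 0 ∧
      (w₁ : ℝ) * l = d.q₂ + Box.coord d.b₂ 1 := by
  have h₁' : (0 : ℝ) < w₁ := by exact_mod_cast h₁
  have h₂' : (0 : ℝ) < w₂ := by exact_mod_cast h₂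
  obtain ⟨q, hq⟩ := Box.exists_rat_coord (X.ray_mem 0) d.b₁
  let l : ℚ := (d.q₁ + q 0) / w₂
  have hl : (w₂ : ℝ) * l = d.q₁ + Box.coord d.b₁ 0 := by
    rw [hq]
    simp only [l]
    push_cast
    field_simp
  have hrel := congrArg toReal d.rel
  rw [toReal_add, toReal_add, toReal_add, toReal_nsmul, toReal_nsmul, Box.toReal_zero_ray,
    Box.toReal_one_ray, toReal_zero] at hrel
  have hrel' := congrArg (fun v => (l : ℝ) • v) (real_relation hw)
  simp only [smul_add, smul_smul, smul_zero] at hrel'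
  have h0 : ((d.q₂ : ℝ) + Box.coord d.b₂ 1 - w₁ * l) • toReal (X.ρ 1) = 0 := by
    rw [mul_comm (l : ℝ), mul_comm (l : ℝ), hl] at hrel'
    rw [sub_smul, add_smul, sub_eq_zero]
    rw [add_smul] at hrel'
    refine add_left_cancel (a := (d.q₁ : ℝ) • toReal (X.ρ 0) +
      Box.coord d.b₁ 0 • toReal (X.ρ 0)) ?_
    rw [hrel', ← hrel]
    abel
  have hl' : (w₁ : ℝ) * l = d.q₂ + Box.coord d.b₂ 1 :=
    (sub_eq_zero.1 ((smul_eq_zero.1 h0).resolve_right (toReal_ray_ne_zero 1))).symm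
  refine ⟨l, ?_, hl, hl'⟩
  have hf₁ := ((Box.coord_spec d.b₁).1 0).1
  have hf₂ := ((Box.coord_spec d.b₂).1 1).1
  have hq₁ : (0 : ℝ) ≤ d.q₁ := Nat.cast_nonneg _
  have hq₂ : (0 : ℝ) ≤ d.q₂ := Nat.cast_nonneg _
  by_contra hneg
  have hneg' : (l : ℝ) ≤ 0 := by exact_mod_cast not_lt.1 hneg
  have e₁ : (w₂ : ℝ) * l ≤ 0 := mul_nonpos_of_nonneg_of_nonpos h₂'.le hneg'
  have e₂ : (w₁ : ℝ) * l ≤ 0 := mul_nonpos_of_nonneg_of_nonpos h₁'.le hneg'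
  refine d.nontrivial ⟨?_, ?_, ?_, ?_⟩
  · have : (d.q₁ : ℝ) = 0 := by linarith
    exact_mod_cast this
  · have : (d.q₂ : ℝ) = 0 := by linarith
    exact_mod_cast this
  · rw [Box.toReal_zero_ray, show Box.coord d.b₁ 0 = 0 by linarith, zero_smul]
  · rw [Box.toReal_one_ray, show Box.coord d.b₂ 1 = 0 by linarith, zero_smul]

lemma nat_eq_of_add_eq {q q' : ℕ} {f f' : ℝ} (h : (q : ℝ) + f = q' + f') (h0 : 0 ≤ f)
    (h1 : f < 1) (h0' : 0 ≤ f') (h1' : f' < 1) : q = q' := by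
  have e1 : (q : ℝ) < q' + 1 := by linarith
  have e2 : (q' : ℝ) < q + 1 := by linarith
  have e1' : q < q' + 1 := by exact_mod_cast e1
  have e2' : q' < q + 1 := by exact_mod_cast e2
  omega

lemma BoxRelation.eq_of_degree_eq {d d' : BoxRelation X} {l : ℝ} (hb : d.b₁ = d'.b₁)
    (h₁ : (w₂ : ℝ) * l = d.q₁ + Box.coord d.b₁ 0) (h₂ : (w₁ : ℝ) * l = d.q₂ + Box.coord d.b₂ 1)
    (h₁' : (w₂ : ℝ) * l = d'.q₁ + Box.coord d'.b₁ 0)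
    (h₂' : (w₁ : ℝ) * l = d'.q₂ + Box.coord d'.b₂ 1) : d = d' := by
  have hq₁ := nat_eq_of_add_eq (h₁.symm.trans h₁') ((Box.coord_spec d.b₁).1 0).1
    ((Box.coord_spec d.b₁).1 0).2 ((Box.coord_spec d'.b₁).1 0).1 ((Box.coord_spec d'.b₁).1 0).2
  have hq₂ := nat_eq_of_add_eq (h₂.symm.trans h₂') ((Box.coord_spec d.b₂).1 1).1
    ((Box.coord_spec d.b₂).1 1).2 ((Box.coord_spec d'.b₂).1 1).1 ((Box.coord_spec d'.b₂).1 1).2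
  have hrel := d.rel
  have hrel' := d'.rel
  rw [hb, hq₁, hq₂, ← hrel', add_right_inj] at hrel
  have hb₂ : d.b₂ = d'.b₂ := Subtype.ext hrel
  obtain ⟨_, _, _, _, _, _⟩ := d
  obtain ⟨_, _, _, _, _, _⟩ := d'
  dsimp only at hb hb₂ hq₁ hq₂
  subst hb hb₂ hq₁ hq₂
  rfl

/-- `q₂` is the integral part of `w₁ l`, and the relation forces `b₂`; the real relation shows that
its coordinate is the fractional part of `w₁ l`. -/
lemma exists_boxRelation (h₂ : 0 < w₂) (hw : w₂ • X.ρ 0 + w₁ • X.ρ 1 = 0)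
    (e : BoxDegree X w₂) : ∃ d : BoxRelation X, d.b₁ = e.b₁ ∧
      (w₂ : ℝ) * e.l = d.q₁ + Box.coord d.b₁ 0 := by
  obtain ⟨k, hk⟩ := e.integral
  have hl : (0 : ℝ) < e.l := by exact_mod_cast e.pos
  have hwl : (0 : ℝ) ≤ w₁ * e.l := by positivity
  let q₂ : ℕ := ⌊(w₁ : ℝ) * e.l⌋₊
  have hq₂ : (q₂ : ℝ) ≤ w₁ * e.l := Nat.floor_le hwl
  have hq₂' : (w₁ : ℝ) * e.l < q₂ + 1 := Nat.lt_floor_add_one _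
  have hrel' := congrArg (fun v => (e.l : ℝ) • v) (real_relation hw)
  simp only [smul_add, smul_smul, smul_zero] at hrel'
  rw [mul_comm (e.l : ℝ), mul_comm (e.l : ℝ)] at hrel'
  have hkl : (w₂ : ℝ) * e.l = k + Box.coord e.b₁ 0 := by linarith
  let b₂ : X.Box {1} := ⟨-(k • X.ρ 0 + q₂ • X.ρ 1 + e.b₁), ![0, w₁ * e.l - q₂], by
      intro i
      fin_cases i
      · simp
      · change 0 ≤ (w₁ : ℝ) * e.l - q₂ ∧ (w₁ : ℝ) * e.l - q₂ < 1
        constructor <;> linarith, by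
      intro i hi
      fin_cases i
      · rfl
      · simp at hi, by
      rw [Fin.sum_univ_two, toReal_neg, toReal_add, toReal_add, toReal_nsmul, toReal_nsmul,
        Box.toReal_zero_ray]
      change (0 : ℝ) • toReal (X.ρ 0) + ((w₁ : ℝ) * e.l - q₂) • toReal (X.ρ 1) = _
      rw [zero_smul, zero_add, sub_smul, eq_neg_of_add_eq_zero_right hrel', hkl, add_smul]
      abel⟩
  refine ⟨⟨e.b₁, b₂, k, q₂, add_neg_cancel _, ?_⟩, rfl, hkl⟩
  rintro ⟨rfl, -, h, -⟩
  rw [Box.toReal_zero_ray, smul_eq_zero, or_iff_left (toReal_ray_ne_zero 0)] at h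
  rw [h, Nat.cast_zero, add_zero] at hkl
  have : (0 : ℝ) < w₂ * e.l := by positivity
  linarith

/-- Relations between box elements correspond to their degrees. -/
lemma exists_boxRelation_equiv (h₁ : 0 < w₁) (h₂ : 0 < w₂)
    (hw : w₂ • X.ρ 0 + w₁ • X.ρ 1 = 0) : ∃ E : BoxRelation X ≃ BoxDegree X w₂,
      ∀ d, (E d).b₁ = d.b₁ ∧ (w₂ : ℝ) * (E d).l = d.q₁ + Box.coord d.b₁ 0 ∧
        (w₁ : ℝ) * (E d).l = d.q₂ + Box.coord d.b₂ 1 := by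
  choose l hl hl₁ hl₂ using BoxRelation.exists_degree (X := X) h₁ h₂ hw
  let F : BoxRelation X → BoxDegree X w₂ := fun d =>
    ⟨d.b₁, l d, hl d, d.q₁, by rw [hl₁, add_sub_cancel_right]⟩
  have h₂' : (w₂ : ℝ) ≠ 0 := by exact_mod_cast h₂.ne'
  refine ⟨Equiv.ofBijective F ⟨fun d d' h => ?_, fun e => ?_⟩, fun d => ⟨rfl, hl₁ d, hl₂ d⟩⟩
  · have hl' : l d = l d' := congrArg BoxDegree.l h
    refine BoxRelation.eq_of_degree_eq (congrArg BoxDegree.b₁ h) (hl₁ d) (hl₂ d) ?_ ?_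
    · rw [hl', hl₁]
    · rw [hl', hl₂]
  · obtain ⟨d, hd, hdl⟩ := exists_boxRelation h₂ hw e
    refine ⟨d, ?_⟩
    have hle : l d = e.l := by
      have := (hl₁ d).trans hdl.symm
      exact_mod_cast mul_left_cancel₀ h₂' this
    obtain ⟨_, _, _, _⟩ := e
    simp only [F, BoxDegree.mk.injEq]
    exact ⟨hd, hle⟩

/-- Toric morphisms to a one-dimensional toric stack are classified by the box element at `0` and
the degree. -/
lemma exists_classes_equiv [AddGroup.FG N] (hX : X.dim = 1) (h₂ : 0 < w₂) :
    ∃ E : ToricCurve.Classes X {0} {1} ≃ BoxDegree X w₂, ∀ f : ToricCurve X {0} {1},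
      f.GivesZero (E (Quotient.mk _ f)).b₁ ∧
        f.degree (X.D 0) = w₂ * (E (Quotient.mk _ f)).l := by
  have H := adjacentAlong_of_dim_one hX
  have hw : (w₂ : ℚ) ≠ 0 := by exact_mod_cast h₂.ne'
  have hw' : (w₂ : ℝ) ≠ 0 := by exact_mod_cast h₂.ne'
  choose b hb using fun f : ToricCurve X {0} {1} => f.exists_givesZero H
  let F : ToricCurve X {0} {1} → BoxDegree X w₂ := fun f =>
    ⟨b f, f.degree (X.D 0) / w₂, div_pos (f.degree_pos H) (by positivity),
      ⌊f.degree (X.D 0)⌋₊, by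
        have e : ((⌊f.degree (X.D 0)⌋₊ : ℕ) : ℚ) + Int.fract (f.degree (X.D 0)) =
            f.degree (X.D 0) := by
          rw [natCast_floor_eq_intCast_floor (f.degree_pos H).le, Int.floor_add_fract]
        rw [← (hb f).fract_degree H, Rat.cast_div, Rat.cast_natCast, mul_div_cancel₀ _ hw',
          sub_eq_iff_eq_add]
        exact_mod_cast e.symm⟩
  have hF : ∀ f f', ToricCurve.Iso f f' → F f = F f' := by
    intro f f' h
    simp only [F, BoxDegree.mk.injEq]
    exact ⟨(h.givesZero (hb f)).unique (hb f'), by rw [h.degree_eq]⟩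
  let F' : ToricCurve.Classes X {0} {1} → BoxDegree X w₂ := Quotient.lift F hF
  refine ⟨Equiv.ofBijective F' ⟨?_, ?_⟩, fun f => ⟨hb f, (mul_div_cancel₀ _ hw).symm⟩⟩
  · rintro ⟨f⟩ ⟨f'⟩ h
    have h' : F f = F f' := h
    simp only [F, BoxDegree.mk.injEq] at h'
    exact Quotient.sound (ToricCurve.iso_of_degree_eq H (hb f) (h'.1 ▸ hb f')
      ((div_left_inj' hw).1 h'.2))
  · rintro ⟨b₁, l, hl, k, hk⟩
    -- Since `0 ≤ f₁ < 1`, integrality of `w₂ l - f₁` means that `f₁` is the fractional part of the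
    -- degree `w₂ l`.
    obtain ⟨f, hf, hfl⟩ := ToricCurve.exists_of_degree H b₁ (c := w₂ * l) (by positivity) (by
      rw [Rat.cast_fract, Int.fract_eq_iff]
      refine ⟨((Box.coord_spec b₁).1 0).1, ((Box.coord_spec b₁).1 0).2, k, ?_⟩
      rw [Rat.cast_mul, Rat.cast_natCast, Int.cast_natCast, hk])
    refine ⟨Quotient.mk _ f, ?_⟩
    change F f = _
    simp only [F, BoxDegree.mk.injEq]
    exact ⟨(hb f).unique hf, by rw [hfl, mul_div_cancel_left₀ _ hw]⟩

lemma degree_D_one [AddGroup.FG N] (hX : X.dim = 1) (hw : w₂ • X.ρ 0 + w₁ • X.ρ 1 = 0)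
    (f : ToricCurve X {0} {1}) {l : ℚ} (hl : f.degree (X.D 0) = w₂ * l) :
    f.degree (X.D 1) = w₁ * l := by
  have hrel' := congrArg (fun v => (l : ℝ) • v) (real_relation hw)
  simp only [smul_add, smul_smul, smul_zero] at hrel'
  have hnone : ∀ i : Fin 2, i ∉ ({0} : Finset (Fin 2)) → i ∉ ({1} : Finset (Fin 2)) → False := by
    decide
  have hnone : ∀ i : Fin 2, i ∉ ({0} : Finset (Fin 2)) → i ∉ ({1} : Finset (Fin 2)) → False := by
    decide
  refine congrFun ((adjacentAlong_of_dim_one hX).relation_unique (d := fun i => f.degree (X.D i))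
    (d' := ![w₂ * l, w₁ * l]) (ratHom_relation _) ?_ (fun i hi hi' => (hnone i hi hi').elim)
    (fun i hi hi' => (hnone i hi hi').elim) hl) 1
  rw [Fin.sum_univ_two, ← hrel']
  simp [mul_comm]

/-- The difference of the two sides is the exponential of the integral vector `(q₁, q₂)` paired with
`-(b₁ + b₂) = q₁ρ₁ + q₂ρ₂`, which is trivial by `expLog_eq_zero_iff`. -/
lemma log_add_log [AddGroup.FG N] {d : BoxRelation X} {l : ℚ}
    (hl₁ : (w₂ : ℝ) * l = d.q₁ + Box.coord d.b₁ 0) (hl₂ : (w₁ : ℝ) * l = d.q₂ + Box.coord d.b₂ 1)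
    {δ : X.LDual →+ ℚ} (h₀ : δ (X.D 0) = w₂ * l) (h₁ : δ (X.D 1) = w₁ * l) :
    ratReduce.comp δ = Box.log d.b₁ + Box.log d.b₂ := by
  have hδ : δ = X.degLift (fun i => δ (X.D i)) (ratHom_relation δ) :=
    ratHom_ext fun i => by rw [degLift_D]
  have e1 : ratReduce.comp δ = X.expLog (fun i => δ (X.D i)) 0
      ((ratHom_relation δ).trans toReal_zero.symm) := by
    conv_lhs => rw [hδ]
    exact AddMonoidHom.ext fun x => X.coe_degLift _ _ x
  have hsum : ∑ i, (Box.coord d.b₁ + Box.coord d.b₂) i • toReal (X.ρ i) =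
      toReal ((d.b₁ : N) + d.b₂) := by
    simp only [Pi.add_apply, add_smul, Finset.sum_add_distrib, (Box.coord_spec _).2.2, toReal_add]
  have hdiff : ∑ i, ((fun i => (δ (X.D i) : ℝ)) - (Box.coord d.b₁ + Box.coord d.b₂)) i •
      toReal (X.ρ i) = toReal (0 - ((d.b₁ : N) + d.b₂)) := by
    simp only [Pi.sub_apply, sub_smul, Finset.sum_sub_distrib, hsum, ratHom_relation, toReal_sub,
      toReal_zero]
  rw [e1, Box.log, Box.log, ← X.expLog_add _ _ _ _ _ _ hsum, ← sub_eq_zero,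
    ← X.expLog_sub _ _ _ _ _ _ hdiff, expLog_eq_zero_iff]
  refine ⟨![d.q₁, d.q₂], fun i => ?_, ?_⟩
  · fin_cases i
    · simp [h₀, hl₁, Box.coord_zero_eq_zero]
    · simp [h₁, hl₂, Box.coord_one_eq_zero]
  · rw [Fin.sum_univ_two, zero_sub, neg_eq_iff_add_eq_zero, ← d.rel]
    simp only [Matrix.cons_val_zero, Matrix.cons_val_one, natCast_zsmul]
    abel

lemma floor_fract_of_eq {l : ℚ} {w q : ℕ} {t : ℝ} (h : (w : ℝ) * l = q + t) (h0 : 0 ≤ t)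
    (h1 : t < 1) : (q : ℤ) = ⌊l * w⌋ ∧ t = (Int.fract (l * w) : ℚ) := by
  have e : ((l * w : ℚ) : ℝ) = q + t := by
    push_cast
    rw [← h, mul_comm]
  constructor
  · rw [← Rat.floor_cast (α := ℝ), e, eq_comm, Int.floor_eq_iff, Int.cast_natCast]
    constructor <;> linarith
  · rw [Rat.cast_fract, e, eq_comm, Int.fract_eq_iff]
    exact ⟨h0, h1, q, by rw [Int.cast_natCast]; ring⟩

end OneDimensional

end

end

theorem mainTheorem8 {N : Type*} [AddCommGroup N] [AddGroup.FG N] :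
    -- The one-dimensional case; the cones are `σ₁ = {0}` and `σ₂ = {1}`.
    (∀ X : StackyFan N 2, X.dim = 1 → X.Complete →
      ∀ w₁ w₂ : ℕ, 0 < w₁ → 0 < w₂ → w₂ • X.ρ 0 + w₁ • X.ρ 1 = 0 →
      (∀ a₁ a₂ : ℤ, a₁ • X.ρ 0 + a₂ • X.ρ 1 = 0 → ∃ k : ℤ, a₁ = k * w₂ ∧ a₂ = k * w₁) →
      ∃ (E : ToricCurve.Classes X {0} {1} ≃ BoxRelation X) (E' : BoxRelation X ≃ BoxDegree X w₂),
        (∀ (f : ToricCurve X {0} {1}) (d : BoxRelation X),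
          E (Quotient.mk (ToricCurve.setoid X {0} {1}) f) = d →
            f.GivesZero d.b₁ ∧ f.GivesInfty d.b₂ ∧
            addOrderOf ((d.b₁ : N) : N ⧸ AddSubgroup.zmultiples (X.ρ 0)) = (f.r₁ : ℕ) ∧
            addOrderOf ((d.b₂ : N) : N ⧸ AddSubgroup.zmultiples (X.ρ 1)) = (f.r₂ : ℕ) ∧
            f.map.HasDegree 0 (w₂ * (E' d).l) ∧ f.map.HasDegree 1 (w₁ * (E' d).l)) ∧
        (∀ d : BoxRelation X,
          (E' d).b₁ = d.b₁ ∧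
          ((E' d).l : ℝ) = (d.q₁ + StackyFan.Box.coord d.b₁ 0) / w₂ ∧
          ((E' d).l : ℝ) = (d.q₂ + StackyFan.Box.coord d.b₂ 1) / w₁ ∧
          (d.q₁ : ℤ) = ⌊(E' d).l * w₂⌋ ∧
          (d.q₂ : ℤ) = ⌊(E' d).l * w₁⌋ ∧
          StackyFan.Box.coord d.b₁ 0 = (Int.fract ((E' d).l * w₂) : ℚ) ∧
          StackyFan.Box.coord d.b₂ 1 = (Int.fract ((E' d).l * w₁) : ℚ))) ∧
    -- The general case.
    (∀ (n : ℕ) (X : StackyFan N n) (σ σ' : Finset (Fin n)), X.Adjacent σ σ' →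
      ∀ j : Fin n, j ∈ σ → j ∉ σ' → ∀ b : X.Box σ,
      ∃ E : ToricCurve.ClassesAt X σ σ' (StackyFan.Box.hat b) ≃
          {c : ℚ // 0 < c ∧ ((Int.fract c : ℚ) : ℝ) =
            StackyFan.Box.coord (StackyFan.Box.hat b) j},
        ∀ f : {f : ToricCurve X σ σ' // f.GivesZero (StackyFan.Box.hat b)},
          f.1.map.HasDegree j
            (E (Quotient.mk ((ToricCurve.setoid X σ σ').comap Subtype.val) f) : ℚ)) := by
  refine ⟨fun X hX _ w₁ w₂ h₁ h₂ hw _ => ?_, fun n X σ σ' hadj j hj hj' b => ?_⟩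
  · obtain ⟨E₁, hE₁⟩ := exists_classes_equiv (w₂ := w₂) hX h₂
    obtain ⟨E₂, hE₂⟩ := exists_boxRelation_equiv h₁ h₂ hw
    have h₁' : (w₁ : ℝ) ≠ 0 := by exact_mod_cast h₁.ne'
    have h₂' : (w₂ : ℝ) ≠ 0 := by exact_mod_cast h₂.ne'
    refine ⟨E₁.trans E₂.symm, E₂, fun f d hfd => ?_, fun d => ?_⟩
    · have hE : E₁ (Quotient.mk _ f) = E₂ d := E₂.symm_apply_eq.1 hfd
      obtain ⟨hb, hd₀⟩ := hE₁ f
      obtain ⟨hb₁, hl₁, hl₂⟩ := hE₂ d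
      rw [hE, hb₁] at hb
      rw [hE] at hd₀
      have hd₁ := degree_D_one hX hw f hd₀
      have hlog := log_add_log hl₁ hl₂ hd₀ hd₁
      have hz := (f.givesZero_iff _).1 hb
      -- The isotropy at `∞` is the degree modulo `ℤ` minus the isotropy at `0`, here `(b₁ + b₂) -
      -- b₁` in terms of logarithms.
      have hinf : (orbiLine.logInfty f.r₁ f.r₂).comp f.map.pic = StackyFan.Box.log d.b₂ := by
        rw [f.logInfty_comp_pic, hlog, hz, add_sub_cancel_left]
      obtain ⟨ho₁, ho₂⟩ := f.map.representable_iff.1 f.representable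
      refine ⟨hb, (f.givesInfty_iff _).2 hinf, ?_, ?_, ?_, ?_⟩
      · rw [← StackyFan.Box.addOrderOf_log, ← hz, ho₁]
      · rw [← StackyFan.Box.addOrderOf_log, ← hinf, ho₂]
      · rw [← hd₀]
        exact f.hasDegree_degree 0
      · rw [← hd₁]
        exact f.hasDegree_degree 1
    · obtain ⟨hb₁, hl₁, hl₂⟩ := hE₂ d
      obtain ⟨hq₁, hf₁⟩ := floor_fract_of_eq hl₁ ((StackyFan.Box.coord_spec d.b₁).1 0).1
        ((StackyFan.Box.coord_spec d.b₁).1 0).2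
      obtain ⟨hq₂, hf₂⟩ := floor_fract_of_eq hl₂ ((StackyFan.Box.coord_spec d.b₂).1 1).1
        ((StackyFan.Box.coord_spec d.b₂).1 1).2
      refine ⟨hb₁, ?_, ?_, hq₁, hq₂, hf₁, hf₂⟩
      · rw [← hl₁, mul_div_cancel_left₀ _ h₂']
      · rw [← hl₂, mul_div_cancel_left₀ _ h₁']
  · obtain ⟨j', H⟩ := hadj.exists_along hj hj'
    exact ToricCurve.exists_classesAt_equiv H (StackyFan.Box.hat b)
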